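/- **Setting.** A time-dependent network is a strongly connected directed graph $G=(V,A)$ with $n\ge 1$ vertices and out-degree at most $2$, in which every arc $uv$ carries a positive, continuous, piecewise-linear, $T$-periodic travel-time function $D[uv]:\mathbb R\to\mathbb R_{>0}$ given by its breakpoints on $[0,T]$, with the FIFO property: $t\mapsto t+D[uv](t)$ is non-decreasing. $D[o,d](t)$ is the shortest travel time from $o$ to $d$ for departure time $t$. Let $K$ be the total number of breakpoints of the arc functions, and $K^*$ the total number of breakpoints in $[0,T)$ at which the slope of a (periodic) arc function increases. Fix constants $0\le\Lambda_{\min}<1$, $\Lambda_{\max}\ge 0$, $\zeta\ge 1$, $\varepsilon>0$, an integer $r\ge 0$ and $a\in(0,\frac1{r+1})$, and assume, for all vertices $o,d$: * (bounded slopes) $\frac{D[o,d](t_1)-D[o,d](t_2)}{t_1-t_2}\in[-\Lambda_{\min},\Lambda_{\max}]$ for all $t_1<t_2$; * (bounded opposite trips) $D[o,d](t)\le\zeta\, D[d,o](t)$ for all $t\in[0,T)$; * for constants $B,c$: $K^*\le B(1+\ln n)^c$, $K\le Bn(1+\ln n)^c$, and $\ln\big(T/D[uv](t)\big)\le B(1+\ln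 n)^c$ for all arcs $uv$ and all $t$. **Oracle.** A landmark set $L\subseteq V$ contains every vertex independently with probability $\rho=n^{-a}$. *Preprocessing:* for every concavity-spoiling breakpoint $t_u$ of an arc leaving $u$, a backward run of the time-dependent Dijkstra algorithm finds the latest departure times from all vertices that reach $u$ by time $t_u$; for each landmark $\ell$ these times, modulo $T$, cut $[0,T]$ into intervals. In each interval $[t_s,t_f]$ the method BISECT samples all $D[\ell,v]$ and their one-sided derivatives at both ends and halves the interval, recursively, for those $v$ for which the maximum absolute error between the tangents and the chord exceeds $\varepsilon\min\{D[\ell,v](t_s),D[\ell,v](t_f)\}$. It stores as summary $\Delta[\ell,v]$ the piecewise-linear function through the sample points of $v$ and, between consecutive ones, the intersection points of the tangents. *Query* $(o,d,t_o)$, by the recursive algorithm RQA with recursion budget $r$: from a center $(w,t)$, starting with $(o,t_o)$, if $w\in L$ the candidate arrival time at $d$ is $t+\Delta[w,d](t)$; otherwise a time-dependent Dijkstra ball is grown until $d$ (exact candidate) or a first landmark $\ell$ is settled, at a time $x$ (candidate $x+\Delta[\ell,d](x)$). In the latter case, while budget remains, the algorithm recurs from the heads outside the ball of all arcs that leave the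 ball, with their tentative arrival times. The answer is the smallest candidate minus $t_o$. Space is counted in memory words (of the network and the stored summaries), and time in steps of a random access machine that operates on real numbers (arithmetic, comparison and floor at unit cost) and starts with blank memory; priority queues are leftist heaps, and piecewise-linear functions are evaluated by binary search. **Theorem.** Let $$\psi=1+\Lambda_{\max}(1+\varepsilon)(1+2\zeta+\Lambda_{\max}\zeta)+(1+\varepsilon)\zeta,\qquad \gamma=\frac{(1+\varepsilon/\psi)^{r+1}}{(1+\varepsilon/\psi)^{r+1}-1}.$$ Then $\gamma>1$, and there are constants $C,k$, which depend only on $r,a,\varepsilon,\zeta,\Lambda_{\min},\Lambda_{\max},B,c$, such that for every such network: 1. for every landmark set $L$, the preprocessing terminates, and every query $(o,d,t_o)\in V\times V\times[0,T)$ terminates with a value $A$ satisfying $D[o,d](t_o)\le A\le(1+\gamma\varepsilon)\,D[o,d](t_o)$; 2. the expected preprocessing space and the expected preprocessing time are each at most $C\,n^{2-a}(1+\ln n)^k$, that is $\tilde O(n^{2-a})$; 3. for every query, the expected query time is at most $C\,n^{(1+r)a}(1+\ln n)^k$, that is $\tilde O(n^{(1+r)a})$. The bound in 2 is $o(n^2)$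 and the bound in 3 is $o(n)$. -/

import Mathlib

open scoped BigOperators

noncomputable section

namespace TDOracle

/-! ## Piecewise-linear periodic delays and time-dependent networks -/

/-- Linear interpolation through a list of points with increasing abscissae
(used only for `s` between the first and the last abscissa). -/
def interp : List (ℝ × ℝ) → ℝ → ℝ
  | p :: q :: rest, s =>
      if s ≤ q.1 then p.2 + (q.2 - p.2) / (q.1 - p.1) * (s - p.1) else interp (q :: rest) s
  | _, _ => 0

/-- A positive, continuous, piecewise-linear, `T`-periodic function, represented by the array of
its breakpoints on `[0, T]`. The first breakpoint is at time `0`, the last one is at time `T`, and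
both carry the same value. -/
structure Profile (T : ℝ) where
  pts : Array (ℝ × ℝ)
  base : ℝ
  sorted : pts.toList.Pairwise (fun p q => p.1 < q.1)
  first : pts.toList.head? = some (0, base)
  last : pts.toList.getLast? = some (T, base)
  pos : ∀ p ∈ pts.toList, 0 < p.2

/-- The travel time at departure time `t`. -/
def Profile.delay {T : ℝ} (P : Profile T) (t : ℝ) : ℝ :=
  interp P.pts.toList (T * Int.fract (t / T))

/-- The slope of the segment from `p` to `q`. -/
def slope2 (p q : ℝ × ℝ) : ℝ := (q.2 - p.2) / (q.1 - p.1)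

/-- Slope of the last segment of a list of points. -/
def lastSlope (l : List (ℝ × ℝ)) : ℝ :=
  match l.reverse with
  | q :: p :: _ => slope2 p q
  | _ => 0

/-- Abscissae at which the slope increases, when the slope before the first point is `σ`. -/
def spoilAux : ℝ → List (ℝ × ℝ) → List ℝ
  | σ, p :: q :: rest =>
      if σ < slope2 p q then p.1 :: spoilAux (slope2 p q) (q :: rest)
      else spoilAux (slope2 p q) (q :: rest)
  | _, _ => []

/-- The concavity-spoiling breakpoints in `[0, T)` of the periodic function: those at which the
slope increases. The slope before time `0` is, by periodicity, the slope of the last segment. -/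
def Profile.spoilTimes {T : ℝ} (P : Profile T) : List ℝ :=
  spoilAux (lastSlope P.pts.toList) P.pts.toList

/-- A time-dependent network on `n` vertices: `out u` lists the arcs leaving `u`, each as a pair
of its head and its delay function. -/
structure Network (n : ℕ) where
  T : ℝ
  T_pos : 0 < T
  out : Fin n → List (Fin n × Profile T)

variable {n : ℕ}

/-- `G.IsPath o p d`: the arc sequence `p` leads from `o` to `d`. -/
def Network.IsPath (G : Network n) : Fin n → List (Fin n × Profile G.T) → Fin n → Prop
  | o, [], d => o = d
  | o, e :: p, d => e ∈ G.out o ∧ G.IsPath e.1 p d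

/-- Arrival time of an arc sequence, as a function of the departure time. -/
def Network.pathArr (G : Network n) : List (Fin n × Profile G.T) → ℝ → ℝ
  | [], t => t
  | e :: p, t => G.pathArr p (t + e.2.delay t)

/-- Earliest arrival time at `d` when departing from `o` at time `t`. -/
def Network.arr (G : Network n) (o d : Fin n) (t : ℝ) : ℝ :=
  sInf {s | ∃ p, G.IsPath o p d ∧ s = G.pathArr p t}

/-- Shortest travel time `D[o,d](t)`. -/
def Network.dist (G : Network n) (o d : Fin n) (t : ℝ) : ℝ := G.arr o d t - t

def Network.StronglyConnected (G : Network n) : Prop := ∀ o d, ∃ p, G.IsPath o p d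

/-- The FIFO property: all arc-arrival functions are non-decreasing. -/
def Network.FIFO (G : Network n) : Prop :=
  ∀ u, ∀ e ∈ G.out u, Monotone (fun t : ℝ => t + e.2.delay t)

/-- Bounded travel-time slopes. -/
def Network.BoundedSlopes (G : Network n) (lmin lmax : ℝ) : Prop :=
  ∀ o d, ∀ t₁ t₂ : ℝ, t₁ < t₂ →
    (G.dist o d t₁ - G.dist o d t₂) / (t₁ - t₂) ∈ Set.Icc (-lmin) lmax

/-- Bounded opposite trips. -/
def Network.BoundedOpposite (G : Network n) (ζ : ℝ) : Prop :=
  ∀ o d, ∀ t ∈ Set.Ico 0 G.T, G.dist o d t ≤ ζ * G.dist d o t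

/-- Total number `K` of breakpoints of the arc-delay functions. -/
def Network.numBreakpoints (G : Network n) : ℕ :=
  ∑ u, ((G.out u).map (fun e => e.2.pts.size)).sum

/-- Degree of disconcavity `K*`: total number of concavity-spoiling breakpoints. -/
def Network.disconcavity (G : Network n) : ℕ :=
  ∑ u, ((G.out u).map (fun e => e.2.spoilTimes.length)).sum

/-! ## Programs with a step count

A program either diverges (`none`) or returns a value and the updated step counter. The cost model
is a real RAM with blank memory: one step pays for a bounded number of operations on reals
(arithmetic, comparison, floor), on integers, on array cells (a function on `Fin n` or an `Array`
is an array in memory), and on list and tree cells. -/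

abbrev Prog := StateT ℕ Option

/-- Spend `k` steps. -/
def tick (k : ℕ) : Prog Unit := modify (fun c => c + k)

/-- Binary search: for `p` true up to some index in `[lo, hi)` and false afterwards, returns the
last index at which `p` is true. -/
def bsearch (p : ℕ → Bool) (lo hi : ℕ) : Prog ℕ := do
  tick 1
  if hi ≤ lo + 1 then pure lo
  else if p ((lo + hi) / 2) then bsearch p ((lo + hi) / 2) hi
  else bsearch p lo ((lo + hi) / 2)
termination_by hi - lo
decreasing_by all_goals omega

/-- Value and one-sided slope (from the left if `left`, else from the right) at time `t` of the
`T`-periodic piecewise-linear function given by its array of breakpoints on `[0, T]`. -/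
def lookup (T : ℝ) (pts : Array (ℝ × ℝ)) (left : Bool) (t : ℝ) : Prog (ℝ × ℝ) := do
  let s : ℝ := if left then T - T * Int.fract (-t / T) else T * Int.fract (t / T)
  let i ← bsearch (fun i => if left then decide ((pts.getD i (0, 0)).1 < s)
    else decide ((pts.getD i (0, 0)).1 ≤ s)) 0 (pts.size - 1)
  tick 1
  let p := pts.getD i (0, 0)
  let σ := slope2 p (pts.getD (i + 1) (0, 0))
  pure (p.2 + σ * (s - p.1), σ)

/-- Arrival time over an arc. -/
def stepTime {T : ℝ} (P : Profile T) (t : ℝ) : Prog ℝ := do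
  let y ← lookup T P.pts false t
  pure (t + y.1)

/-- Arrival time over an arc for a departure at the time `x + σ·δ`, with `δ > 0` infinitesimal;
such a time is the pair `(x, σ)`, and pairs are ordered lexicographically. -/
def stepGerm {T : ℝ} (P : Profile T) (g : ℝ ×ₗ ℝ) : Prog (ℝ ×ₗ ℝ) := do
  let x := (ofLex g).1
  let σ := (ofLex g).2
  let y ← lookup T P.pts (decide (σ < 0)) x
  pure (toLex (x + y.1, σ * (1 + y.2)))

/-- Traversal of an arc backwards in time: from an arrival time `τ` at the head to the latest
departure time from the tail that arrives no later than `τ`. Times are negated, so that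
the latest time has the smallest key. -/
def stepBack {T : ℝ} (P : Profile T) (key : ℝ) : Prog ℝ := do
  let a := fun i => (P.pts.getD i (0, 0)).1 + (P.pts.getD i (0, 0)).2
  let k : ℤ := ⌊(-key - a 0) / T⌋
  let τ : ℝ := -key - k * T
  let i ← bsearch (fun i => decide (a i ≤ τ)) 0 (P.pts.size - 1)
  tick 1
  let x := (P.pts.getD i (0, 0)).1
  let x' := (P.pts.getD (i + 1) (0, 0)).1
  pure (-(k * T + (x + (τ - a i) / (a (i + 1) - a i) * (x' - x))))

/-! ### Priority queue (leftist heap) -/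

inductive Heap (α : Type) where
  | leaf : Heap α
  | node (rank : ℕ) (x : α) (l r : Heap α) : Heap α

namespace Heap

variable {α κ : Type}

def rank : Heap α → ℕ
  | leaf => 0
  | node k _ _ _ => k

def toList : Heap α → List α
  | leaf => []
  | node _ x l r => x :: (l.toList ++ r.toList)

def mk (x : α) (h₁ h₂ : Heap α) : Heap α :=
  if h₂.rank ≤ h₁.rank then node (h₂.rank + 1) x h₁ h₂ else node (h₁.rank + 1) x h₂ h₁

def merge [LinearOrder κ] : Heap (κ × α) → Heap (κ × α) → Prog (Heap (κ × α))
  | leaf, h => do tick 1; pure h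
  | node k x l r, leaf => do tick 1; pure (node k x l r)
  | node k x l r, node k' x' l' r' => do
      tick 1
      if x.1 ≤ x'.1 then
        let h ← merge r (node k' x' l' r')
        pure (mk x l h)
      else
        let h ← merge (node k x l r) r'
        pure (mk x' l' h)
termination_by h₁ h₂ => sizeOf h₁ + sizeOf h₂

def insert [LinearOrder κ] (x : κ × α) (h : Heap (κ × α)) : Prog (Heap (κ × α)) :=
  merge (node 1 x leaf leaf) h

end Heap

/-! ### Time-dependent Dijkstra -/

/-- Result of growing a ball: the keys of the settled vertices, the queue of the tentative keys
(of arcs that leave settled vertices), and the settled vertex at which the growth was stopped. -/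
structure Ball (n : ℕ) (κ : Type) where
  settled : Fin n → Option κ
  queue : Heap (κ × Fin n)
  last : Option (Fin n × κ)

/-- Main loop of Dijkstra's algorithm: vertices are settled in the order of their keys, until a
vertex with `halt` is settled or the queue is empty. -/
def grow {κ : Type} [LinearOrder κ] {T : ℝ} (adj : Fin n → List (Fin n × Profile T))
    (step : Profile T → κ → Prog κ) (halt : Fin n → Bool)
    (S : Fin n → Option κ) (H : Heap (κ × Fin n)) : Prog (Ball n κ) := do
  tick 1
  match H with
  | .leaf => pure ⟨S, .leaf, none⟩
  | .node _ kv l r => do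
      let H₁ ← Heap.merge l r
      if (S kv.2).isSome then grow adj step halt S H₁
      else
        let H₂ ← (adj kv.2).foldlM (fun h e => do
          tick 1
          let k ← step e.2 kv.1
          Heap.insert (k, e.1) h) H₁
        let S' := Function.update S kv.2 (some kv.1)
        if halt kv.2 then pure ⟨S', H₂, some (kv.2, kv.1)⟩ else grow adj step halt S' H₂
  partial_fixpoint

def dijkstra {κ : Type} [LinearOrder κ] {T : ℝ} (adj : Fin n → List (Fin n × Profile T))
    (step : Profile T → κ → Prog κ) (halt : Fin n → Bool) (o : Fin n) (key : κ) :
    Prog (Ball n κ) :=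
  grow adj step halt (fun _ => none) (.node 1 (key, o) .leaf .leaf)

/-! ### Preprocessing: bisection -/

/-- Sample of a function: time, value, left and right derivative. -/
structure Sample where
  time : ℝ
  val : ℝ
  left : ℝ
  right : ℝ

/-- Samples at time `t` of all the functions `D[ℓ,v]`, by two runs of Dijkstra's algorithm,
for departures just after and just before `t`. -/
def probe (G : Network n) (ℓ : Fin n) (t : ℝ) : Prog (Fin n → Sample) := do
  let R ← dijkstra G.out stepGerm (fun _ => false) ℓ (toLex (t, (1 : ℝ)))
  let L ← dijkstra G.out stepGerm (fun _ => false) ℓ (toLex (t, (-1 : ℝ)))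
  tick n
  pure (fun v =>
    let gR := ofLex ((R.settled v).getD (toLex (0, 0)))
    let gL := ofLex ((L.settled v).getD (toLex (0, 0)))
    { time := t, val := gR.1 - t, left := -gL.2 - 1, right := gR.2 - 1 })

/-- Abscissa of the intersection of the tangents at two samples. -/
def kink (p q : Sample) : ℝ :=
  (q.val - p.val + p.time * p.right - q.time * q.left) / (p.right - q.left)

/-- Maximum absolute error between the tangents and the chord at two samples of a concave
function. -/
def mae (p q : Sample) : ℝ :=
  (p.right - q.left) * ((kink p q - p.time) * (q.time - kink p q) / (q.time - p.time))

/-- Append the samples `s` to the lists (kept in reverse order) of the vertices `vs`. -/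
def push (s : Fin n → Sample) (vs : List (Fin n)) (lbp : Fin n → List Sample) :
    Prog (Fin n → List Sample) :=
  vs.foldlM (fun l v => do tick 1; pure (Function.update l v (s v :: l v))) lbp

/-- Concurrent bisection of the interval between the sample times of `s` and `f`: a vertex stays
active as long as the maximum absolute error exceeds `ε` times the minimum of its travel time
at the ends. -/
def bisect (G : Network n) (ε : ℝ) (ℓ : Fin n) (s f : Fin n → Sample) (t₁ t₂ : ℝ)
    (active : List (Fin n)) (lbp : Fin n → List Sample) : Prog (Fin n → List Sample) := do
  tick (1 + active.length)
  let act := active.filter (fun v => decide (ε * min (s v).val (f v).val < mae (s v) (f v)))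
  if act.isEmpty then pure lbp
  else
    let mid ← probe G ℓ ((t₁ + t₂) / 2)
    let lbp₁ ← bisect G ε ℓ s mid t₁ ((t₁ + t₂) / 2) act lbp
    let lbp₂ ← push mid act lbp₁
    bisect G ε ℓ mid f ((t₁ + t₂) / 2) t₂ act lbp₂
  partial_fixpoint

/-- Bisection of the consecutive intervals between the remaining cut points. -/
def pieces (G : Network n) (ε : ℝ) (ℓ : Fin n) :
    (Fin n → Sample) → ℝ → List ℝ → (Fin n → List Sample) → Prog (Fin n → List Sample)
  | _, _, [], lbp => pure lbp
  | s, t, c :: cs, lbp => do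
      let f ← probe G ℓ c
      let lbp₁ ← bisect G ε ℓ s f t c (List.finRange n) lbp
      let lbp₂ ← push f (List.finRange n) lbp₁
      pieces G ε ℓ f c cs lbp₂

/-- Linear scan of the samples (in reverse order) that yields the breakpoints of the
upper-approximating function: between any two consecutive samples the intersection of the tangents
is inserted. -/
def upper : List Sample → List (ℝ × ℝ) → Prog (List (ℝ × ℝ))
  | [], acc => pure acc
  | [p], acc => do tick 1; pure ((p.time, p.val) :: acc)
  | q :: p :: rest, acc => do
      tick 1
      if q.left < p.right then
        upper (p :: rest)
          ((kink p q, p.val + p.right * (kink p q - p.time)) :: (q.time, q.val) :: acc)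
      else upper (p :: rest) ((q.time, q.val) :: acc)

/-- Insertion into a sorted list without repetitions. -/
def insertCut (x : ℝ) : List ℝ → Prog (List ℝ)
  | [] => do tick 1; pure [x]
  | y :: l => do
      tick 1
      if x < y then pure (x :: y :: l)
      else if x = y then pure (y :: l)
      else
        let l' ← insertCut x l
        pure (y :: l')

/-- One-to-all summaries from the landmark `ℓ`; `images` lists the latest departure times from all
vertices for the concavity-spoiling breakpoints. -/
def summaries (G : Network n) (ε : ℝ) (images : List (Fin n → Option ℝ)) (ℓ : Fin n) :
    Prog (Fin n → Array (ℝ × ℝ)) := do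
  let cuts ← images.foldlM (fun l im => do
    tick 1
    match im ℓ with
    | none => pure l
    | some key => insertCut (G.T * Int.fract (-key / G.T)) l) [0, G.T]
  let s ← probe G ℓ 0
  let lbp₀ ← push s (List.finRange n) (fun _ => [])
  let lbp ← pieces G ε ℓ s 0 cuts.tail lbp₀
  (List.finRange n).foldlM (fun row v => do
    let l ← upper (lbp v) []
    tick (1 + l.length)
    pure (Function.update row v l.toArray)) (fun _ => #[])

/-- The reverse network: at each vertex, the list of its incoming arcs, each as a pair of its tail
and its delay function. -/
def reverseAdj (G : Network n) : Prog (Fin n → List (Fin n × Profile G.T)) :=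
  (List.finRange n).foldlM (fun adj u => do
    tick 1
    (G.out u).foldlM (fun adj e => do
      tick 1
      pure (Function.update adj e.1 ((u, e.2) :: adj e.1))) adj) (fun _ => [])

/-- All concavity-spoiling breakpoints, each with the tail of its arc. -/
def spoilingPoints (G : Network n) : Prog (List (Fin n × ℝ)) :=
  (List.finRange n).foldlM (fun l u => do
    tick 1
    (G.out u).foldlM (fun l e => do
      tick (1 + e.2.pts.size)
      pure (e.2.spoilTimes.map (fun t => (u, t)) ++ l)) l) []

/-- The distance oracle: for every landmark, its summaries towards all vertices. A vertex
is a landmark if it has such a row. -/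
structure Oracle (n : ℕ) where
  row : Fin n → Option (Fin n → Array (ℝ × ℝ))

/-- Preprocessing for the landmark set `L`. -/
def preprocess (G : Network n) (ε : ℝ) (L : Finset (Fin n)) : Prog (Oracle n) := do
  let rev ← reverseAdj G
  let sp ← spoilingPoints G
  let images ← sp.foldlM (fun l ut => do
    tick 1
    let B ← dijkstra rev stepBack (fun _ => false) ut.1 (-ut.2)
    pure (B.settled :: l)) []
  let rows ← (List.finRange n).foldlM (fun rows v => do
    tick 1
    if v ∈ L then
      let row ← summaries G ε images v
      pure (Function.update rows v (some row))
    else pure rows) (fun _ => none)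
  pure ⟨rows⟩

/-- Space, in memory words, of the network and the summaries. -/
def space (G : Network n) (O : Oracle n) : ℕ :=
  (n + ∑ u, ((G.out u).map (fun e => 2 + 2 * e.2.pts.size)).sum) +
    (n + ∑ ℓ, match O.row ℓ with
      | none => 0
      | some row => ∑ v, (1 + 2 * (row v).size))

/-! ### Queries -/

/-- A ball is grown around `(w, t)` until `d` or a landmark is settled. The result is an upper bound
on the earliest arrival time at `d` (exact if `d` is settled, else through the landmark), together
with the unsettled heads, with their tentative arrival times, of the arcs that leave the ball
(none if `w` is a landmark or `d` is settled). -/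
def ballQuery (G : Network n) (O : Oracle n) (d w : Fin n) (t : ℝ) :
    Prog (ℝ × List (ℝ × Fin n)) := do
  tick 1
  match O.row w with
  | some row =>
      let y ← lookup G.T (row d) false t
      pure (t + y.1, [])
  | none =>
      let B ← dijkstra G.out stepTime (fun v => decide (v = d) || (O.row v).isSome) w t
      match B.settled d, B.last with
      | some τ, _ => pure (τ, [])
      | none, none => failure
      | none, some (ℓ, x) =>
          match O.row ℓ with
          | none => failure
          | some row =>
              let y ← lookup G.T (row d) false x
              tick (1 + B.queue.toList.length)
              pure (x + y.1, B.queue.toList.filter (fun kv => (B.settled kv.2).isNone))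

/-- Recursive query algorithm with recursion budget `r`: the first vertex outside the ball on a
shortest path is guessed by exhaustive search. Returns an arrival time at `d`. -/
def rqa (G : Network n) (O : Oracle n) (d : Fin n) : ℕ → Fin n → ℝ → Prog ℝ
  | 0, w, t => do
      let b ← ballQuery G O d w t
      pure b.1
  | r + 1, w, t => do
      let b ← ballQuery G O d w t
      b.2.foldlM (fun best kv => do
        tick 1
        let τ ← rqa G O d r kv.2 kv.1
        pure (min best τ)) b.1

/-- The travel time reported for the query `(o, d, t)`. -/
def query (G : Network n) (O : Oracle n) (r : ℕ) (o d : Fin n) (t : ℝ) : Prog ℝ := do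
  let τ ← rqa G O d r o t
  tick 1
  pure (τ - t)

/-! ### Random landmarks and the constants of the guarantee -/

/-- Expectation of `f L` for the random set `L` that contains every vertex independently with
probability `ρ`. -/
def expect (ρ : ℝ) (f : Finset (Fin n) → ℝ) : ℝ :=
  ∑ L : Finset (Fin n), ρ ^ L.card * (1 - ρ) ^ (n - L.card) * f L

def psi (ε ζ lmax : ℝ) : ℝ :=
  1 + lmax * (1 + ε) * (1 + 2 * ζ + lmax * ζ) + (1 + ε) * ζ

def gam (ε ζ lmax : ℝ) (r : ℕ) : ℝ :=
  (1 + ε / psi ε ζ lmax) ^ (r + 1) / ((1 + ε / psi ε ζ lmax) ^ (r + 1) - 1)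

end TDOracle

end

/-! All programs are analysed through `Ret` and `Runs`: a run returns a value with a bounded number
of steps, whatever the counter at its start. Termination of the partial fixpoints is thus proved
together with correctness and cost.

Concave pieces. Dijkstra's algorithm with FIFO steps computes earliest arrival times; on pairs `(x,
σ)`, read as `x + σ·δ` with infinitesimal `δ`, it also computes exact one-sided slopes. The slope of
D[ℓ,v] can increase at `t` only if, departing from ℓ at `t`, some vertex u is reached at a
concavity-spoiling breakpoint of an arc leaving u (`exists_concave_sample`). Since Λ_min < 1,
arrival functions are strictly increasing, so each such breakpoint has one preimage modulo T. The
backward runs find these preimages, and at most K*+1 pieces remain on which all D[ℓ,v] are concave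
(`ImagesSpec.concave`).

Few samples. A nonnegative concave function has, at distance x from an end of its piece, relative
slope at most 1/x in the direction away from that end. An interval that is short compared with its
distance to both ends is therefore never split (`mae_le_of_far`), and splitting concentrates at the
two ends. There the lengths halve until the slope bounds and the least delay stop the process
(`mae_le_of_short`), after O(ln(T/δ)) rounds, δ being a lower bound for the delays
(`exists_bisectionTree`). Every summary has polylogarithmic size; multiplying by n destinations and
by the n^(1-a) expected landmarks gives n^(2-a).

Stretch. If a ball stops at a landmark at distance R, the candidate through it exceeds (1+ε)D by at
most ψR (`landmark_le`). Otherwise the trip can continue optimally from a vertex in the queue, with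
at most D-R left. Either R is small and the candidate is good, or R is large and the recursive
answer is good. The formula for γ is the exact balance of the two cases (`gam_succ`).

Query time. A ball depends on the landmark set only through the vertex at which it stops. All
centers that a query may visit hence lie in a list of polynomial length that does not depend on L
(`centers`, `IsBall.mem_fringe`). A ball with more than s vertices needs s fixed vertices to avoid L
(`exists_core`), which has probability (1-ρ)^s. With s of order n^a(1+ln n), a union bound makes a
large ball so rare that the worst-case cost contributes only a polylogarithmic term; otherwise the
recursion costs (s·polylog)^(r+1). -/

noncomputable section

namespace TDOracle

variable {n : ℕ}

/-! ## Programs: returned value and number of steps -/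

section Programs

variable {α β : Type}

/-- The program `m` returns `a` after `k` steps. -/
def Ret (m : Prog α) (a : α) (k : ℕ) : Prop := ∀ c, m.run c = some (a, c + k)

theorem Ret.unique {m : Prog α} {a a' : α} {k k' : ℕ} (h : Ret m a k) (h' : Ret m a' k') :
    a = a' ∧ k = k' := by
  have := (h 0).symm.trans (h' 0)
  simpa using this

theorem Ret.pure (a : α) : Ret (Pure.pure a : Prog α) a 0 := fun _ => rfl

theorem Ret.bind {m : Prog α} {f : α → Prog β} {a : α} {b : β} {k l : ℕ}
    (h : Ret m a k) (h' : Ret (f a) b l) : Ret (m >>= f) b (k + l) := by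
  intro c
  rw [StateT.run_bind, h c]
  simpa [Nat.add_assoc] using h' (c + k)

theorem Ret.tick (k : ℕ) : Ret (TDOracle.tick k) () k := fun _ => rfl

/-- The program `m` returns, within `b` steps, a value that satisfies `Q`. -/
def Runs (m : Prog α) (b : ℕ) (Q : α → Prop) : Prop := ∃ a k, Ret m a k ∧ k ≤ b ∧ Q a

theorem Ret.runs {m : Prog α} {a : α} {k b : ℕ} {Q : α → Prop} (h : Ret m a k) (hk : k ≤ b)
    (hQ : Q a) : Runs m b Q := ⟨a, k, h, hk, hQ⟩

/-- Programs are deterministic, so a bound proved separately applies to a run whose result is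
already named. Facts about subprograms are read off a recorded trace in this way. -/
theorem Runs.post {m : Prog α} {a : α} {k b : ℕ} {Q : α → Prop} (h : Runs m b Q)
    (h' : Ret m a k) : k ≤ b ∧ Q a := by
  obtain ⟨a', k', h₁, h₂, h₃⟩ := h
  obtain ⟨rfl, rfl⟩ := h₁.unique h'
  exact ⟨h₂, h₃⟩

theorem Runs.mono {m : Prog α} {b b' : ℕ} {Q Q' : α → Prop} (h : Runs m b Q) (hb : b ≤ b')
    (hQ : ∀ a, Q a → Q' a) : Runs m b' Q' := by
  obtain ⟨a, k, h₁, h₂, h₃⟩ := h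
  exact ⟨a, k, h₁, h₂.trans hb, hQ a h₃⟩

theorem Runs.pure {a : α} {Q : α → Prop} (h : Q a) (b : ℕ) : Runs (Pure.pure a : Prog α) b Q :=
  ⟨a, 0, Ret.pure a, Nat.zero_le _, h⟩

theorem Runs.bind {m : Prog α} {f : α → Prog β} {b b' : ℕ} {Q : α → Prop} {Q' : β → Prop}
    (h : Runs m b Q) (h' : ∀ a, Q a → Runs (f a) b' Q') : Runs (m >>= f) (b + b') Q' := by
  obtain ⟨a, k, h₁, h₂, h₃⟩ := h
  obtain ⟨a', k', h₁', h₂', h₃'⟩ := h' a h₃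
  exact ⟨a', k + k', h₁.bind h₁', by omega, h₃'⟩

theorem Runs.bind_ret {m : Prog α} {f : α → Prog β} {a : α} {k b : ℕ} {Q : β → Prop}
    (h : Ret m a k) (h' : Runs (f a) b Q) : Runs (m >>= f) (k + b) Q := by
  obtain ⟨a', k', h₁', h₂', h₃'⟩ := h'
  exact ⟨a', k + k', h.bind h₁', by omega, h₃'⟩

theorem Runs.tick {f : Unit → Prog β} {k b : ℕ} {Q : β → Prop}
    (h : Runs (f ()) b Q) : Runs (TDOracle.tick k >>= f) (k + b) Q :=
  Runs.bind_ret (Ret.tick k) h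

theorem Runs.tick_pure {a : α} {k b : ℕ} {Q : α → Prop} (h : Q a) (hb : k ≤ b) :
    Runs (TDOracle.tick k >>= fun _ => (Pure.pure a : Prog α)) b Q :=
  (Runs.tick (b := 0) (Runs.pure h 0)).mono hb fun _ h => h

/-- Left fold over a list, with an invariant that may refer to the processed part of the list. -/
theorem Runs.foldlM {f : β → α → Prog β} {l : List α} {init : β} (I : List α → β → Prop)
    (cost : α → ℕ) (h₀ : I [] init)
    (hs : ∀ done x rest b, l = done ++ x :: rest → I done b →
      Runs (f b x) (cost x) (I (done ++ [x]))) :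
    Runs (l.foldlM f init) (l.map cost).sum (I l) := by
  suffices H : ∀ (rest done : List α) (b : β), l = done ++ rest → I done b →
      Runs (rest.foldlM f b) (rest.map cost).sum (I l) from H l [] init rfl h₀
  intro rest
  induction rest with
  | nil =>
    intro done b hl hb
    rw [List.append_nil] at hl
    subst hl
    exact Runs.pure hb _
  | cons x rest ih =>
    intro done b hl hb
    rw [List.foldlM_cons, List.map_cons, List.sum_cons]
    refine (hs done x rest b hl hb).bind fun b' hb' => ih (done ++ [x]) b' ?_ hb'
    simpa using hl

theorem Runs.foldlM_le {f : β → α → Prog β} {l : List α} {init : β} (I : List α → β → Prop)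
    (k : ℕ) (h₀ : I [] init)
    (hs : ∀ done x rest b, l = done ++ x :: rest → I done b →
      Runs (f b x) k (I (done ++ [x]))) :
    Runs (l.foldlM f init) (l.length * k) (I l) := by
  refine (Runs.foldlM I (fun _ => k) h₀ hs).mono ?_ fun _ h => h
  simp

end Programs

/-- The invariant is that `p` holds at `lo` and fails at `hi`; monotonicity of `p` plays no role.
The longer half has length ⌈d/2⌉, which is the recursion of `Nat.clog`. -/
theorem bsearch_runs (p : ℕ → Bool) (lo hi : ℕ) (hlt : lo < hi) (hlo : p lo = true)
    (hhi : p hi = false) :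
    Runs (bsearch p lo hi) (Nat.clog 2 (hi - lo) + 1)
      (fun i => lo ≤ i ∧ i < hi ∧ p i = true ∧ p (i + 1) = false) := by
  induction hd : hi - lo using Nat.strong_induction_on generalizing lo hi with
  | _ d ih =>
    subst hd
    rw [bsearch]
    by_cases h1 : hi ≤ lo + 1
    · rw [if_pos h1]
      have : hi = lo + 1 := by omega
      subst this
      refine (Runs.tick (b := 0) ?_).mono (by omega) fun _ h => h
      exact Runs.pure ⟨le_rfl, hlt, hlo, hhi⟩ 0
    · rw [if_neg h1]
      have hc : Nat.clog 2 (hi - lo) = Nat.clog 2 ((hi - lo + 1) / 2) + 1 := by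
        rw [Nat.clog_of_two_le (by norm_num) (by omega)]
        congr 2
      by_cases hm : p ((lo + hi) / 2) = true
      · rw [if_pos hm]
        have := ih (hi - (lo + hi) / 2) (by omega) ((lo + hi) / 2) hi (by omega) hm hhi rfl
        refine (Runs.tick this).mono ?_ fun i hi' => ⟨by omega, hi'.2⟩
        have : Nat.clog 2 (hi - (lo + hi) / 2) ≤ Nat.clog 2 ((hi - lo + 1) / 2) :=
          Nat.clog_mono_right _ (by omega)
        omega
      · rw [if_neg hm]
        have := ih ((lo + hi) / 2 - lo) (by omega) lo ((lo + hi) / 2) (by omega) hlo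
          (by simpa using hm) rfl
        refine (Runs.tick this).mono ?_ fun i hi' => ⟨hi'.1, by omega, hi'.2.2⟩
        have : Nat.clog 2 ((lo + hi) / 2 - lo) ≤ Nat.clog 2 ((hi - lo + 1) / 2) :=
          Nat.clog_mono_right _ (by omega)
        omega

/-! ## Leftist heaps -/

namespace Heap

variable {α κ : Type}

/-- The ranks are the lengths of the right spines, and the heap leans to the left. -/
def Leftist : Heap α → Prop
  | leaf => True
  | node k _ l r => k = r.rank + 1 ∧ r.rank ≤ l.rank ∧ l.Leftist ∧ r.Leftist

/-- No key is smaller than the key above it. -/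
def Ordered [LinearOrder κ] : Heap (κ × α) → Prop
  | leaf => True
  | node _ x l r => (∀ y ∈ l.toList ++ r.toList, x.1 ≤ y.1) ∧ l.Ordered ∧ r.Ordered

/-- The left subtree has at least the rank of the right one, so by induction both have at least
2^rank - 1 elements. -/
theorem two_pow_rank_le (h : Heap α) (hh : h.Leftist) : 2 ^ h.rank ≤ h.toList.length + 1 := by
  induction h with
  | leaf => simp [rank, toList]
  | node k x l r ihl ihr =>
    obtain ⟨rfl, hle, hl, hr⟩ := hh
    have h1 := ihl hl
    have h2 := ihr hr
    have h3 : 2 ^ r.rank ≤ 2 ^ l.rank := Nat.pow_le_pow_right (by norm_num) hle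
    change 2 ^ (r.rank + 1) ≤ _
    simp only [toList, List.length_cons, List.length_append, pow_succ]
    omega

theorem rank_le_log (h : Heap α) (hh : h.Leftist) : h.rank ≤ Nat.log 2 (h.toList.length + 1) :=
  Nat.le_log_of_pow_le (by norm_num) (h.two_pow_rank_le hh)

theorem leftist_mk (x : α) (h₁ h₂ : Heap α) (H₁ : h₁.Leftist) (H₂ : h₂.Leftist) :
    (mk x h₁ h₂).Leftist := by
  unfold mk
  split_ifs with h
  · exact ⟨rfl, h, H₁, H₂⟩
  · exact ⟨rfl, by omega, H₂, H₁⟩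

theorem toList_mk (x : α) (h₁ h₂ : Heap α) :
    (mk x h₁ h₂).toList.Perm (x :: (h₁.toList ++ h₂.toList)) := by
  unfold mk
  split_ifs with h
  · exact List.Perm.refl _
  · exact List.Perm.cons _ List.perm_append_comm

theorem ordered_mk [LinearOrder κ] (x : κ × α) (h₁ h₂ : Heap (κ × α)) (H₁ : h₁.Ordered)
    (H₂ : h₂.Ordered) (h : ∀ y ∈ h₁.toList ++ h₂.toList, x.1 ≤ y.1) : (mk x h₁ h₂).Ordered := by
  unfold mk
  split_ifs
  · exact ⟨h, H₁, H₂⟩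
  · exact ⟨fun y hy => h y (by simpa [or_comm] using hy), H₂, H₁⟩

/-- Each call steps down one of the two right spines, whose lengths are the ranks. -/
theorem merge_runs [LinearOrder κ] (h₁ h₂ : Heap (κ × α)) (L₁ : h₁.Leftist) (L₂ : h₂.Leftist)
    (O₁ : h₁.Ordered) (O₂ : h₂.Ordered) :
    Runs (merge h₁ h₂) (h₁.rank + h₂.rank + 1)
      (fun h => h.Leftist ∧ h.Ordered ∧ h.toList.Perm (h₁.toList ++ h₂.toList)) := by
  induction h₁, h₂ using merge.induct (κ := κ) with
  | case1 h =>
    rw [merge]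
    refine (Runs.tick (b := 0) ?_).mono (by omega) fun _ h => h
    exact Runs.pure ⟨L₂, O₂, by simp [toList]⟩ 0
  | case2 k x l r =>
    rw [merge]
    refine (Runs.tick (b := 0) ?_).mono (by omega) fun _ h => h
    exact Runs.pure ⟨L₁, O₁, by simp [toList]⟩ 0
  | case3 k x l r k' x' l' r' ih ih' =>
    rw [merge]
    obtain ⟨rfl, hle, hl, hr⟩ := id L₁
    obtain ⟨rfl, hle', hl', hr'⟩ := id L₂
    obtain ⟨ho, ol, or⟩ := id O₁
    obtain ⟨ho', ol', or'⟩ := id O₂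
    split_ifs with hx
    · refine (Runs.tick ((ih hr L₂ or O₂).bind (b' := 0)
        (Q' := fun h : Heap (κ × α) => h.Leftist ∧ h.Ordered ∧ h.toList.Perm (_ ++ _)) ?_)).mono ?_
        fun _ h => h
      · intro h hh
        refine Runs.pure ⟨leftist_mk _ _ _ hl hh.1, ordered_mk _ _ _ ol hh.2.1 ?_, ?_⟩ 0
        · intro y hy
          rw [List.mem_append, hh.2.2.mem_iff, List.mem_append] at hy
          rcases hy with hy | hy | hy
          · exact ho y (by simp [hy])
          · exact ho y (by simp [hy])
          · rw [toList, List.mem_cons] at hy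
            rcases hy with rfl | hy
            · exact hx
            · exact hx.trans (O₂.1 y hy)
        · refine (toList_mk _ _ _).trans ?_
          rw [toList, List.cons_append, List.append_assoc]
          exact (hh.2.2.append_left l.toList).cons x
      · change _ ≤ r.rank + 1 + (r'.rank + 1) + 1
        change 1 + (r.rank + (r'.rank + 1) + 1 + 0) ≤ _
        omega
    · refine (Runs.tick ((ih' L₁ hr' O₁ or').bind (b' := 0)
        (Q' := fun h : Heap (κ × α) => h.Leftist ∧ h.Ordered ∧ h.toList.Perm (_ ++ _)) ?_)).mono ?_
        fun _ h => h
      · intro h hh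
        refine Runs.pure ⟨leftist_mk _ _ _ hl' hh.1, ordered_mk _ _ _ ol' hh.2.1 ?_, ?_⟩ 0
        · intro y hy
          rw [List.mem_append, hh.2.2.mem_iff, List.mem_append] at hy
          have hx' : x'.1 ≤ x.1 := (lt_of_not_ge hx).le
          rcases hy with hy | hy | hy
          · exact ho' y (by simp [hy])
          · rw [toList, List.mem_cons] at hy
            rcases hy with rfl | hy
            · exact hx'
            · exact hx'.trans (O₁.1 y hy)
          · exact ho' y (by simp [hy])
        · refine (toList_mk _ _ _).trans ?_
          refine ((hh.2.2.append_left l'.toList).cons x').trans ?_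
          simp only [toList]
          rw [← Multiset.coe_eq_coe]
          simp only [← Multiset.coe_add, ← Multiset.cons_coe, ← Multiset.singleton_add]
          abel
      · change _ ≤ r.rank + 1 + (r'.rank + 1) + 1
        change 1 + (r.rank + 1 + r'.rank + 1 + 0) ≤ _
        omega

theorem insert_runs [LinearOrder κ] (x : κ × α) (h : Heap (κ × α)) (L : h.Leftist)
    (O : h.Ordered) :
    Runs (insert x h) (h.rank + 2)
      (fun h' => h'.Leftist ∧ h'.Ordered ∧ h'.toList.Perm (x :: h.toList)) := by
  refine (merge_runs (node 1 x leaf leaf) h (by simp [Leftist, rank]) L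
    (by simp [Ordered, toList]) O).mono (by change 1 + h.rank + 1 ≤ _; omega) fun h' hh => ?_
  simpa [toList] using hh

end Heap

/-! ## Dijkstra's algorithm with monotone steps -/

section Dijkstra

variable {κ : Type} [LinearOrder κ] {T : ℝ}

/-- Insertion of the tentative keys of the heads of a list of arcs. -/
def relax (step : Profile T → κ → Prog κ) (l : List (Fin n × Profile T)) (key : κ)
    (H : Heap (κ × Fin n)) : Prog (Heap (κ × Fin n)) :=
  l.foldlM (fun h e => do
    tick 1
    let k ← step e.2 key
    Heap.insert (k, e.1) h) H

/-- Trace of `grow`: from the settled keys and the queue to the final ball and the list of the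
vertices settled, in the order of settlement. -/
inductive Growth (adj : Fin n → List (Fin n × Profile T)) (step : Profile T → κ → Prog κ)
    (halt : Fin n → Bool) :
    (Fin n → Option κ) → Heap (κ × Fin n) → Ball n κ → List (Fin n) → Prop
  | leaf (S) : Growth adj step halt S .leaf ⟨S, .leaf, none⟩ []
  | skip {S m key v l r H₁ k₁ B o} (h₁ : Ret (Heap.merge l r) H₁ k₁) (hv : (S v).isSome = true)
      (hB : Growth adj step halt S H₁ B o) : Growth adj step halt S (.node m (key, v) l r) B o
  | halts {S m key v l r H₁ k₁ H₂ k₂} (h₁ : Ret (Heap.merge l r) H₁ k₁) (hv : S v = none)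
      (h₂ : Ret (relax step (adj v) key H₁) H₂ k₂) (hh : halt v = true) :
      Growth adj step halt S (.node m (key, v) l r)
        ⟨Function.update S v (some key), H₂, some (v, key)⟩ [v]
  | next {S m key v l r H₁ k₁ H₂ k₂ B o} (h₁ : Ret (Heap.merge l r) H₁ k₁) (hv : S v = none)
      (h₂ : Ret (relax step (adj v) key H₁) H₂ k₂) (hh : halt v = false)
      (hB : Growth adj step halt (Function.update S v (some key)) H₂ B o) :
      Growth adj step halt S (.node m (key, v) l r) B (v :: o)

/-- The programs `step` compute the function `f` within `cs` steps on the arcs of `adj`. -/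
def Computes (adj : Fin n → List (Fin n × Profile T)) (step : Profile T → κ → Prog κ)
    (f : Profile T → κ → κ) (cs : ℕ) : Prop :=
  ∀ u, ∀ e ∈ adj u, ∀ k, Runs (step e.2 k) cs (fun k' => k' = f e.2 k)

theorem relax_runs {adj : Fin n → List (Fin n × Profile T)} {step : Profile T → κ → Prog κ}
    {f : Profile T → κ → κ} {cs : ℕ} (hc : Computes adj step f cs) (v : Fin n) (key : κ)
    (H : Heap (κ × Fin n)) (N : ℕ) (L : H.Leftist) (O : H.Ordered)
    (hN : H.toList.length + (adj v).length ≤ N) :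
    Runs (relax step (adj v) key H) ((adj v).length * (cs + Nat.log 2 (N + 1) + 3))
      (fun H' : Heap (κ × Fin n) => H'.Leftist ∧ H'.Ordered ∧
        H'.toList.Perm (H.toList ++ (adj v).map (fun e => (f e.2 key, e.1)))) := by
  refine Runs.foldlM_le (fun done (H' : Heap (κ × Fin n)) => H'.Leftist ∧ H'.Ordered ∧
        H'.toList.Perm (H.toList ++ done.map (fun e : Fin n × Profile T => (f e.2 key, e.1)))) _ ⟨L, O, by simp⟩ ?_
  rintro done x rest H' hl ⟨L', O', P'⟩
  have hx : x ∈ adj v := by rw [hl]; simp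
  have hlen : H'.toList.length + 1 ≤ N + 1 := by
    rw [P'.length_eq]
    have := congrArg List.length hl
    simp at this ⊢
    omega
  have hrank : H'.rank ≤ Nat.log 2 (N + 1) :=
    (H'.rank_le_log L').trans (Nat.log_mono_right hlen)
  refine (Runs.tick ((hc v x hx key).bind (b' := Nat.log 2 (N + 1) + 2) ?_)).mono
    (by omega) fun _ h => h
  rintro k rfl
  refine (Heap.insert_runs _ H' L' O').mono (by omega) ?_
  rintro H'' ⟨L'', O'', P''⟩
  refine ⟨L'', O'', P''.trans ?_⟩
  rw [List.map_append, ← List.append_assoc]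
  refine List.Perm.trans (P'.cons _) ?_
  simp only [List.map_cons, List.map_nil]
  exact (List.perm_append_singleton _ _).symm

/-- The number of arcs that leave a list of vertices. -/
def outArcs (adj : Fin n → List (Fin n × Profile T)) (o : List (Fin n)) : ℕ :=
  (o.map (fun u => (adj u).length)).sum

/-- The number of insertions into the queue that are still possible. -/
def pending (adj : Fin n → List (Fin n × Profile T)) (S : Fin n → Option κ) : ℕ :=
  ∑ u, if (S u).isSome = true then 0 else (adj u).length

/-- Settling `v` trades its pending arcs for as many insertions. Queue length plus pending
insertions therefore drops by exactly one with each extraction, the measure that makes `grow`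
terminate. -/
theorem pending_update {κ : Type} (adj : Fin n → List (Fin n × Profile T))
    (S : Fin n → Option κ) (v : Fin n) (key : κ) (hv : S v = none) :
    pending adj (Function.update S v (some key)) + (adj v).length = pending adj S := by
  unfold pending
  rw [Fintype.sum_eq_add_sum_compl v, Fintype.sum_eq_add_sum_compl v
    (fun u => if (S u).isSome = true then 0 else (adj u).length)]
  have : ∑ u ∈ {v}ᶜ, (if (Function.update S v (some key) u).isSome = true then 0
      else (adj u).length) = ∑ u ∈ {v}ᶜ, if (S u).isSome = true then 0 else (adj u).length := by
    refine Finset.sum_congr rfl fun u hu => ?_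
    rw [Function.update_of_ne (by simpa using hu)]
  rw [this]
  simp [hv]
  omega

/-- `N` bounds the queue throughout and hence the ranks. The cost is charged to the arcs leaving the
vertices settled in this run: every extraction removes an initial entry or one inserted by such an
arc. The time of a small ball is thus, up to logarithms, proportional to its size and not to `n`. -/
theorem grow_ret {adj : Fin n → List (Fin n × Profile T)} {step : Profile T → κ → Prog κ}
    {f : Profile T → κ → κ} {cs : ℕ} (hc : Computes adj step f cs) (halt : Fin n → Bool)
    (N : ℕ) (S : Fin n → Option κ) (H : Heap (κ × Fin n)) (L : H.Leftist) (O : H.Ordered)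
    (hN : H.toList.length + pending adj S ≤ N) :
    ∃ B k o, Ret (grow adj step halt S H) B k ∧ Growth adj step halt S H B o ∧
      k ≤ 1 + (H.toList.length + outArcs adj o) * (2 * Nat.log 2 (N + 1) + 2) +
        outArcs adj o * (cs + Nat.log 2 (N + 1) + 3) := by
  induction hd : H.toList.length + pending adj S using Nat.strong_induction_on
    generalizing S H with
  | _ d ih =>
    subst hd
    cases H with
    | leaf =>
      refine ⟨⟨S, .leaf, none⟩, 1, [], ?_, .leaf S, by omega⟩
      rw [grow]
      refine (Ret.tick 1).bind (l := 0) ?_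
      exact Ret.pure _
    | node m kv l r =>
      obtain ⟨key, v⟩ := kv
      obtain ⟨H₁, k₁, h₁, hk₁, L₁, O₁, P₁⟩ :=
        Heap.merge_runs l r L.2.2.1 L.2.2.2 O.2.1 O.2.2
      have hlen : (Heap.node m (key, v) l r).toList.length = H₁.toList.length + 1 := by
        simp [Heap.toList, P₁.length_eq]
      have hl : l.rank ≤ Nat.log 2 (N + 1) := by
        refine (l.rank_le_log L.2.2.1).trans (Nat.log_mono_right ?_)
        simp [Heap.toList] at hN
        omega
      have hr : r.rank ≤ Nat.log 2 (N + 1) := by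
        refine (r.rank_le_log L.2.2.2).trans (Nat.log_mono_right ?_)
        simp [Heap.toList] at hN
        omega
      rw [hlen] at hN ih ⊢
      by_cases hv : (S v).isSome = true
      · obtain ⟨B, k, o, hB, hG, hk⟩ := ih _ (by omega) S H₁ L₁ O₁ (by omega) rfl
        refine ⟨B, 1 + (k₁ + k), o, ?_, .skip h₁ hv hG, ?_⟩
        · rw [grow]
          refine (Ret.tick 1).bind (h₁.bind ?_)
          rw [if_pos hv]
          exact hB
        · have e : (H₁.toList.length + 1 + outArcs adj o) * (2 * Nat.log 2 (N + 1) + 2) =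
            (H₁.toList.length + outArcs adj o) * (2 * Nat.log 2 (N + 1) + 2) +
              (2 * Nat.log 2 (N + 1) + 2) := by ring
          omega
      · have hv' : S v = none := by simpa using hv
        have hp := pending_update adj S v key hv'
        obtain ⟨H₂, k₂, h₂, hk₂, L₂, O₂, P₂⟩ :=
          relax_runs hc v key H₁ N L₁ O₁ (by omega)
        have hlen₂ : H₂.toList.length = H₁.toList.length + (adj v).length := by
          simp [P₂.length_eq]
        by_cases hh : halt v = true
        · refine ⟨_, 1 + (k₁ + (k₂ + 0)), [v], ?_, .halts h₁ hv' h₂ hh, ?_⟩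
          · rw [grow]
            refine (Ret.tick 1).bind (h₁.bind ?_)
            rw [if_neg hv]
            refine h₂.bind ?_
            simp only [hh, if_true]
            exact Ret.pure _
          · have e : (H₁.toList.length + 1 + outArcs adj [v]) * (2 * Nat.log 2 (N + 1) + 2) =
              (H₁.toList.length + outArcs adj [v]) * (2 * Nat.log 2 (N + 1) + 2) +
                (2 * Nat.log 2 (N + 1) + 2) := by ring
            have e' : outArcs adj [v] = (adj v).length := by simp [outArcs]
            rw [← e'] at hk₂
            omega
        · obtain ⟨B, k, o, hB, hG, hk⟩ :=
            ih _ (by omega) (Function.update S v (some key)) H₂ L₂ O₂ (by omega) rfl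
          refine ⟨B, 1 + (k₁ + (k₂ + k)), v :: o, ?_, .next h₁ hv' h₂ (by simpa using hh) hG, ?_⟩
          · rw [grow]
            refine (Ret.tick 1).bind (h₁.bind ?_)
            rw [if_neg hv]
            refine h₂.bind ?_
            simp only [hh]
            exact hB
          · have e' : outArcs adj (v :: o) = (adj v).length + outArcs adj o := by simp [outArcs]
            rw [hlen₂] at hk
            rw [e']
            have e : (H₁.toList.length + 1 + ((adj v).length + outArcs adj o)) *
                (2 * Nat.log 2 (N + 1) + 2) =
              (H₁.toList.length + (adj v).length + outArcs adj o) * (2 * Nat.log 2 (N + 1) + 2) +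
                (2 * Nat.log 2 (N + 1) + 2) := by ring
            have e'' : ((adj v).length + outArcs adj o) * (cs + Nat.log 2 (N + 1) + 3) =
              (adj v).length * (cs + Nat.log 2 (N + 1) + 3) +
                outArcs adj o * (cs + Nat.log 2 (N + 1) + 3) := by ring
            omega

/-! ### Order of settlement -/

section Order

variable {adj : Fin n → List (Fin n × Profile T)} {step : Profile T → κ → Prog κ}
  {halt halt' : Fin n → Bool} {S : Fin n → Option κ} {H : Heap (κ × Fin n)} {B B' : Ball n κ}
  {o o' : List (Fin n)}

/-- A ball that stops at `ℓ` does not change when other vertices lose the power to halt. -/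
theorem Growth.change_halt (h : Growth adj step halt S H B o)
    (hle : ∀ v, halt' v = true → halt v = true) {ℓ : Fin n} {x : κ} (hl : B.last = some (ℓ, x))
    (hℓ : halt' ℓ = true) : Growth adj step halt' S H B o := by
  induction h with
  | leaf S => simp at hl
  | skip h₁ hv hB ih => exact .skip h₁ hv (ih hl)
  | halts h₁ hv h₂ hh =>
    simp only [Option.some.injEq, Prod.mk.injEq] at hl
    obtain ⟨rfl, rfl⟩ := hl
    exact .halts h₁ hv h₂ hℓ
  | @next _ _ _ v _ _ _ _ _ _ _ _ h₁ hv h₂ hh hB ih =>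
    refine .next h₁ hv h₂ ?_ (ih hl)
    by_contra h
    rw [hle v (by simpa using h)] at hh
    simp at hh

/-- When fewer vertices halt, more vertices are settled, in the same order. -/
theorem Growth.prefix (h : Growth adj step halt S H B o) (h' : Growth adj step halt' S H B' o')
    (hle : ∀ v, halt' v = true → halt v = true) : o <+: o' := by
  induction h generalizing B' o' with
  | leaf S => exact List.nil_prefix
  | skip h₁ hv hB ih =>
    cases h' with
    | skip h₁' hv' hB' =>
      obtain ⟨rfl, rfl⟩ := h₁.unique h₁'
      exact ih hB'
    | halts h₁' hv' h₂' hh' => simp [hv'] at hv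
    | next h₁' hv' h₂' hh' hB' => simp [hv'] at hv
  | halts h₁ hv h₂ hh =>
    cases h' with
    | skip h₁' hv' hB' => simp [hv] at hv'
    | halts h₁' hv' h₂' hh' => exact List.prefix_rfl
    | next h₁' hv' h₂' hh' hB' => simp
  | @next _ _ _ v _ _ _ _ _ _ _ _ h₁ hv h₂ hh hB ih =>
    cases h' with
    | skip h₁' hv' hB' => simp [hv] at hv'
    | halts h₁' hv' h₂' hh' => simp [hle v hh'] at hh
    | next h₁' hv' h₂' hh' hB' =>
      obtain ⟨rfl, rfl⟩ := h₁.unique h₁'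
      obtain ⟨rfl, rfl⟩ := h₂.unique h₂'
      simpa using ih hB'

theorem Growth.nodup (h : Growth adj step halt S H B o) :
    o.Nodup ∧ ∀ v ∈ o, S v = none := by
  induction h with
  | leaf S => simp
  | skip h₁ hv hB ih => exact ih
  | halts h₁ hv h₂ hh => simpa using hv
  | @next _ _ _ w _ _ _ _ _ _ _ _ h₁ hv h₂ hh hB ih =>
    have hne : ∀ v ∈ _, v ≠ w := fun v hvo => by
      rintro rfl
      simpa using ih.2 v hvo
    refine ⟨List.nodup_cons.2 ⟨fun hw => hne w hw rfl, ih.1⟩, ?_⟩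
    intro v hvo
    rcases List.mem_cons.1 hvo with rfl | hvo
    · exact hv
    · simpa [Function.update_of_ne (hne v hvo)] using ih.2 v hvo

/-- A halting vertex ends the growth, so it can only be settled last. A large ball therefore yields
a large set free of landmarks. -/
theorem Growth.not_halt (h : Growth adj step halt S H B o) :
    ∀ v ∈ o.dropLast, halt v = false := by
  induction h with
  | leaf S => simp
  | skip h₁ hv hB ih => exact ih
  | halts h₁ hv h₂ hh => simp
  | @next _ _ _ w _ _ _ _ _ _ _ o h₁ hv h₂ hh hB ih =>
    intro v hv'
    cases o with
    | nil => simp at hv'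
    | cons a o =>
      rw [List.dropLast_cons_of_ne_nil (by simp)] at hv'
      rcases List.mem_cons.1 hv' with rfl | hv'
      · exact hh
      · exact ih v hv'

theorem Growth.last_none (h : Growth adj step halt S H B o) (hl : B.last = none) :
    B.queue = .leaf := by
  induction h with
  | leaf S => rfl
  | skip h₁ hv hB ih => exact ih hl
  | halts h₁ hv h₂ hh => simp at hl
  | next h₁ hv h₂ hh hB ih => exact ih hl

end Order

/-! ### Correctness -/

/-- Invariant of Dijkstra's algorithm: the settled keys and the queue. -/
structure DijkstraInv (adj : Fin n → List (Fin n × Profile T)) (f : Profile T → κ → κ)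
    (src : Fin n) (key₀ : κ) (S : Fin n → Option κ) (Q : List (κ × Fin n)) : Prop where
  le : ∀ u k, S u = some k → ∀ y ∈ Q, k ≤ y.1
  tree : ∀ v k, S v = some k → (v = src ∧ k = key₀) ∨
    ∃ u ku e, S u = some ku ∧ e ∈ adj u ∧ e.1 = v ∧ f e.2 ku = k
  queue : ∀ y ∈ Q, (y.2 = src ∧ y.1 = key₀) ∨
    ∃ u ku e, S u = some ku ∧ e ∈ adj u ∧ e.1 = y.2 ∧ f e.2 ku = y.1
  relaxed : ∀ u k, S u = some k → ∀ e ∈ adj u,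
    (∃ k', S e.1 = some k' ∧ k' ≤ f e.2 k) ∨ (f e.2 k, e.1) ∈ Q
  source : (∃ k, S src = some k ∧ k ≤ key₀) ∨ (key₀, src) ∈ Q

theorem DijkstraInv.perm {adj : Fin n → List (Fin n × Profile T)} {f : Profile T → κ → κ}
    {src : Fin n} {key₀ : κ} {S : Fin n → Option κ} {Q Q' : List (κ × Fin n)}
    (h : DijkstraInv adj f src key₀ S Q) (hQ : Q.Perm Q') : DijkstraInv adj f src key₀ S Q' where
  le u k hu y hy := h.le u k hu y (hQ.mem_iff.2 hy)
  tree := h.tree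
  queue y hy := h.queue y (hQ.mem_iff.2 hy)
  relaxed u k hu e he := (h.relaxed u k hu e he).imp_right hQ.mem_iff.1
  source := h.source.imp_right hQ.mem_iff.1

/-- The settled key is at most the key of the discarded duplicate, so it takes over whatever that
entry guaranteed. -/
theorem DijkstraInv.skip {adj : Fin n → List (Fin n × Profile T)} {f : Profile T → κ → κ}
    {src : Fin n} {key₀ : κ} {S : Fin n → Option κ} {Q : List (κ × Fin n)} {key : κ} {v : Fin n}
    (h : DijkstraInv adj f src key₀ S ((key, v) :: Q)) (hv : (S v).isSome = true) :
    DijkstraInv adj f src key₀ S Q := by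
  obtain ⟨kv, hkv⟩ := Option.isSome_iff_exists.1 hv
  have hle : kv ≤ key := h.le v kv hkv _ List.mem_cons_self
  refine ⟨fun u k hu y hy => h.le u k hu y (List.mem_cons_of_mem _ hy), h.tree,
    fun y hy => h.queue y (List.mem_cons_of_mem _ hy), fun u k hu e he => ?_, ?_⟩
  · rcases h.relaxed u k hu e he with h' | h'
    · exact .inl h'
    · rcases List.mem_cons.1 h' with h' | h'
      · rw [Prod.mk.injEq] at h'
        exact .inl ⟨kv, by rw [h'.2, hkv], by rw [h'.1]; exact hle⟩
      · exact .inr h'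
  · rcases h.source with h' | h'
    · exact .inl h'
    · rcases List.mem_cons.1 h' with h' | h'
      · rw [Prod.mk.injEq] at h'
        exact .inl ⟨kv, by rw [h'.2, hkv], by rw [h'.1]; exact hle⟩
      · exact .inr h'

/-- The extracted key is minimal and steps strictly increase keys, so it separates the settled keys
from the queue. Monotonicity of the steps is not needed here: it enters only when keys are compared
with arrival times. -/
theorem DijkstraInv.settle {adj : Fin n → List (Fin n × Profile T)} {f : Profile T → κ → κ}
    {src : Fin n} {key₀ : κ} {S : Fin n → Option κ} {Q : List (κ × Fin n)} {key : κ} {v : Fin n}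
    (h : DijkstraInv adj f src key₀ S ((key, v) :: Q)) (hv : S v = none)
    (hQ : ∀ y ∈ Q, key ≤ y.1) (hf : ∀ u, ∀ e ∈ adj u, ∀ k, k < f e.2 k) :
    DijkstraInv adj f src key₀ (Function.update S v (some key))
      (Q ++ (adj v).map (fun e => (f e.2 key, e.1))) ∧
    (∀ u k, Function.update S v (some key) u = some k → k ≤ key) ∧
    (∀ y ∈ Q ++ (adj v).map (fun e => (f e.2 key, e.1)), key ≤ y.1) := by
  have hup : ∀ u k, S u = some k → Function.update S v (some key) u = some k := by
    intro u k hu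
    rw [Function.update_of_ne (by rintro rfl; simp [hv] at hu), hu]
  have hcase : ∀ u k, Function.update S v (some key) u = some k →
      (u = v ∧ k = key) ∨ S u = some k := by
    intro u k hu
    by_cases huv : u = v
    · subst huv
      rw [Function.update_self] at hu
      exact .inl ⟨rfl, (Option.some.inj hu).symm⟩
    · rw [Function.update_of_ne huv] at hu
      exact .inr hu
  have hle : ∀ u k, Function.update S v (some key) u = some k → k ≤ key := by
    intro u k hu
    rcases hcase u k hu with ⟨-, rfl⟩ | hu
    · exact le_rfl
    · exact h.le u k hu _ List.mem_cons_self
  have hge : ∀ y ∈ Q ++ (adj v).map (fun e => (f e.2 key, e.1)), key ≤ y.1 := by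
    intro y hy
    rcases List.mem_append.1 hy with hy | hy
    · exact hQ y hy
    · obtain ⟨e, he, rfl⟩ := List.mem_map.1 hy
      exact (hf v e he key).le
  have hlift : ∀ w k, ((w = src ∧ k = key₀) ∨
      ∃ u ku e, S u = some ku ∧ e ∈ adj u ∧ e.1 = w ∧ f e.2 ku = k) →
      ((w = src ∧ k = key₀) ∨ ∃ u ku e, Function.update S v (some key) u = some ku ∧
        e ∈ adj u ∧ e.1 = w ∧ f e.2 ku = k) := by
    rintro w k (h' | ⟨u, ku, e, hu, h'⟩)
    · exact .inl h'
    · exact .inr ⟨u, ku, e, hup _ _ hu, h'⟩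
  refine ⟨⟨fun u k hu y hy => (hle u k hu).trans (hge y hy), ?_, ?_, ?_, ?_⟩, hle, hge⟩
  · intro w k hw
    apply hlift
    rcases hcase w k hw with ⟨rfl, rfl⟩ | hw
    · exact h.queue _ List.mem_cons_self
    · exact h.tree w k hw
  · intro y hy
    rcases List.mem_append.1 hy with hy | hy
    · exact hlift _ _ (h.queue y (List.mem_cons_of_mem _ hy))
    · obtain ⟨e, he, rfl⟩ := List.mem_map.1 hy
      exact .inr ⟨v, key, e, Function.update_self .., he, rfl, rfl⟩
  · intro u k hu e he
    rcases hcase u k hu with ⟨rfl, rfl⟩ | hu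
    · exact .inr (List.mem_append_right _ (List.mem_map.2 ⟨e, he, rfl⟩))
    · rcases h.relaxed u k hu e he with ⟨k', h', hk'⟩ | h'
      · exact .inl ⟨k', hup _ _ h', hk'⟩
      · rcases List.mem_cons.1 h' with h' | h'
        · rw [Prod.mk.injEq] at h'
          exact .inl ⟨key, by rw [h'.2, Function.update_self], by rw [h'.1]⟩
        · exact .inr (List.mem_append_left _ h')
  · rcases h.source with ⟨k', h', hk'⟩ | h'
    · exact .inl ⟨k', hup _ _ h', hk'⟩
    · rcases List.mem_cons.1 h' with h' | h'
      · rw [Prod.mk.injEq] at h'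
        exact .inl ⟨key, by rw [h'.2, Function.update_self], by rw [h'.1]⟩
      · exact .inr (List.mem_append_left _ h')

/-- What a ball knows at the end of its growth. -/
structure BallSpec (adj : Fin n → List (Fin n × Profile T)) (f : Profile T → κ → κ)
    (halt : Fin n → Bool) (src : Fin n) (key₀ : κ) (B : Ball n κ) : Prop where
  inv : DijkstraInv adj f src key₀ B.settled B.queue.toList
  last : ∀ ℓ x, B.last = some (ℓ, x) → B.settled ℓ = some x ∧ halt ℓ = true ∧
    (∀ u k, B.settled u = some k → k ≤ x) ∧ ∀ y ∈ B.queue.toList, x ≤ y.1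

theorem Growth.spec {adj : Fin n → List (Fin n × Profile T)} {step : Profile T → κ → Prog κ}
    {f : Profile T → κ → κ} {cs : ℕ} (hc : Computes adj step f cs)
    (hf : ∀ u, ∀ e ∈ adj u, ∀ k, k < f e.2 k)
    {halt : Fin n → Bool} {S : Fin n → Option κ} {H : Heap (κ × Fin n)} {B : Ball n κ}
    {o : List (Fin n)} (h : Growth adj step halt S H B o) {src : Fin n} {key₀ : κ}
    (L : H.Leftist) (O : H.Ordered) (I : DijkstraInv adj f src key₀ S H.toList) :
    BallSpec adj f halt src key₀ B := by
  induction h with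
  | leaf S => exact ⟨I, by simp⟩
  | skip h₁ hv hB ih =>
    obtain ⟨-, L₁, O₁, P₁⟩ := (Heap.merge_runs _ _ L.2.2.1 L.2.2.2 O.2.1 O.2.2).post h₁
    exact ih L₁ O₁ ((I.skip hv).perm P₁.symm)
  | @halts _ _ key v _ _ H₁ _ _ _ h₁ hv h₂ hh =>
    obtain ⟨-, L₁, O₁, P₁⟩ := (Heap.merge_runs _ _ L.2.2.1 L.2.2.2 O.2.1 O.2.2).post h₁
    obtain ⟨-, L₂, O₂, P₂⟩ := (relax_runs hc v key H₁ _ L₁ O₁ le_rfl).post h₂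
    obtain ⟨I', hle, hge⟩ := I.settle hv (fun y hy => O.1 y hy) hf
    have P : (_ : List (κ × Fin n)).Perm _ := P₂.trans (P₁.append_right _)
    refine ⟨I'.perm P.symm, ?_⟩
    intro ℓ x hx
    simp only [Option.some.injEq, Prod.mk.injEq] at hx
    obtain ⟨rfl, rfl⟩ := hx
    exact ⟨Function.update_self .., hh, hle, fun y hy => hge y (P.mem_iff.1 hy)⟩
  | @next _ _ key v _ _ H₁ _ _ _ _ _ h₁ hv h₂ hh hB ih =>
    obtain ⟨-, L₁, O₁, P₁⟩ := (Heap.merge_runs _ _ L.2.2.1 L.2.2.2 O.2.1 O.2.2).post h₁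
    obtain ⟨-, L₂, O₂, P₂⟩ := (relax_runs hc v key H₁ _ L₁ O₁ le_rfl).post h₂
    obtain ⟨I', hle, hge⟩ := I.settle hv (fun y hy => O.1 y hy) hf
    have P : (_ : List (κ × Fin n)).Perm _ := P₂.trans (P₁.append_right _)
    exact ih L₂ O₂ (I'.perm P.symm)

theorem DijkstraInv.init (adj : Fin n → List (Fin n × Profile T)) (f : Profile T → κ → κ)
    (src : Fin n) (key₀ : κ) : DijkstraInv adj f src key₀ (fun _ => none) [(key₀, src)] where
  le _ _ h := by simp at h
  tree _ _ h := by simp at h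
  queue y hy := by
    rw [List.mem_singleton] at hy
    subst hy
    exact .inl ⟨rfl, rfl⟩
  relaxed _ _ h := by simp at h
  source := .inr (List.mem_singleton.2 rfl)

/-- Bound for the number of steps of Dijkstra's algorithm when `a` arcs leave the settled vertices,
out of at most `N`. -/
def dijkstraCost (cs N a : ℕ) : ℕ :=
  1 + (1 + a) * (2 * Nat.log 2 (N + 2) + 2) + a * (cs + Nat.log 2 (N + 2) + 3)

theorem dijkstra_ret {adj : Fin n → List (Fin n × Profile T)} {step : Profile T → κ → Prog κ}
    {f : Profile T → κ → κ} {cs N : ℕ} (hc : Computes adj step f cs)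
    (hf : ∀ u, ∀ e ∈ adj u, ∀ k, k < f e.2 k) (halt : Fin n → Bool) (src : Fin n) (key₀ : κ)
    (hN : ∑ u, (adj u).length ≤ N) :
    ∃ B k o, Ret (dijkstra adj step halt src key₀) B k ∧
      Growth adj step halt (fun _ => none) (.node 1 (key₀, src) .leaf .leaf) B o ∧
      BallSpec adj f halt src key₀ B ∧ k ≤ dijkstraCost cs N (outArcs adj o) := by
  have L : (Heap.node 1 (key₀, src) .leaf .leaf).Leftist := by simp [Heap.Leftist, Heap.rank]
  have O : (Heap.node 1 (key₀, src) .leaf .leaf).Ordered := by simp [Heap.Ordered, Heap.toList]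
  -- One more than the number of arcs, for the source that is in the queue at the start.
  obtain ⟨B, k, o, h, hG, hk⟩ := grow_ret hc halt (N + 1) (fun _ => none)
    (.node 1 (key₀, src) .leaf .leaf) L O (by simp [Heap.toList, pending]; omega)
  refine ⟨B, k, o, h, hG, hG.spec hc hf L O ?_, ?_⟩
  · simpa [Heap.toList] using DijkstraInv.init adj f src key₀
  · simpa [Heap.toList, dijkstraCost] using hk

/-- Induction along the shortest-path tree. -/
theorem DijkstraInv.tree_induction {adj : Fin n → List (Fin n × Profile T)}
    {f : Profile T → κ → κ} {src : Fin n} {key₀ : κ} {S : Fin n → Option κ}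
    {Q : List (κ × Fin n)} (h : DijkstraInv adj f src key₀ S Q)
    (hf : ∀ u, ∀ e ∈ adj u, ∀ k, k < f e.2 k) (P : Fin n → κ → Prop) (h₀ : P src key₀)
    (hs : ∀ u k, S u = some k → P u k → ∀ e ∈ adj u, S e.1 = some (f e.2 k) →
      P e.1 (f e.2 k)) :
    ∀ v k, S v = some k → P v k := by
  -- Keys increase strictly along tree arcs and there are finitely many vertices, so comparison of
  -- settled keys is well founded.
  let r : Fin n → Fin n → Prop := fun u v => ∃ ku kv, S u = some ku ∧ S v = some kv ∧ ku < kv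
  have htr : IsTrans (Fin n) r := ⟨by
    rintro a b c ⟨ka, kb, ha, hb, hab⟩ ⟨kb', kc, hb', hc, hbc⟩
    rw [hb] at hb'
    obtain rfl := Option.some.inj hb'
    exact ⟨ka, kc, ha, hc, hab.trans hbc⟩⟩
  have hirr : Std.Irrefl r := ⟨by
    rintro a ⟨ka, kb, ha, hb, hab⟩
    rw [ha] at hb
    obtain rfl := Option.some.inj hb
    exact lt_irrefl _ hab⟩
  have hwf : WellFounded r := Finite.wellFounded_of_trans_of_irrefl r
  intro v
  induction v using hwf.induction with
  | _ v ih =>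
    intro k hv
    rcases h.tree v k hv with ⟨rfl, rfl⟩ | ⟨u, ku, e, hu, he, rfl, rfl⟩
    · exact h₀
    · exact hs u ku hu (ih u ⟨ku, _, hu, hv, hf u e he ku⟩ ku hu) e he hv

/-- A run without halting vertices settles everything within reach. -/
theorem dijkstra_full_runs {adj : Fin n → List (Fin n × Profile T)}
    {step : Profile T → κ → Prog κ} {f : Profile T → κ → κ} {cs N : ℕ}
    (hc : Computes adj step f cs) (hf : ∀ u, ∀ e ∈ adj u, ∀ k, k < f e.2 k) (src : Fin n)
    (key₀ : κ) (hN : ∑ u, (adj u).length ≤ N) (hD₀ : ∀ P : Fin n → Prop,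
      P src → (∀ u, P u → ∀ e ∈ adj u, P e.1) → ∀ v, P v) :
    Runs (dijkstra adj step (fun _ => false) src key₀) (dijkstraCost cs N N) (fun B =>
      ∃ key : Fin n → κ, (∀ v, B.settled v = some (key v)) ∧ key src = key₀ ∧
        (∀ u, ∀ e ∈ adj u, key e.1 ≤ f e.2 (key u)) ∧
        (∀ P : Fin n → Prop, P src →
          (∀ u, P u → ∀ e ∈ adj u, key e.1 = f e.2 (key u) → P e.1) → ∀ v, P v)) := by
  obtain ⟨B, k, o, h, hG, hB, hk⟩ := dijkstra_ret hc hf (fun _ => false) src key₀ hN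
  have hlast : B.last = none := by
    rcases hl : B.last with _ | ⟨ℓ, x⟩
    · rfl
    · have := (hB.last ℓ x hl).2.1
      simp at this
  have hq : B.queue.toList = [] := by rw [hG.last_none hlast]; rfl
  have I := hB.inv
  rw [hq] at I
  have hall : ∀ v, (B.settled v).isSome = true := by
    apply hD₀
    · rcases I.source with ⟨k, hk, -⟩ | h
      · simp [hk]
      · simp at h
    · intro u hu e he
      obtain ⟨ku, hku⟩ := Option.isSome_iff_exists.1 hu
      rcases I.relaxed u ku hku e he with ⟨k, hk, -⟩ | h
      · simp [hk]
      · simp at h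
  have hsome : ∀ v, B.settled v = some ((B.settled v).get (hall v)) := fun v => by simp
  refine h.runs ?_ ⟨fun v => (B.settled v).get (hall v), hsome, ?_, ?_, ?_⟩
  · refine hk.trans ?_
    have : outArcs adj o ≤ N := by
      refine le_trans ?_ hN
      unfold outArcs
      rw [← List.sum_toFinset _ hG.nodup.1]
      exact Finset.sum_le_sum_of_subset (Finset.subset_univ _)
    unfold dijkstraCost
    gcongr
  · apply le_antisymm
    · rcases I.source with ⟨k, hk, hle⟩ | h
      · simpa [hk] using hle
      · simp at h
    · refine I.tree_induction hf (fun _ k => key₀ ≤ k) le_rfl ?_ src _ (hsome src)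
      intro u k hu hle e he _
      exact hle.trans (hf u e he k).le
  · intro u e he
    rcases I.relaxed u _ (hsome u) e he with ⟨k, hk, hle⟩ | h
    · simpa [hk] using hle
    · simp at h
  · intro P h₀ hs v
    refine I.tree_induction hf (fun v _ => P v) h₀ ?_ v _ (hsome v)
    intro u k hu hP e he hk
    refine hs u hP e he ?_
    simp [hk, hu]

end Dijkstra

/-! ## Delay functions -/

open Filter Topology

/-- `interp` picks the first segment whose right end is not before `s`. If `s` is the left end of
the given segment, this is the previous segment, which has the same value there. -/
theorem interp_segment (l₁ : List (ℝ × ℝ)) (p q : ℝ × ℝ) (l₂ : List (ℝ × ℝ)) {s : ℝ}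
    (hs : (l₁ ++ p :: q :: l₂).Pairwise (fun p q => p.1 < q.1)) (h₁ : p.1 ≤ s) (h₂ : s ≤ q.1) :
    interp (l₁ ++ p :: q :: l₂) s = p.2 + slope2 p q * (s - p.1) := by
  induction l₁ with
  | nil => simp [interp, h₂, slope2]
  | cons a l₁ ih =>
    have ih := ih (List.pairwise_cons.1 hs).2
    cases l₁ with
    | nil =>
      have hap : a.1 < p.1 := (List.pairwise_cons.1 hs).1 p (by simp)
      simp only [List.cons_append, List.nil_append, interp] at ih ⊢
      by_cases h : s ≤ p.1
      · obtain rfl : s = p.1 := le_antisymm h h₁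
        have : p.1 - a.1 ≠ 0 := by linarith
        simp
        field_simp
        ring
      · rw [if_neg h, ih]
    | cons b l₁ =>
      have hbp : b.1 < p.1 :=
        (List.pairwise_cons.1 (List.pairwise_cons.1 hs).2).1 p (by simp)
      rw [← ih]
      simp only [List.cons_append]
      rw [interp, if_neg (by linarith)]

theorem mem_spoilAux (l₁ : List (ℝ × ℝ)) (p q r : ℝ × ℝ) (l₂ : List (ℝ × ℝ)) (σ : ℝ)
    (h : slope2 p q < slope2 q r) : q.1 ∈ spoilAux σ (l₁ ++ p :: q :: r :: l₂) := by
  induction l₁ generalizing σ with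
  | nil =>
    simp only [List.nil_append]
    rw [spoilAux, spoilAux, if_pos h]
    split_ifs <;> simp
  | cons a l₁ ih =>
    cases l₁ with
    | nil =>
      have := ih (slope2 a p)
      simp only [List.cons_append, List.nil_append] at this ⊢
      rw [spoilAux]
      split_ifs
      · exact List.mem_cons_of_mem _ this
      · exact this
    | cons b l₁ =>
      have := ih (slope2 a b)
      simp only [List.cons_append] at this ⊢
      rw [spoilAux]
      split_ifs
      · exact List.mem_cons_of_mem _ this
      · exact this

theorem lastSlope_append (l : List (ℝ × ℝ)) (p q : ℝ × ℝ) :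
    lastSlope (l ++ [p, q]) = slope2 p q := by
  simp [lastSlope]

namespace Profile

variable {T : ℝ}

/-- The `i`-th breakpoint. -/
def pt (P : Profile T) (i : ℕ) : ℝ × ℝ := P.pts.getD i (0, 0)

theorem pt_eq (P : Profile T) {i : ℕ} (hi : i < P.pts.toList.length) :
    P.pt i = P.pts.toList[i] := by
  have hi' : i < P.pts.size := by simpa using hi
  simp [pt, Array.getD, hi']

theorem two_le_size (P : Profile T) (hT : 0 < T) : 2 ≤ P.pts.size := by
  have h₁ := P.first
  have h₂ := P.last
  rw [← Array.length_toList]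
  match h : P.pts.toList with
  | [] => simp [h] at h₁
  | [p] =>
    rw [h] at h₁ h₂
    simp only [List.head?_cons, List.getLast?_singleton, Option.some.injEq] at h₁ h₂
    rw [h₁, Prod.mk.injEq] at h₂
    linarith [h₂.1]
  | _ :: _ :: _ => simp

theorem pt_zero (P : Profile T) (hT : 0 < T) : P.pt 0 = (0, P.base) := by
  have h := P.two_le_size hT
  have h₁ := P.first
  rw [pt_eq P (by simp; omega)]
  rw [List.head?_eq_getElem?, List.getElem?_eq_getElem (by simp; omega)] at h₁
  exact Option.some.inj h₁

theorem pt_last (P : Profile T) (hT : 0 < T) : P.pt (P.pts.size - 1) = (T, P.base) := by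
  have h := P.two_le_size hT
  have h₁ := P.last
  rw [pt_eq P (by simp; omega)]
  rw [List.getLast?_eq_getElem?, List.getElem?_eq_getElem (by simp; omega)] at h₁
  simpa using Option.some.inj h₁

theorem pt_lt (P : Profile T) {i j : ℕ} (hij : i < j) (hj : j < P.pts.size) :
    (P.pt i).1 < (P.pt j).1 := by
  rw [pt_eq P (by simp; omega), pt_eq P (by simpa using hj)]
  exact List.pairwise_iff_getElem.1 P.sorted i j _ _ hij

theorem pt_pos (P : Profile T) {i : ℕ} (hi : i < P.pts.size) : 0 < (P.pt i).2 := by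
  rw [pt_eq P (by simpa using hi)]
  exact P.pos _ (List.getElem_mem _)

theorem toList_split (P : Profile T) {i : ℕ} (hi : i + 1 < P.pts.size) :
    P.pts.toList = P.pts.toList.take i ++ P.pt i :: P.pt (i + 1) :: P.pts.toList.drop (i + 2) := by
  have h₁ : i + 1 < P.pts.toList.length := by simpa using hi
  rw [pt_eq P h₁, pt_eq P (Nat.lt_of_succ_lt h₁), List.cons_getElem_drop_succ,
    List.cons_getElem_drop_succ, List.take_append_drop]

theorem interp_eq (P : Profile T) {i : ℕ} (hi : i + 1 < P.pts.size) {s : ℝ}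
    (h₁ : (P.pt i).1 ≤ s) (h₂ : s ≤ (P.pt (i + 1)).1) :
    interp P.pts.toList s = (P.pt i).2 + slope2 (P.pt i) (P.pt (i + 1)) * (s - (P.pt i).1) := by
  have hs := P.sorted
  rw [P.toList_split hi] at hs ⊢
  exact interp_segment _ _ _ _ hs h₁ h₂

/-- The closed interval includes `s = T`, where the fractional part jumps to 0; the identity
survives because the first and the last breakpoint share the value `base`. -/
theorem delay_eq (P : Profile T) (hT : 0 < T) {s : ℝ} (hs : s ∈ Set.Icc 0 T) (k : ℤ) :
    P.delay (s + k * T) = interp P.pts.toList s := by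
  have h2 := P.two_le_size hT
  unfold delay
  have e : (s + k * T) / T = s / T + k := by field_simp
  rw [e, Int.fract_add_intCast]
  rcases hs.2.lt_or_eq with h | h
  · rw [Int.fract_eq_self.2 ⟨div_nonneg hs.1 hT.le, (div_lt_one hT).2 h⟩]
    congr 1
    field_simp
  · subst h
    rw [div_self hT.ne', Int.fract_one, mul_zero]
    have e₁ := P.pt_zero hT
    have e₂ := P.pt_last hT
    have l₁ := P.pt_lt (i := 0) (j := 1) (by omega) (by omega)
    rw [P.interp_eq (i := 0) (s := 0) (by omega) (by rw [e₁]) (by rw [e₁] at l₁; exact l₁.le)]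
    have hs' : P.pts.size - 2 + 1 = P.pts.size - 1 := by omega
    have l₂ := P.pt_lt (i := P.pts.size - 2) (j := P.pts.size - 1) (by omega) (by omega)
    rw [P.interp_eq (i := P.pts.size - 2) (s := s) (by omega)
      (by rw [e₂] at l₂; exact l₂.le) (by rw [hs', e₂]), hs', e₁]
    unfold slope2
    rw [e₂] at l₂ ⊢
    have : s - (P.pt (P.pts.size - 2)).1 ≠ 0 := by simp at l₂; linarith
    simp
    field_simp
    ring

theorem delay_periodic (P : Profile T) (hT : 0 < T) (t : ℝ) (k : ℤ) :
    P.delay (t + k * T) = P.delay t := by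
  unfold delay
  have e : (t + k * T) / T = t / T + k := by field_simp
  rw [e, Int.fract_add_intCast]

theorem interp_pos (P : Profile T) {i : ℕ} (hi : i + 1 < P.pts.size) {s : ℝ}
    (h₁ : (P.pt i).1 ≤ s) (h₂ : s ≤ (P.pt (i + 1)).1) : 0 < interp P.pts.toList s := by
  rw [P.interp_eq hi h₁ h₂]
  have p₁ := P.pt_pos (i := i) (by omega)
  have p₂ := P.pt_pos hi
  have l := P.pt_lt (Nat.lt_succ_self i) hi
  have hd : 0 < (P.pt (i + 1)).1 - (P.pt i).1 := by linarith
  unfold slope2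
  have e : (P.pt i).2 + ((P.pt (i + 1)).2 - (P.pt i).2) / ((P.pt (i + 1)).1 - (P.pt i).1) *
      (s - (P.pt i).1) = ((P.pt i).2 * ((P.pt (i + 1)).1 - s) +
        (P.pt (i + 1)).2 * (s - (P.pt i).1)) / ((P.pt (i + 1)).1 - (P.pt i).1) := by
    field_simp
    ring
  rw [e]
  refine div_pos ?_ hd
  rcases h₁.lt_or_eq with h | h
  · have := mul_pos p₂ (sub_pos.2 h)
    have := mul_nonneg p₁.le (sub_nonneg.2 h₂)
    linarith
  · rw [← h, sub_self, mul_zero, add_zero]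
    exact mul_pos p₁ hd

/-- Slope from the left or from the right at time `t`. -/
def slope (P : Profile T) (left : Bool) (t : ℝ) : ℝ :=
  ((lookup T P.pts left t).run 0).elim 0 (fun y => y.1.2)

end Profile

/-- Value and slope at the position found by `lookup`. -/
theorem lookup_runs {T : ℝ} (pts : Array (ℝ × ℝ)) (left : Bool) (t s : ℝ)
    (hs : s = if left then T - T * Int.fract (-t / T) else T * Int.fract (t / T))
    (h2 : 2 ≤ pts.size)
    (h0 : if left then (pts.getD 0 (0, 0)).1 < s else (pts.getD 0 (0, 0)).1 ≤ s)
    (h1 : if left then s ≤ (pts.getD (pts.size - 1) (0, 0)).1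
      else s < (pts.getD (pts.size - 1) (0, 0)).1) :
    Runs (lookup T pts left t) (Nat.clog 2 pts.size + 2) (fun y => ∃ i, i + 1 < pts.size ∧
      (if left then (pts.getD i (0, 0)).1 < s ∧ s ≤ (pts.getD (i + 1) (0, 0)).1
        else (pts.getD i (0, 0)).1 ≤ s ∧ s < (pts.getD (i + 1) (0, 0)).1) ∧
      y.2 = slope2 (pts.getD i (0, 0)) (pts.getD (i + 1) (0, 0)) ∧
      y.1 = (pts.getD i (0, 0)).2 + y.2 * (s - (pts.getD i (0, 0)).1)) := by
  unfold lookup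
  simp only
  rw [← hs]
  refine ((bsearch_runs _ 0 (pts.size - 1) (by omega) ?_ ?_).bind (b' := 1) ?_).mono ?_
    fun _ h => h
  · cases left <;> simpa using h0
  · cases left <;> simpa using h1
  · rintro i ⟨-, hi, hp, hp'⟩
    refine (Runs.tick (b := 0) ?_)
    refine Runs.pure ⟨i, by omega, ?_, rfl, rfl⟩ 0
    cases left <;> simpa using And.intro hp hp'
  · have : Nat.clog 2 (pts.size - 1 - 0) ≤ Nat.clog 2 pts.size := Nat.clog_mono_right _ (by omega)
    omega

theorem mul_fract_mem {T : ℝ} (hT : 0 < T) (t : ℝ) : T * Int.fract (t / T) ∈ Set.Ico 0 T := by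
  refine ⟨mul_nonneg hT.le (Int.fract_nonneg _), ?_⟩
  have := mul_lt_mul_of_pos_left (Int.fract_lt_one (t / T)) hT
  linarith

theorem mul_fract_eq {T : ℝ} (hT : 0 < T) (t : ℝ) : T * Int.fract (t / T) = t - ⌊t / T⌋ * T := by
  unfold Int.fract
  field_simp

namespace Profile

variable {T : ℝ}

/-- The second part records which segment is found: closed at the left end for the right slope,
closed at the right end for the left slope. The segment thus extends beyond `t` on the requested
side, which makes the slope one-sided. -/
theorem lookup_ret (P : Profile T) (hT : 0 < T) (left : Bool) (t : ℝ) :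
    Runs (lookup T P.pts left t) (Nat.clog 2 P.pts.size + 2)
      (fun y => y = (P.delay t, P.slope left t)) ∧
    ∃ (i : ℕ) (k : ℤ), i + 1 < P.pts.size ∧ P.slope left t = slope2 (P.pt i) (P.pt (i + 1)) ∧
      (if left then 0 < t - k * T ∧ t - k * T ≤ T ∧ (P.pt i).1 < t - k * T ∧
          t - k * T ≤ (P.pt (i + 1)).1
        else 0 ≤ t - k * T ∧ t - k * T < T ∧ (P.pt i).1 ≤ t - k * T ∧
          t - k * T < (P.pt (i + 1)).1) := by
  have e₁ := P.pt_zero hT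
  have e₂ := P.pt_last hT
  obtain ⟨k, hk⟩ : ∃ k : ℤ,
      (if left then T - T * Int.fract (-t / T) else T * Int.fract (t / T)) = t - k * T := by
    cases left
    · exact ⟨⌊t / T⌋, mul_fract_eq hT t⟩
    -- From the left, the representative of `t` modulo `T` is taken in (0, T], so that time 0 is
    -- looked up at the end of the last segment.
    · refine ⟨-1 - ⌊-t / T⌋, ?_⟩
      have := mul_fract_eq hT (-t)
      simp only [if_true]
      push_cast
      linarith
  have hmem : if left then 0 < t - k * T ∧ t - k * T ≤ T else 0 ≤ t - k * T ∧ t - k * T < T := by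
    rw [← hk]
    cases left
    · exact mul_fract_mem hT t
    · have := mul_fract_mem hT (-t)
      simp only [if_true]
      constructor <;> linarith [this.1, this.2]
  have h := lookup_runs P.pts left t (t - k * T) hk.symm (P.two_le_size hT)
    (by
      change if left then (P.pt 0).1 < _ else (P.pt 0).1 ≤ _
      rw [e₁]
      cases left
      · exact hmem.1
      · exact hmem.1)
    (by
      change if left then _ ≤ (P.pt _).1 else _ < (P.pt _).1
      rw [e₂]
      cases left
      · exact hmem.2
      · exact hmem.2)
  obtain ⟨y, c, hr, hc, i, hi, hs, hy₂, hy₁⟩ := h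
  have hsl : P.slope left t = y.2 := by
    unfold slope
    rw [hr 0]
    rfl
  have hle : (P.pt i).1 ≤ t - k * T ∧ t - k * T ≤ (P.pt (i + 1)).1 := by
    cases left
    · exact ⟨hs.1, hs.2.le⟩
    · exact ⟨hs.1.le, hs.2⟩
  have hle' : 0 ≤ t - k * T ∧ t - k * T ≤ T := by
    cases left
    · exact ⟨hmem.1, hmem.2.le⟩
    · exact ⟨hmem.1.le, hmem.2⟩
  refine ⟨⟨y, c, hr, hc, ?_⟩, i, k, hi, hsl.trans hy₂, ?_⟩
  · refine Prod.ext ?_ hsl.symm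
    have := P.delay_eq hT (s := t - k * T) hle' k
    rw [sub_add_cancel] at this
    rw [this, P.interp_eq hi hle.1 hle.2, hy₁, hy₂]
    rfl
  · cases left
    · exact ⟨hmem.1, hmem.2, hs.1, hs.2⟩
    · exact ⟨hmem.1, hmem.2, hs.1, hs.2⟩

theorem delay_segment (P : Profile T) (hT : 0 < T) {i : ℕ} (hi : i + 1 < P.pts.size) {k : ℤ}
    {t : ℝ} (h₁ : (P.pt i).1 ≤ t - k * T) (h₂ : t - k * T ≤ (P.pt (i + 1)).1) :
    P.delay t = (P.pt i).2 + slope2 (P.pt i) (P.pt (i + 1)) * (t - k * T - (P.pt i).1) := by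
  have h0 : 0 ≤ (P.pt i).1 := by
    rcases Nat.eq_zero_or_pos i with rfl | h
    · rw [P.pt_zero hT]
    · have := P.pt_lt h (by omega)
      rw [P.pt_zero hT] at this
      exact this.le
  have h1 : (P.pt (i + 1)).1 ≤ T := by
    rcases Nat.lt_or_ge (i + 1) (P.pts.size - 1) with h | h
    · have := P.pt_lt h (by omega)
      rw [P.pt_last hT] at this
      exact this.le
    · have : i + 1 = P.pts.size - 1 := by omega
      rw [this, P.pt_last hT]
  have := P.delay_eq hT (s := t - k * T) ⟨h0.trans h₁, h₂.trans h1⟩ k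
  rw [sub_add_cancel] at this
  rw [this, P.interp_eq hi h₁ h₂]

theorem delay_pos (P : Profile T) (hT : 0 < T) (t : ℝ) : 0 < P.delay t := by
  obtain ⟨-, i, k, hi, -, h⟩ := P.lookup_ret hT false t
  simp only [Bool.false_eq_true, if_false] at h
  rw [P.delay_segment hT hi h.2.2.1 h.2.2.2.le, ← P.interp_eq hi h.2.2.1 h.2.2.2.le]
  exact P.interp_pos hi h.2.2.1 h.2.2.2.le

theorem delay_right (P : Profile T) (hT : 0 < T) (t : ℝ) :
    ∀ᶠ δ in 𝓝[>] (0 : ℝ), P.delay (t + δ) = P.delay t + P.slope false t * δ := by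
  obtain ⟨-, i, k, hi, hs, h⟩ := P.lookup_ret hT false t
  simp only [Bool.false_eq_true, if_false] at h
  have hpos : 0 < (P.pt (i + 1)).1 - (t - k * T) := by linarith [h.2.2.2]
  filter_upwards [Ioo_mem_nhdsGT hpos] with δ hδ
  rw [P.delay_segment hT hi (t := t + δ) (k := k) (by linarith [hδ.1, h.2.2.1])
    (by linarith [hδ.2]), P.delay_segment hT hi h.2.2.1 h.2.2.2.le, hs]
  ring

theorem delay_left (P : Profile T) (hT : 0 < T) (t : ℝ) :
    ∀ᶠ δ in 𝓝[>] (0 : ℝ), P.delay (t - δ) = P.delay t - P.slope true t * δ := by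
  obtain ⟨-, i, k, hi, hs, h⟩ := P.lookup_ret hT true t
  simp only [if_true] at h
  have hpos : 0 < t - k * T - (P.pt i).1 := by linarith [h.2.2.1]
  filter_upwards [Ioo_mem_nhdsGT hpos] with δ hδ
  rw [P.delay_segment hT hi (t := t - δ) (k := k) (by linarith [hδ.2])
    (by linarith [hδ.1, h.2.2.2]), P.delay_segment hT hi h.2.2.1.le h.2.2.2, hs]
  ring

/-- If the right slope exceeds the left one, the two lookups used different segments, so `t` is a
breakpoint modulo `T`. It is either interior, between consecutive segments, or the seam between `T`
and 0, where `spoilTimes` starts from the last slope for this reason. -/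
theorem slope_le_of_not_spoiling (P : Profile T) (hT : 0 < T) {t : ℝ}
    (ht : T * Int.fract (t / T) ∉ P.spoilTimes) : P.slope false t ≤ P.slope true t := by
  by_contra hlt
  rw [not_le] at hlt
  apply ht
  have h2 := P.two_le_size hT
  obtain ⟨-, i, k, hi, hs, h⟩ := P.lookup_ret hT false t
  obtain ⟨-, j, m, hj, hs', h'⟩ := P.lookup_ret hT true t
  simp only [Bool.false_eq_true, if_false] at h
  simp only [if_true] at h'
  have hf : T * Int.fract (t / T) = t - k * T := by
    have e : t / T = (t - k * T) / T + k := by field_simp; ring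
    rw [e, Int.fract_add_intCast, Int.fract_eq_self.2
      ⟨div_nonneg h.1 hT.le, (div_lt_one hT).2 h.2.1⟩]
    field_simp
  rw [hf, spoilTimes]
  rw [hs, hs'] at hlt
  -- The representatives lie in [0, T) and in (0, T], hence coincide or differ by `T`; the latter is
  -- the seam.
  have hkm : k = m ∨ k = m + 1 := by
    have h₁ : ((m : ℝ) - k) * T < T := by nlinarith [h.2.1, h'.1]
    have h₂ : ((k : ℝ) - m) * T ≤ T := by nlinarith [h.1, h'.2.1]
    have h₁' : (m : ℝ) - k < 1 := by
      by_contra hc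
      nlinarith
    have h₂' : (k : ℝ) - m ≤ 1 := by
      by_contra hc
      nlinarith
    have : m - k < 1 := by exact_mod_cast h₁'
    have : k - m ≤ 1 := by exact_mod_cast h₂'
    omega
  rcases hkm with rfl | rfl
  · have hij : i < j + 1 + 1 := by
      by_contra hc
      have := P.pt_lt (i := j + 1) (j := i) (by omega) (by omega)
      linarith [h.2.2.1, h'.2.2.2]
    have hji : j < i + 1 := by
      by_contra hc
      rcases Nat.eq_or_lt_of_le (Nat.not_lt.1 hc) with hc | hc
      · rw [hc] at h
        linarith [h.2.2.2, h'.2.2.1]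
      · have := P.pt_lt (i := i + 1) (j := j) (by omega) (by omega)
        linarith [h.2.2.2, h'.2.2.1]
    rcases Nat.eq_or_lt_of_le (Nat.lt_succ_iff.1 hji) with rfl | hji
    · exact absurd hlt (lt_irrefl _)
    · have : i = j + 1 := by omega
      subst this
      have hx : t - k * T = (P.pt (j + 1)).1 := le_antisymm h'.2.2.2 h.2.2.1
      rw [hx, P.toList_split hj]
      have hd : P.pts.toList.drop (j + 2) = P.pt (j + 1 + 1) :: P.pts.toList.drop (j + 3) := by
        have : j + 2 < P.pts.toList.length := by simpa using hi
        rw [pt_eq P this, List.cons_getElem_drop_succ]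
      rw [hd]
      exact mem_spoilAux _ _ _ _ _ _ hlt
  · have hx : t - (m + 1 : ℤ) * T = 0 := by
      have := h.1
      push_cast at this ⊢
      linarith [h'.2.1]
    rw [hx] at h ⊢
    have hi0 : i = 0 := by
      by_contra hc
      have := P.pt_lt (i := 0) (j := i) (by omega) (by omega)
      rw [P.pt_zero hT] at this
      linarith [h.2.2.1]
    subst hi0
    have hjl : j + 1 = P.pts.size - 1 := by
      by_contra hc
      have := P.pt_lt (i := j + 1) (j := P.pts.size - 1) (by omega) (by omega)
      rw [P.pt_last hT] at this
      have : t - m * T = T := by push_cast at hx; linarith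
      linarith [h'.2.2.2]
    have hls : lastSlope P.pts.toList = slope2 (P.pt j) (P.pt (j + 1)) := by
      rw [P.toList_split hj]
      have : P.pts.toList.drop (j + 2) = [] := by
        apply List.drop_eq_nil_of_le
        simp
        omega
      rw [this]
      exact lastSlope_append _ _ _
    rw [hls]
    rw [P.toList_split hi]
    simp only [List.take_zero, List.nil_append]
    rw [spoilAux, if_pos hlt, P.pt_zero hT]
    simp

end Profile

/-! ### Steps over arcs -/

theorem stepTime_runs {T : ℝ} (P : Profile T) (hT : 0 < T) (t : ℝ) :
    Runs (stepTime P t) (Nat.clog 2 P.pts.size + 2) (fun k => k = t + P.delay t) := by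
  refine ((P.lookup_ret hT false t).1.bind (b' := 0) ?_).mono (by omega) fun _ h => h
  rintro y rfl
  exact Runs.pure (Q := fun x => x = _) rfl 0

/-- The value of `stepGerm`. -/
def Profile.germStep {T : ℝ} (P : Profile T) (g : ℝ ×ₗ ℝ) : ℝ ×ₗ ℝ :=
  toLex ((ofLex g).1 + P.delay (ofLex g).1,
    (ofLex g).2 * (1 + P.slope (decide ((ofLex g).2 < 0)) (ofLex g).1))

theorem stepGerm_runs {T : ℝ} (P : Profile T) (hT : 0 < T) (g : ℝ ×ₗ ℝ) :
    Runs (stepGerm P g) (Nat.clog 2 P.pts.size + 2) (fun k => k = P.germStep g) := by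
  refine ((P.lookup_ret hT _ _).1.bind (b' := 0) ?_).mono (by omega) fun _ h => h
  rintro y rfl
  exact Runs.pure (Q := fun x => x = _) rfl 0

/-- The time `x + σ·δ` that the pair `(x, σ)` stands for. -/
def germ (g : ℝ ×ₗ ℝ) (δ : ℝ) : ℝ := (ofLex g).1 + (ofLex g).2 * δ

/-- The lexicographic order is the order of the represented times for all small `δ > 0`. A single
run of Dijkstra's algorithm on pairs thus handles departures just after or just before `t`. -/
theorem germ_le_iff (g g' : ℝ ×ₗ ℝ) :
    g ≤ g' ↔ ∀ᶠ δ in 𝓝[>] (0 : ℝ), germ g δ ≤ germ g' δ := by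
  rw [Prod.Lex.le_iff]
  have hpos : ∀ᶠ δ in 𝓝[>] (0 : ℝ), 0 < δ := eventually_mem_nhdsWithin
  have hcont : ∀ h : ℝ ×ₗ ℝ, Tendsto (germ h) (𝓝[>] (0 : ℝ)) (𝓝 (ofLex h).1) := by
    intro h
    have : Continuous (germ h) := by unfold germ; fun_prop
    have := this.tendsto 0
    simp only [germ, mul_zero, add_zero] at this
    exact this.mono_left nhdsWithin_le_nhds
  constructor
  · rintro (h | ⟨h, h'⟩)
    · filter_upwards [(hcont g).eventually_lt (hcont g') h] with δ hδ using hδ.le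
    · filter_upwards [hpos] with δ hδ
      unfold germ
      rw [h]
      have := mul_le_mul_of_nonneg_right h' hδ.le
      linarith
  · intro h
    have h₁ : (ofLex g).1 ≤ (ofLex g').1 := le_of_tendsto_of_tendsto (hcont g) (hcont g') h
    rcases h₁.lt_or_eq with h₁ | h₁
    · exact .inl h₁
    · refine .inr ⟨h₁, ?_⟩
      obtain ⟨δ, hδ, hp⟩ := (h.and hpos).exists
      unfold germ at hδ
      rw [h₁] at hδ
      exact le_of_mul_le_mul_right (by linarith) hp

/-- The sign of `σ` tells from which side the arc is entered. For `σ = 0` the represented time is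
constant and the slope is multiplied by 0. -/
theorem Profile.germ_germStep {T : ℝ} (P : Profile T) (hT : 0 < T) (g : ℝ ×ₗ ℝ) :
    ∀ᶠ δ in 𝓝[>] (0 : ℝ), germ g δ + P.delay (germ g δ) = germ (P.germStep g) δ := by
  rcases lt_trichotomy (ofLex g).2 0 with h | h | h
  · have ht : Tendsto (fun δ : ℝ => -(ofLex g).2 * δ) (𝓝[>] (0 : ℝ)) (𝓝[>] (0 : ℝ)) := by
      refine tendsto_nhdsWithin_iff.2 ⟨?_, ?_⟩
      · have : Continuous fun δ : ℝ => -(ofLex g).2 * δ := by fun_prop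
        have := this.tendsto 0
        rw [mul_zero] at this
        exact this.mono_left nhdsWithin_le_nhds
      · filter_upwards [self_mem_nhdsWithin] with δ hδ
        exact mul_pos (neg_pos.2 h) hδ
    filter_upwards [ht.eventually (P.delay_left hT (ofLex g).1)] with δ hδ
    unfold germ Profile.germStep
    rw [show (ofLex g).1 + (ofLex g).2 * δ = (ofLex g).1 - -(ofLex g).2 * δ by ring, hδ]
    simp [h]
    ring
  · filter_upwards with δ
    simp [germ, Profile.germStep, h]
  · have ht : Tendsto (fun δ : ℝ => (ofLex g).2 * δ) (𝓝[>] (0 : ℝ)) (𝓝[>] (0 : ℝ)) := by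
      refine tendsto_nhdsWithin_iff.2 ⟨?_, ?_⟩
      · have : Continuous fun δ : ℝ => (ofLex g).2 * δ := by fun_prop
        have := this.tendsto 0
        rw [mul_zero] at this
        exact this.mono_left nhdsWithin_le_nhds
      · filter_upwards [self_mem_nhdsWithin] with δ hδ
        exact mul_pos h hδ
    filter_upwards [ht.eventually (P.delay_right hT (ofLex g).1)] with δ hδ
    unfold germ Profile.germStep
    rw [hδ]
    simp [not_lt.2 h.le]
    ring

theorem Profile.lt_germStep {T : ℝ} (P : Profile T) (hT : 0 < T) (g : ℝ ×ₗ ℝ) :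
    g < P.germStep g := by
  rw [Prod.Lex.lt_iff]
  left
  have := P.delay_pos hT (ofLex g).1
  simp [Profile.germStep]
  linarith

theorem Profile.one_add_slope_nonneg {T : ℝ} (P : Profile T) (hT : 0 < T)
    (hP : Monotone (fun t : ℝ => t + P.delay t)) (left : Bool) (t : ℝ) :
    0 ≤ 1 + P.slope left t := by
  have hpos : ∀ᶠ δ in 𝓝[>] (0 : ℝ), 0 < δ := eventually_mem_nhdsWithin
  cases left
  · obtain ⟨δ, h, hδ⟩ := ((P.delay_right hT t).and hpos).exists
    have := hP (show t ≤ t + δ by linarith)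
    simp only [h] at this
    nlinarith
  · obtain ⟨δ, h, hδ⟩ := ((P.delay_left hT t).and hpos).exists
    have := hP (show t - δ ≤ t by linarith)
    simp only [h] at this
    nlinarith

/-- The negated latest departure time for the negated arrival time `key`. -/
def Profile.back {T : ℝ} (P : Profile T) (key : ℝ) : ℝ :=
  ((stepBack P key).run 0).elim 0 (fun y => y.1)

/-- The equivalence says that, up to signs, `back` is the upper adjoint of the arc-arrival function,
which is the form that composes along paths. The segment found satisfies `a i ≤ τ < a (i + 1)`, so
arrival is strictly increasing on it even if it is constant elsewhere, and the preimage in this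
segment is the latest departure. -/
theorem stepBack_runs {T : ℝ} (P : Profile T) (hT : 0 < T)
    (hP : Monotone (fun t : ℝ => t + P.delay t)) (key : ℝ) :
    Runs (stepBack P key) (Nat.clog 2 P.pts.size + 2) (fun k => k = P.back key) ∧
      ∀ y, y ≤ -P.back key ↔ y + P.delay y ≤ -key := by
  have h2 := P.two_le_size hT
  obtain ⟨a, ha⟩ : ∃ a : ℕ → ℝ, ∀ i, a i = (P.pt i).1 + (P.pt i).2 := ⟨_, fun _ => rfl⟩
  -- Whole periods are removed until the arrival time lies in [a 0, a 0 + T), between the arrivals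
  -- of the first and the last breakpoint.
  obtain ⟨k, hk⟩ : ∃ k : ℤ, k = ⌊(-key - a 0) / T⌋ := ⟨_, rfl⟩
  obtain ⟨τ, hτ⟩ : ∃ τ : ℝ, τ = -key - k * T := ⟨_, rfl⟩
  have hτ₀ : a 0 ≤ τ := by
    have := Int.floor_le ((-key - a 0) / T)
    rw [← hk, le_div_iff₀ hT] at this
    linarith
  have hτ₁ : τ < a (P.pts.size - 1) := by
    have := Int.lt_floor_add_one ((-key - a 0) / T)
    rw [← hk, div_lt_iff₀ hT] at this
    rw [ha, P.pt_last hT]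
    rw [ha, P.pt_zero hT] at this
    simp only at this ⊢
    linarith
  have hb := bsearch_runs (fun i => decide (a i ≤ τ)) 0 (P.pts.size - 1) (by omega)
    (by simpa using hτ₀) (by simpa using hτ₁)
  obtain ⟨i, c, hr, hc, -, hi, hi₁, hi₂⟩ := hb
  simp only [decide_eq_true_eq, decide_eq_false_iff_not, not_le] at hi₁ hi₂
  have hc' : Nat.clog 2 (P.pts.size - 1 - 0) ≤ Nat.clog 2 P.pts.size :=
    Nat.clog_mono_right _ (by omega)
  have hret : Ret (stepBack P key)
      (-(k * T + ((P.pt i).1 + (τ - a i) / (a (i + 1) - a i) *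
        ((P.pt (i + 1)).1 - (P.pt i).1)))) (c + (1 + 0)) := by
    unfold stepBack
    simp only
    have e : (fun i => (P.pts.getD i (0, 0)).1 + (P.pts.getD i (0, 0)).2) = a := by
      funext i
      rw [ha]
      rfl
    simp only [← hτ, ← hk, congrFun e]
    exact hr.bind ((Ret.tick 1).bind (Ret.pure _))
  obtain ⟨x, hx⟩ : ∃ x, x = (P.pt i).1 + (τ - a i) / (a (i + 1) - a i) *
        ((P.pt (i + 1)).1 - (P.pt i).1) := ⟨_, rfl⟩
  rw [← hx] at hret
  have hback : P.back key = -(k * T + x) := by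
    unfold Profile.back
    rw [hret 0]
    rfl
  refine ⟨hret.runs (by omega) hback.symm, ?_⟩
  have hi' : i + 1 < P.pts.size := by omega
  have hlt := P.pt_lt (Nat.lt_succ_self i) hi'
  have hda : 0 < a (i + 1) - a i := by linarith
  have hdx : 0 < (P.pt (i + 1)).1 - (P.pt i).1 := by linarith
  have hx₀ : (P.pt i).1 ≤ x := by
    have : 0 ≤ (τ - a i) / (a (i + 1) - a i) := div_nonneg (by linarith) hda.le
    nlinarith
  have hx₁ : x < (P.pt (i + 1)).1 := by
    have : (τ - a i) / (a (i + 1) - a i) < 1 := (div_lt_one hda).2 (by linarith)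
    nlinarith
  have harr : ∀ y, (P.pt i).1 ≤ y - k * T → y - k * T ≤ (P.pt (i + 1)).1 →
      y + P.delay y = k * T + a i + (a (i + 1) - a i) / ((P.pt (i + 1)).1 - (P.pt i).1) *
        (y - k * T - (P.pt i).1) := by
    intro y h₁ h₂
    rw [P.delay_segment hT hi' h₁ h₂, ha, ha]
    unfold slope2
    field_simp
    ring
  have hX : k * T + x + P.delay (k * T + x) = -key := by
    rw [harr _ (by linarith) (by linarith)]
    have : (a (i + 1) - a i) / ((P.pt (i + 1)).1 - (P.pt i).1) *
        (k * T + x - k * T - (P.pt i).1) = τ - a i := by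
      rw [hx]
      field_simp
      ring
    rw [this]
    linarith
  intro y
  rw [hback, neg_neg]
  constructor
  · intro hy
    rw [← hX]
    exact hP hy
  · intro hy
    by_contra hlt'
    rw [not_le] at hlt'
    -- A later departure is clipped to the end of the segment, where the strictly increasing formula
    -- still applies.
    obtain ⟨z, hz⟩ : ∃ z, z = min y ((P.pt (i + 1)).1 + k * T) := ⟨_, rfl⟩
    have hzy : z ≤ y := hz ▸ min_le_left _ _
    have hzx : z ≤ (P.pt (i + 1)).1 + k * T := hz ▸ min_le_right _ _
    have hz₀ : k * T + x < z := by rw [hz]; exact lt_min hlt' (by linarith)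
    have h₁ : z + P.delay z ≤ -key := (hP hzy).trans hy
    rw [← hX, harr z (by linarith) (by linarith), harr (k * T + x) (by linarith)
      (by linarith)] at h₁
    have := mul_lt_mul_of_pos_left (show k * T + x - k * T - (P.pt i).1 < z - k * T - (P.pt i).1
      by linarith) (div_pos hda hdx)
    linarith

theorem Profile.lt_back {T : ℝ} (P : Profile T) (hT : 0 < T)
    (hP : Monotone (fun t : ℝ => t + P.delay t)) (key : ℝ) : key < P.back key := by
  have := ((stepBack_runs P hT hP key).2 (-P.back key)).1 le_rfl
  have := P.delay_pos hT (-P.back key)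
  linarith

/-! ## Earliest arrival times -/

/-- Strongly connected FIFO networks of out-degree at most two in which an arc is evaluated
within `m` steps. -/
structure Network.Regular (G : Network n) (m : ℕ) : Prop where
  strong : G.StronglyConnected
  fifo : G.FIFO
  degree : ∀ u, (G.out u).length ≤ 2
  arcCost : ∀ u, ∀ e ∈ G.out u, Nat.clog 2 e.2.pts.size + 2 ≤ m

namespace Network

variable {G : Network n} {m : ℕ}

theorem Regular.reach (hG : G.Regular m) (src : Fin n) (P : Fin n → Prop) (h₀ : P src)
    (hs : ∀ u, P u → ∀ e ∈ G.out u, P e.1) (v : Fin n) : P v := by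
  obtain ⟨p, hp⟩ := hG.strong src v
  induction p generalizing src with
  | nil => exact hp ▸ h₀
  | cons e p ih => exact ih e.1 (hs src h₀ e hp.1) hp.2

theorem Regular.arcs_le (hG : G.Regular m) : ∑ u, (G.out u).length ≤ 2 * n := by
  refine (Finset.sum_le_sum fun u _ => hG.degree u).trans ?_
  simp [mul_comm]

theorem Regular.arc_mono (hG : G.Regular m) {u : Fin n} {e : Fin n × Profile G.T}
    (he : e ∈ G.out u) {s t : ℝ} (h : s ≤ t) : s + e.2.delay s ≤ t + e.2.delay t :=
  hG.fifo u e he h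

/-- Keys that are consistent along all arcs, and attained along a tree. -/
structure Keys {κ : Type} [LinearOrder κ] (G : Network n) (f : Profile G.T → κ → κ) (src : Fin n)
    (key₀ : κ) (key : Fin n → κ) : Prop where
  source : key src = key₀
  relaxed : ∀ u, ∀ e ∈ G.out u, key e.1 ≤ f e.2 (key u)
  tree : ∀ P : Fin n → Prop, P src →
    (∀ u, P u → ∀ e ∈ G.out u, key e.1 = f e.2 (key u) → P e.1) → ∀ v, P v

theorem Regular.keys_runs {κ : Type} [LinearOrder κ] (hG : G.Regular m)
    {step : Profile G.T → κ → Prog κ} {f : Profile G.T → κ → κ}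
    (hc : Computes G.out step f m) (hf : ∀ u, ∀ e ∈ G.out u, ∀ k, k < f e.2 k) (src : Fin n)
    (key₀ : κ) :
    Runs (dijkstra G.out step (fun _ => false) src key₀) (dijkstraCost m (2 * n) (2 * n))
      (fun B => ∃ key : Fin n → κ, (∀ v, B.settled v = some (key v)) ∧
        G.Keys f src key₀ key) := by
  refine (dijkstra_full_runs hc hf src key₀ hG.arcs_le (hG.reach src)).mono le_rfl ?_
  rintro B ⟨key, h, h₁, h₂, h₃⟩
  exact ⟨key, h, h₁, h₂, h₃⟩

theorem Regular.computes_time (hG : G.Regular m) :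
    Computes G.out stepTime (fun P t => t + P.delay t) m := fun u e he k =>
  (stepTime_runs e.2 G.T_pos k).mono (hG.arcCost u e he) fun _ h => h

theorem Regular.computes_germ (hG : G.Regular m) :
    Computes G.out stepGerm (fun P g => P.germStep g) m := fun u e he k =>
  (stepGerm_runs e.2 G.T_pos k).mono (hG.arcCost u e he) fun _ h => h

theorem lt_arc {T : ℝ} (hT : 0 < T) (P : Profile T) (t : ℝ) : t < t + P.delay t := by
  linarith [P.delay_pos hT t]

theorem isPath_append {o w d : Fin n} {p q : List (Fin n × Profile G.T)} (hp : G.IsPath o p w)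
    (hq : G.IsPath w q d) : G.IsPath o (p ++ q) d := by
  induction p generalizing o with
  | nil => obtain rfl : o = w := hp; exact hq
  | cons e p ih => exact ⟨hp.1, ih hp.2⟩

theorem pathArr_append (p q : List (Fin n × Profile G.T)) (t : ℝ) :
    G.pathArr (p ++ q) t = G.pathArr q (G.pathArr p t) := by
  induction p generalizing t with
  | nil => rfl
  | cons e p ih => exact ih _

theorem le_pathArr (p : List (Fin n × Profile G.T)) (t : ℝ) : t ≤ G.pathArr p t := by
  induction p generalizing t with
  | nil => exact le_rfl
  | cons e p ih => exact (lt_arc G.T_pos e.2 t).le.trans (ih _)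

theorem Regular.pathArr_mono (hG : G.Regular m) {o d : Fin n}
    {p : List (Fin n × Profile G.T)} (hp : G.IsPath o p d) {s t : ℝ} (h : s ≤ t) :
    G.pathArr p s ≤ G.pathArr p t := by
  induction p generalizing o s t with
  | nil => exact h
  | cons e p ih => exact ih hp.2 (hG.arc_mono hp.1 h)

theorem arr_le {o d : Fin n} {p : List (Fin n × Profile G.T)}
    (hp : G.IsPath o p d) (t : ℝ) : G.arr o d t ≤ G.pathArr p t := by
  refine csInf_le ⟨t, ?_⟩ ⟨p, hp, rfl⟩
  rintro s ⟨q, -, rfl⟩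
  exact le_pathArr q t

/-- Consistent keys are earliest arrival times. -/
theorem Regular.arr_eq_key (hG : G.Regular m) {o : Fin n} {t : ℝ} {key : Fin n → ℝ}
    (h₀ : key o = t) (hr : ∀ u, ∀ e ∈ G.out u, key e.1 ≤ key u + e.2.delay (key u))
    (ht : ∀ P : Fin n → Prop, P o →
      (∀ u, P u → ∀ e ∈ G.out u, key e.1 = key u + e.2.delay (key u) → P e.1) → ∀ v, P v)
    (d : Fin n) :
    G.arr o d t = key d ∧ ∃ p, G.IsPath o p d ∧ G.pathArr p t = key d := by
  have hle : ∀ (p : List (Fin n × Profile G.T)) (u : Fin n) (s : ℝ), G.IsPath u p d →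
      key u ≤ s → key d ≤ G.pathArr p s := by
    intro p
    induction p with
    | nil =>
      intro u s hp hs
      obtain rfl : u = d := hp
      exact hs
    | cons e p ih =>
      intro u s hp hs
      exact ih e.1 _ hp.2 ((hr u e hp.1).trans (hG.arc_mono hp.1 hs))
  have hex : ∃ p, G.IsPath o p d ∧ G.pathArr p t = key d := by
    refine ht (fun v => ∃ p, G.IsPath o p v ∧ G.pathArr p t = key v) ⟨[], rfl, h₀.symm⟩ ?_ d
    rintro u ⟨p, hp, hpt⟩ e he hk
    refine ⟨p ++ [e], isPath_append hp ⟨he, rfl⟩, ?_⟩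
    rw [pathArr_append, hpt, hk]
    rfl
  refine ⟨?_, hex⟩
  obtain ⟨p, hp, hpt⟩ := hex
  refine le_antisymm (hpt ▸ arr_le hp t) (le_csInf ⟨_, p, hp, rfl⟩ ?_)
  rintro s ⟨q, hq, rfl⟩
  exact hle q o t hq h₀.le

/-- The infimum ranges over infinitely many paths; it is attained because the tree of a run of
Dijkstra's algorithm supplies a path. -/
theorem Regular.exists_path (hG : G.Regular m) (o d : Fin n) (t : ℝ) :
    ∃ p, G.IsPath o p d ∧ G.pathArr p t = G.arr o d t := by
  obtain ⟨B, -, -, -, key, -, h⟩ :=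
    hG.keys_runs hG.computes_time (fun _ e _ k => lt_arc G.T_pos e.2 k) o t
  obtain ⟨h₁, h₂⟩ := hG.arr_eq_key h.source h.relaxed h.tree d
  rwa [h₁]

theorem Regular.le_arr (hG : G.Regular m) (o d : Fin n) (t : ℝ) : t ≤ G.arr o d t := by
  obtain ⟨p, -, hp⟩ := hG.exists_path o d t
  exact hp ▸ le_pathArr p t

theorem Regular.arr_self (hG : G.Regular m) (o : Fin n) (t : ℝ) : G.arr o o t = t :=
  le_antisymm (arr_le (p := []) rfl t) (hG.le_arr o o t)

theorem Regular.arr_mono (hG : G.Regular m) (o d : Fin n) {s t : ℝ} (h : s ≤ t) :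
    G.arr o d s ≤ G.arr o d t := by
  obtain ⟨p, hp, hpt⟩ := hG.exists_path o d t
  exact hpt ▸ (arr_le hp s).trans (hG.pathArr_mono hp h)

theorem Regular.arr_triangle (hG : G.Regular m) (o w d : Fin n) (t : ℝ) :
    G.arr o d t ≤ G.arr w d (G.arr o w t) := by
  obtain ⟨p, hp, hpt⟩ := hG.exists_path o w t
  obtain ⟨q, hq, hqt⟩ := hG.exists_path w d (G.arr o w t)
  rw [← hqt, ← hpt, ← pathArr_append]
  exact arr_le (isPath_append hp hq) t

theorem Regular.arr_arc (hG : G.Regular m) (o : Fin n) {u : Fin n} {e : Fin n × Profile G.T}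
    (he : e ∈ G.out u) (t : ℝ) : G.arr o e.1 t ≤ G.arr o u t + e.2.delay (G.arr o u t) :=
  (hG.arr_triangle o u e.1 t).trans (arr_le (p := [e]) ⟨he, rfl⟩ _)

theorem Regular.arr_cons (hG : G.Regular m) {o : Fin n} (d : Fin n) {e : Fin n × Profile G.T}
    (he : e ∈ G.out o) (t : ℝ) : G.arr o d t ≤ G.arr e.1 d (t + e.2.delay t) :=
  (hG.arr_triangle o e.1 d t).trans
    (hG.arr_mono _ _ (arr_le (p := [e]) ⟨he, rfl⟩ _))

theorem pathArr_add_period (p : List (Fin n × Profile G.T)) (t : ℝ) (k : ℤ) :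
    G.pathArr p (t + k * G.T) = G.pathArr p t + k * G.T := by
  induction p generalizing t with
  | nil => rfl
  | cons e p ih =>
    change G.pathArr p (t + k * G.T + e.2.delay (t + k * G.T)) = G.pathArr p _ + _
    rw [e.2.delay_periodic G.T_pos, ← ih]
    congr 1
    ring

theorem Regular.arr_add_period (hG : G.Regular m) (o d : Fin n) (t : ℝ) (k : ℤ) :
    G.arr o d (t + k * G.T) = G.arr o d t + k * G.T := by
  apply le_antisymm
  · obtain ⟨p, hp, hpt⟩ := hG.exists_path o d t
    rw [← hpt, ← pathArr_add_period]
    exact arr_le hp _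
  · obtain ⟨p, hp, hpt⟩ := hG.exists_path o d (t + k * G.T)
    rw [← hpt, pathArr_add_period]
    linarith [arr_le hp t]

theorem Regular.dist_add_period (hG : G.Regular m) (o d : Fin n) (t : ℝ) (k : ℤ) :
    G.dist o d (t + k * G.T) = G.dist o d t := by
  unfold dist
  rw [hG.arr_add_period]
  ring

theorem Regular.dist_nonneg (hG : G.Regular m) (o d : Fin n) (t : ℝ) : 0 ≤ G.dist o d t :=
  sub_nonneg.2 (hG.le_arr o d t)

theorem Regular.dist_self (hG : G.Regular m) (o : Fin n) (t : ℝ) : G.dist o o t = 0 := by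
  unfold dist
  rw [hG.arr_self, sub_self]

/-- Travel times between different vertices are at least the smallest delay. -/
theorem Regular.le_dist (hG : G.Regular m) {δ : ℝ}
    (hδ : ∀ u, ∀ e ∈ G.out u, ∀ t : ℝ, δ ≤ e.2.delay t) {o d : Fin n} (h : o ≠ d) (t : ℝ) :
    δ ≤ G.dist o d t := by
  obtain ⟨p, hp, hpt⟩ := hG.exists_path o d t
  unfold dist
  rw [← hpt]
  cases p with
  | nil => exact absurd hp h
  | cons e p =>
    have := hδ o e hp.1 t
    have h' : t + e.2.delay t ≤ G.pathArr (e :: p) t := le_pathArr p _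
    linarith

/-! ### Bounded slopes -/

section Slopes

variable {lmin lmax : ℝ}

theorem BoundedSlopes.dist_sub (h : G.BoundedSlopes lmin lmax) (o d : Fin n) {s t : ℝ}
    (hst : s ≤ t) : -lmin * (t - s) ≤ G.dist o d t - G.dist o d s ∧
      G.dist o d t - G.dist o d s ≤ lmax * (t - s) := by
  rcases hst.lt_or_eq with hlt | rfl
  · have hpos : 0 < t - s := sub_pos.2 hlt
    have h' := h o d s t hlt
    have e : (G.dist o d s - G.dist o d t) / (s - t) =
        (G.dist o d t - G.dist o d s) / (t - s) := by
      rw [← neg_sub t s, ← neg_sub (G.dist o d t), neg_div_neg_eq]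
    rw [e, Set.mem_Icc, le_div_iff₀ hpos, div_le_iff₀ hpos] at h'
    exact h'
  · simp

theorem BoundedSlopes.arr_strictMono (h : G.BoundedSlopes lmin lmax) (hmin : lmin < 1)
    (o d : Fin n) : StrictMono (G.arr o d) := by
  intro s t hst
  have := (h.dist_sub o d hst.le).1
  unfold dist at this
  nlinarith

theorem BoundedSlopes.dist_continuous (h : G.BoundedSlopes lmin lmax) (hmin : 0 ≤ lmin)
    (hmax : 0 ≤ lmax) (o d : Fin n) : Continuous (G.dist o d) := by
  have : LipschitzWith (Real.toNNReal (lmin + lmax)) (G.dist o d) := by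
    apply LipschitzWith.of_dist_le_mul
    intro x y
    rw [Real.coe_toNNReal _ (by linarith), Real.dist_eq, Real.dist_eq]
    rcases le_total x y with hxy | hxy
    · have := h.dist_sub o d hxy
      rw [abs_sub_comm x y, abs_of_nonneg (sub_nonneg.2 hxy), abs_le]
      constructor <;> nlinarith [this.1, this.2]
    · have := h.dist_sub o d hxy
      rw [abs_of_nonneg (sub_nonneg.2 hxy), abs_le]
      constructor <;> nlinarith [this.1, this.2]
  exact this.continuous

theorem BoundedOpposite.dist_le (hG : G.Regular m) {ζ : ℝ} (h : G.BoundedOpposite ζ)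
    (o d : Fin n) (t : ℝ) : G.dist o d t ≤ ζ * G.dist d o t := by
  have := h o d _ (mul_fract_mem G.T_pos t)
  rw [mul_fract_eq G.T_pos] at this
  have e : t - ⌊t / G.T⌋ * G.T = t + (-⌊t / G.T⌋ : ℤ) * G.T := by push_cast; ring
  rwa [e, hG.dist_add_period, hG.dist_add_period] at this

end Slopes

/-! ### One-sided slopes -/

/-- Consistent germs describe the earliest arrival times on one side of `t`. -/
theorem Regular.arr_germ (hG : G.Regular m) {ℓ : Fin n} {t σ : ℝ} {g : Fin n → ℝ ×ₗ ℝ}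
    (hg : G.Keys (fun P g => P.germStep g) ℓ (toLex (t, σ)) g) (v : Fin n) :
    G.arr ℓ v t = (ofLex (g v)).1 ∧
      ∀ᶠ δ in 𝓝[>] (0 : ℝ), G.arr ℓ v (t + σ * δ) = germ (g v) δ := by
  have hsrc := hg.source
  refine ⟨(hG.arr_eq_key (key := fun v => (ofLex (g v)).1) ?_ ?_ ?_ v).1, ?_⟩
  · simp [hsrc]
  · intro u e he
    rcases Prod.Lex.le_iff.1 (hg.relaxed u e he) with h | h
    · exact h.le
    · exact h.1.le
  · intro P h₀ hs
    refine hg.tree P h₀ fun u hu e he hk => hs u hu e he ?_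
    simp only [hk]
    rfl
  · have hup : ∀ᶠ δ in 𝓝[>] (0 : ℝ), G.arr ℓ v (t + σ * δ) ≤ germ (g v) δ := by
      refine hg.tree (fun v => ∀ᶠ δ in 𝓝[>] (0 : ℝ), G.arr ℓ v (t + σ * δ) ≤ germ (g v) δ)
        ?_ ?_ v
      · filter_upwards with δ
        rw [hG.arr_self, hsrc]
        exact le_rfl
      · intro u hu e he hk
        filter_upwards [hu, e.2.germ_germStep G.T_pos (g u)] with δ h₁ h₂
        rw [hk, ← h₂]
        exact (hG.arr_arc ℓ he _).trans (hG.arc_mono he h₁)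
    -- Finitely many arcs share one neighbourhood of 0. At a fixed `δ` in it, the bound then extends
    -- to paths of any length.
    have hlow : ∀ᶠ δ in 𝓝[>] (0 : ℝ), ∀ u, ∀ e ∈ G.out u,
        germ (g e.1) δ ≤ germ (g u) δ + e.2.delay (germ (g u) δ) := by
      rw [eventually_all]
      intro u
      have := (eventually_all_finite (List.finite_toSet (G.out u)) (l := 𝓝[>] (0 : ℝ))
        (p := fun e δ => germ (g e.1) δ ≤ germ (g u) δ + e.2.delay (germ (g u) δ))).2
      refine this fun e he => ?_
      filter_upwards [(germ_le_iff _ _).1 (hg.relaxed u e he),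
        e.2.germ_germStep G.T_pos (g u)] with δ h₁ h₂
      rw [h₂]
      exact h₁
    filter_upwards [hup, hlow] with δ h₁ h₂
    refine le_antisymm h₁ ?_
    obtain ⟨p, hp, hpt⟩ := hG.exists_path ℓ v (t + σ * δ)
    rw [← hpt]
    have hle : ∀ (p : List (Fin n × Profile G.T)) (u : Fin n) (s : ℝ), G.IsPath u p v →
        germ (g u) δ ≤ s → germ (g v) δ ≤ G.pathArr p s := by
      intro p
      induction p with
      | nil =>
        intro u s hp hs
        obtain rfl : u = v := hp
        exact hs
      | cons e p ih =>
        intro u s hp hs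
        exact ih e.1 _ hp.2 ((h₂ u e hp.1).trans (hG.arc_mono hp.1 hs))
    refine hle p ℓ _ hp ?_
    rw [hsrc]
    exact le_rfl

end Network

/-- `p` is a sample of the function `D` at time `t`. -/
structure IsSample (D : ℝ → ℝ) (t : ℝ) (p : Sample) : Prop where
  time : p.time = t
  val : p.val = D t
  right : ∀ᶠ δ in 𝓝[>] (0 : ℝ), D (t + δ) = D t + p.right * δ
  left : ∀ᶠ δ in 𝓝[>] (0 : ℝ), D (t - δ) = D t - p.left * δ

namespace Network

variable {G : Network n} {m : ℕ}

theorem Regular.isSample_of_keys (hG : G.Regular m) {ℓ : Fin n} {t : ℝ} {gR gL : Fin n → ℝ ×ₗ ℝ}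
    (hR : G.Keys (fun P g => P.germStep g) ℓ (toLex (t, 1)) gR)
    (hL : G.Keys (fun P g => P.germStep g) ℓ (toLex (t, -1)) gL) (v : Fin n) :
    IsSample (G.dist ℓ v) t
      { time := t, val := (ofLex (gR v)).1 - t, left := -(ofLex (gL v)).2 - 1,
        right := (ofLex (gR v)).2 - 1 } := by
  obtain ⟨hR₁, hR₂⟩ := hG.arr_germ hR v
  obtain ⟨hL₁, hL₂⟩ := hG.arr_germ hL v
  refine ⟨rfl, ?_, ?_, ?_⟩
  · simp only [dist, hR₁]
  · filter_upwards [hR₂] with δ hδ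
    rw [one_mul] at hδ
    simp only [dist, hδ, hR₁, germ]
    ring
  · filter_upwards [hL₂] with δ hδ
    rw [neg_one_mul, ← sub_eq_add_neg] at hδ
    simp only [dist, hδ, hL₁, germ]
    ring

/-- The cost of a probe. -/
def probeCost (n m : ℕ) : ℕ := 2 * dijkstraCost m (2 * n) (2 * n) + n

theorem Regular.probe_runs (hG : G.Regular m) (ℓ : Fin n) (t : ℝ) :
    Runs (probe G ℓ t) (probeCost n m) (fun s => ∀ v, IsSample (G.dist ℓ v) t (s v)) := by
  unfold probe
  have hf : ∀ u, ∀ e ∈ G.out u, ∀ k : ℝ ×ₗ ℝ, k < e.2.germStep k :=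
    fun _ e _ k => e.2.lt_germStep G.T_pos k
  refine ((hG.keys_runs hG.computes_germ hf ℓ (toLex (t, 1))).bind fun R hR =>
    (hG.keys_runs hG.computes_germ hf ℓ (toLex (t, -1))).bind (b' := n + 0) fun L hL =>
      Runs.tick ?_).mono (by unfold probeCost; omega) fun _ h => h
  refine Runs.pure ?_ 0
  obtain ⟨gR, hRs, hR⟩ := hR
  obtain ⟨gL, hLs, hL⟩ := hL
  intro v
  simp only [hRs, hLs, Option.getD_some]
  exact hG.isSample_of_keys hR hL v

/-- At a time that does not reach any concavity-spoiling breakpoint, slopes do not increase. -/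
theorem Regular.exists_concave_sample (hG : G.Regular m) (ℓ : Fin n) (t : ℝ)
    (ht : ∀ u, ∀ e ∈ G.out u, G.T * Int.fract (G.arr ℓ u t / G.T) ∉ e.2.spoilTimes)
    (v : Fin n) : ∃ p, IsSample (G.dist ℓ v) t p ∧ p.right ≤ p.left := by
  have hf : ∀ u, ∀ e ∈ G.out u, ∀ k : ℝ ×ₗ ℝ, k < e.2.germStep k :=
    fun _ e _ k => e.2.lt_germStep G.T_pos k
  obtain ⟨-, -, -, -, gR, -, hR⟩ := hG.keys_runs hG.computes_germ hf ℓ (toLex (t, 1))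
  obtain ⟨-, -, -, -, gL, -, hL⟩ := hG.keys_runs hG.computes_germ hf ℓ (toLex (t, -1))
  refine ⟨_, hG.isSample_of_keys hR hL v, ?_⟩
  have hsl : ∀ u, ∀ e ∈ G.out u, ∀ left s, 0 ≤ 1 + e.2.slope left s := fun u e he left s =>
    e.2.one_add_slope_nonneg G.T_pos (fun _ _ h => hG.arc_mono he h) left s
  have hR₀ : ∀ v, 0 ≤ (ofLex (gR v)).2 := by
    refine hR.tree _ ?_ ?_
    · rw [hR.source]
      exact zero_le_one
    · intro u hu e he hk
      rw [hk]
      exact mul_nonneg hu (hsl u e he _ _)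
  -- The one-sided slopes of the arrival times are compared along the tree of the left germs. On its
  -- arcs the left slope is multiplied exactly, while relaxation over the same arc bounds the right
  -- slope from above. FIFO keeps all factors nonnegative.
  have key : ∀ v, (ofLex (gR v)).2 ≤ -(ofLex (gL v)).2 := by
    refine hL.tree _ ?_ ?_
    · rw [hR.source, hL.source]
      simp
    · intro u hu e he hk
      have hxu : (ofLex (gR u)).1 = (ofLex (gL u)).1 :=
        (hG.arr_germ hR u).1.symm.trans (hG.arr_germ hL u).1
      have hxv : (ofLex (gR e.1)).1 = (ofLex (gL e.1)).1 :=
        (hG.arr_germ hR e.1).1.symm.trans (hG.arr_germ hL e.1).1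
      have hlv : (ofLex (gL e.1)).1 = (ofLex (gL u)).1 + e.2.delay (ofLex (gL u)).1 := by
        rw [hk]; rfl
      have hlv₂ : (ofLex (gL e.1)).2 = (ofLex (gL u)).2 *
          (1 + e.2.slope (decide ((ofLex (gL u)).2 < 0)) (ofLex (gL u)).1) := by
        rw [hk]; rfl
      have hle : (ofLex (gR e.1)).2 ≤ (ofLex (gR u)).2 *
          (1 + e.2.slope false (ofLex (gR u)).1) := by
        have hdec : decide ((ofLex (gR u)).2 < 0) = false := by simpa using hR₀ u
        rcases Prod.Lex.le_iff.1 (hR.relaxed u e he) with h | h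
        · simp only [Profile.germStep, ofLex_toLex, hxv, hlv, hxu] at h
          exact absurd h (lt_irrefl _)
        · have := h.2
          simp only [Profile.germStep, ofLex_toLex, hdec] at this
          exact this
      have hslope : e.2.slope false (ofLex (gR u)).1 ≤ e.2.slope true (ofLex (gL u)).1 := by
        rw [hxu]
        apply e.2.slope_le_of_not_spoiling G.T_pos
        rw [← (hG.arr_germ hL u).1]
        exact ht u e he
      rw [hlv₂]
      have h₁ : (ofLex (gR u)).2 * (1 + e.2.slope false (ofLex (gR u)).1) ≤
          -(ofLex (gL u)).2 * (1 + e.2.slope false (ofLex (gR u)).1) :=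
        mul_le_mul_of_nonneg_right hu (hsl u e he _ _)
      have h₀ : 0 ≤ -(ofLex (gL u)).2 := (hR₀ u).trans hu
      rcases h₀.lt_or_eq with h | h
      · have hdec : decide ((ofLex (gL u)).2 < 0) = true := by simpa using neg_pos.1 h
        rw [hdec]
        have := mul_le_mul_of_nonneg_left (add_le_add_right hslope 1) h₀
        linarith
      -- Here `germStep` looks up the slope on the other side, which is harmless because it is
      -- multiplied by 0.
      · have : (ofLex (gL u)).2 = 0 := by linarith
        rw [this] at h₁ ⊢
        simp only [neg_zero, zero_mul] at h₁ ⊢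
        linarith
  have := key v
  simp only
  linarith

end Network

/-! ## Concave functions and their samples -/

/-- `D` is nowhere below its chords on `[a, b]`. -/
def ConcaveBetween (D : ℝ → ℝ) (a b : ℝ) : Prop :=
  ∀ x y t, a ≤ x → x ≤ t → t ≤ y → y ≤ b → D x * (y - t) + D y * (t - x) ≤ D t * (y - x)

theorem ConcaveBetween.mono {D : ℝ → ℝ} {a b a' b' : ℝ} (h : ConcaveBetween D a b)
    (ha : a ≤ a') (hb : b' ≤ b) : ConcaveBetween D a' b' :=
  fun x y t h₁ h₂ h₃ h₄ => h x y t (ha.trans h₁) h₂ h₃ (h₄.trans hb)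

/-- A continuous function whose slope never increases is concave. -/
theorem concaveBetween_of_samples {D : ℝ → ℝ} (hD : Continuous D) {a b : ℝ}
    (h : ∀ t, a < t → t < b → ∃ p, IsSample D t p ∧ p.right ≤ p.left) :
    ConcaveBetween D a b := by
  intro x y t hax hxt hty hyb
  rcases (hxt.trans hty).lt_or_eq with hxy | hxy
  swap
  · subst hxy
    obtain rfl := le_antisymm hxt hty
    simp
  by_contra hlt
  rw [not_le] at hlt
  have hpos : 0 < y - x := sub_pos.2 hxy
  obtain ⟨c, hc⟩ : ∃ c, c = (D y - D x) / (y - x) := ⟨_, rfl⟩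
  have hcy : D y - D x = c * (y - x) := by rw [hc]; field_simp
  -- After subtraction of the slope of the chord, a dip below the chord becomes an interior minimum.
  -- At the leftmost minimiser the left slope is negative and the right slope is not, so the slope
  -- increases there.
  obtain ⟨f, hf⟩ : ∃ f : ℝ → ℝ, ∀ s, f s = D s - c * (s - x) := ⟨_, fun _ => rfl⟩
  have hfc : Continuous f := by
    have : f = fun s => D s - c * (s - x) := funext hf
    rw [this]
    fun_prop
  obtain ⟨s₁, hs₁, hmin⟩ := isCompact_Icc.exists_isMinOn (Set.nonempty_Icc.2 hxy.le)
    hfc.continuousOn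
  have hK : IsCompact (Set.Icc x y ∩ f ⁻¹' {f s₁}) :=
    isCompact_Icc.inter_right (isClosed_singleton.preimage hfc)
  obtain ⟨s, ⟨hs, hfs⟩, hleast⟩ := hK.exists_isLeast ⟨s₁, hs₁, rfl⟩
  replace hfs : f s = f s₁ := hfs
  have hft : f t < f x := by
    rw [hf, hf]
    have : D t * (y - x) < (D x + c * (t - x)) * (y - x) := by
      have : D y = D x + c * (y - x) := by linarith
      rw [this] at hlt
      nlinarith
    have := lt_of_mul_lt_mul_right this hpos.le
    linarith
  have hfy : f y = f x := by rw [hf, hf]; linarith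
  have hst : f s ≤ f t := hfs ▸ hmin ⟨hxt, hty⟩
  have hxs : x < s := lt_of_le_of_ne hs.1 (by rintro rfl; linarith)
  have hsy : s < y := lt_of_le_of_ne hs.2 (by rintro rfl; linarith)
  obtain ⟨p, hp, hle⟩ := h s (by linarith) (by linarith)
  obtain ⟨δ, ⟨h₁, h₂⟩, h₃⟩ := ((hp.right.and hp.left).and
    (Ioo_mem_nhdsGT (show 0 < min (s - x) (y - s) from
      lt_min (by linarith) (by linarith)))).exists
  have hδx : δ < s - x := h₃.2.trans_le (min_le_left _ _)
  have hδy : δ < y - s := h₃.2.trans_le (min_le_right _ _)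
  have hr : f s ≤ f (s + δ) := by
    rw [hfs]
    exact hmin ⟨by linarith [h₃.1], by linarith⟩
  have hl : f s < f (s - δ) := by
    have hm : s - δ ∈ Set.Icc x y := ⟨by linarith, by linarith [h₃.1]⟩
    refine lt_of_le_of_ne (hfs ▸ hmin hm) fun heq => ?_
    have := hleast ⟨hm, show f (s - δ) = f s₁ by rw [← heq, hfs]⟩
    linarith [h₃.1]
  rw [hf, hf, h₁] at hr
  rw [hf, hf, h₂] at hl
  have h₄ : 0 ≤ (p.right - c) * δ := by linarith
  have h₅ : 0 < (c - p.left) * δ := by linarith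
  have h₆ := pos_of_mul_pos_left h₅ h₃.1.le
  have h₇ := nonneg_of_mul_nonneg_left h₄ h₃.1
  linarith

/-! ### Tangents and chords of concave functions. -/

section Tangents

variable {D : ℝ → ℝ} {a b x y : ℝ} {p q : Sample}

/-- Close to `x` on the right, `D` coincides with its tangent. Comparing with a chord that ends or
passes at `x + δ` bounds `D` on both sides of `x`. -/
theorem ConcaveBetween.le_right (h : ConcaveBetween D a b) (hp : IsSample D x p) (hax : a ≤ x)
    (hxb : x < b) {t : ℝ} (hat : a ≤ t) (htb : t ≤ b) : D t ≤ D x + p.right * (t - x) := by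
  rcases lt_trichotomy t x with htx | rfl | htx
  · obtain ⟨δ, h₁, h₂⟩ := (hp.right.and (Ioo_mem_nhdsGT (sub_pos.2 hxb))).exists
    have := h t (x + δ) x hat htx.le (by linarith [h₂.1]) (by linarith [h₂.2])
    rw [h₁] at this
    have h₃ : D t * δ ≤ (D x + p.right * (t - x)) * δ := by linarith
    exact le_of_mul_le_mul_right h₃ h₂.1
  · simp
  · obtain ⟨δ, h₁, h₂⟩ := (hp.right.and (Ioo_mem_nhdsGT (sub_pos.2 htx))).exists
    have := h x t (x + δ) hax (by linarith [h₂.1]) (by linarith [h₂.2]) htb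
    rw [h₁] at this
    have h₃ : D t * δ ≤ (D x + p.right * (t - x)) * δ := by linarith
    exact le_of_mul_le_mul_right h₃ h₂.1

theorem ConcaveBetween.le_left (h : ConcaveBetween D a b) (hq : IsSample D y q) (hay : a < y)
    (hyb : y ≤ b) {t : ℝ} (hat : a ≤ t) (htb : t ≤ b) : D t ≤ D y + q.left * (t - y) := by
  rcases lt_trichotomy t y with hty | rfl | hty
  · obtain ⟨δ, h₁, h₂⟩ := (hq.left.and (Ioo_mem_nhdsGT (sub_pos.2 hty))).exists
    have := h t y (y - δ) hat (by linarith [h₂.2]) (by linarith [h₂.1]) hyb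
    rw [h₁] at this
    have h₃ : D t * δ ≤ (D y + q.left * (t - y)) * δ := by linarith
    exact le_of_mul_le_mul_right h₃ h₂.1
  · simp
  · obtain ⟨δ, h₁, h₂⟩ := (hq.left.and (Ioo_mem_nhdsGT (sub_pos.2 hay))).exists
    have := h (y - δ) t y (by linarith [h₂.2]) (by linarith [h₂.1]) hty.le htb
    rw [h₁] at this
    have h₃ : D t * δ ≤ (D y + q.left * (t - y)) * δ := by linarith
    exact le_of_mul_le_mul_right h₃ h₂.1

theorem ConcaveBetween.left_le_right (h : ConcaveBetween D a b) (hp : IsSample D x p)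
    (hq : IsSample D y q) (hax : a ≤ x) (hxy : x < y) (hyb : y ≤ b) : q.left ≤ p.right := by
  have h₁ := h.le_right hp hax (hxy.trans_le hyb) (hax.trans hxy.le) hyb
  have h₂ := h.le_left hq (hax.trans_lt hxy) hyb hax (hxy.le.trans hyb)
  have h₃ : 0 ≤ (p.right - q.left) * (y - x) := by linarith
  have := nonneg_of_mul_nonneg_left h₃ (sub_pos.2 hxy)
  linarith

/-- The product of the two parts into which the kink divides the interval is at most a quarter of
the squared length. -/
theorem mae_le (hpq : q.left ≤ p.right) (hlt : p.time < q.time) :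
    mae p q ≤ (p.right - q.left) * (q.time - p.time) / 4 := by
  unfold mae
  have h₁ : (kink p q - p.time) * (q.time - kink p q) / (q.time - p.time) ≤
      (q.time - p.time) / 4 := by
    rw [div_le_iff₀ (sub_pos.2 hlt)]
    nlinarith [sq_nonneg ((kink p q - p.time) - (q.time - kink p q))]
  have := mul_le_mul_of_nonneg_left h₁ (sub_nonneg.2 hpq)
  linarith

/-- Short intervals in the middle of a concave piece are not bisected. -/
theorem ConcaveBetween.mae_le_of_far (h : ConcaveBetween D a b) (h₀ : ∀ t, 0 ≤ D t) {ε M : ℝ}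
    (hε : 0 < ε) (hM : 1 ≤ M) (hεM : 1 ≤ ε * M) (hp : IsSample D x p) (hq : IsSample D y q)
    (hax : a ≤ x) (hxy : x < y) (hyb : y ≤ b) (h₁ : M * (y - x) ≤ x - a)
    (h₂ : M * (y - x) ≤ b - y) : mae p q ≤ ε * min p.val q.val := by
  have hle := h.left_le_right hp hq hax hxy hyb
  have hm := mae_le hle (by rw [hp.time, hq.time]; exact hxy)
  rw [hp.time, hq.time] at hm
  -- The tangents, extended to the far ends `a` and `b`, stay above `D ≥ 0`. This limits the rise to
  -- the right at `x` by `D x / (x - a)` and the rise to the left at `y` by `D y / (b - y)`.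
  have ha := h.le_right hp hax (hxy.trans_le hyb) le_rfl (by linarith)
  have hb := h.le_left hq (hax.trans_lt hxy) hyb (by linarith) le_rfl
  have hy := h.le_right hp hax (hxy.trans_le hyb) (by linarith) hyb
  have hx := h.le_left hq (hax.trans_lt hxy) hyb hax (by linarith)
  have hda := h₀ a
  have hdb := h₀ b
  have hdx := h₀ x
  have hdy := h₀ y
  have hd : 0 < y - x := sub_pos.2 hxy
  rw [hp.val, hq.val]
  obtain ⟨u, hu⟩ : ∃ u, u = p.right * (y - x) := ⟨_, rfl⟩
  obtain ⟨w, hw⟩ : ∃ w, w = -q.left * (y - x) := ⟨_, rfl⟩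
  have hu₁ : M * u ≤ D x := by
    rcases le_total p.right 0 with hr | hr
    · have : u ≤ 0 := by rw [hu]; exact mul_nonpos_of_nonpos_of_nonneg hr hd.le
      nlinarith
    · have := mul_le_mul_of_nonneg_left h₁ hr
      rw [hu]
      linarith
  have hw₁ : M * w ≤ D y := by
    rcases le_total (-q.left) 0 with hr | hr
    · have : w ≤ 0 := by rw [hw]; exact mul_nonpos_of_nonpos_of_nonneg hr hd.le
      nlinarith
    · have := mul_le_mul_of_nonneg_left h₂ hr
      rw [hw]
      linarith
  -- Since `M ≥ 1`, the two end values are within a factor 2, so each of them controls the error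
  -- alone.
  have hyx : D y ≤ 2 * D x := by
    have : u ≤ D x := by
      rcases le_total u 0 with h' | h'
      · linarith
      · nlinarith
    linarith
  have hxy' : D x ≤ 2 * D y := by
    have : w ≤ D y := by
      rcases le_total w 0 with h' | h'
      · linarith
      · nlinarith
    linarith
  have huw : mae p q ≤ (u + w) / 4 := by rw [hu, hw]; linarith
  have hMm : M * mae p q ≤ min (D x) (D y) := by
    refine le_min ?_ ?_
    · nlinarith
    · nlinarith
  have hmin : 0 ≤ min (D x) (D y) := le_min hdx hdy
  rcases le_total (mae p q) 0 with h' | h'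
  · exact h'.trans (mul_nonneg hε.le hmin)
  · have := mul_le_mul_of_nonneg_left hMm hε.le
    nlinarith

/-- Very short intervals are not bisected. -/
theorem ConcaveBetween.mae_le_of_short (h : ConcaveBetween D a b) {ε δ lmin lmax : ℝ}
    (hl : ∀ s t, s ≤ t → -lmin * (t - s) ≤ D t - D s ∧ D t - D s ≤ lmax * (t - s))
    (hp : IsSample D x p) (hq : IsSample D y q) (hax : a ≤ x) (hxy : x < y) (hyb : y ≤ b)
    (hε : 0 < ε) (hδ : (∀ t, D t = 0) ∨ ∀ t, δ ≤ D t)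
    (hs : (lmax + lmin) * (y - x) ≤ 4 * ε * δ) : mae p q ≤ ε * min p.val q.val := by
  have hle := h.left_le_right hp hq hax hxy hyb
  have hm := mae_le hle (by rw [hp.time, hq.time]; exact hxy)
  rw [hp.time, hq.time] at hm
  rw [hp.val, hq.val]
  have hpos : ∀ᶠ δ in 𝓝[>] (0 : ℝ), 0 < δ := eventually_mem_nhdsWithin
  obtain ⟨η, h₁, hη⟩ := (hp.right.and hpos).exists
  obtain ⟨θ, h₂, hθ⟩ := (hq.left.and hpos).exists
  rcases hδ with hδ | hδ
  -- The zero function occurs as the travel time from the landmark to itself; both of its tangents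
  -- have slope 0.
  · rw [hδ, hδ, zero_add] at h₁
    rw [hδ, hδ, zero_sub] at h₂
    have h₃ : p.right = 0 := by
      rcases mul_eq_zero.1 h₁.symm with h' | h'
      · exact h'
      · exact absurd h' hη.ne'
    have h₄ : q.left = 0 := by
      rcases mul_eq_zero.1 (neg_eq_zero.1 h₂.symm) with h' | h'
      · exact h'
      · exact absurd h' hθ.ne'
    rw [h₃, h₄] at hm
    rw [hδ, hδ]
    simpa using hm
  · have h₃ : p.right ≤ lmax := by
      have := (hl x (x + η) (by linarith)).2
      rw [h₁] at this
      exact le_of_mul_le_mul_right (by linarith) hη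
    have h₄ : -lmin ≤ q.left := by
      have := (hl (y - θ) y (by linarith)).1
      rw [h₂] at this
      exact le_of_mul_le_mul_right (by linarith) hθ
    have h₅ : (p.right - q.left) * (y - x) ≤ (lmax + lmin) * (y - x) :=
      mul_le_mul_of_nonneg_right (by linarith) (by linarith)
    have h₆ : ε * δ ≤ ε * min (D x) (D y) :=
      mul_le_mul_of_nonneg_left (le_min (hδ x) (hδ y)) hε.le
    linarith

/-- The segment from `p` to `q` approximates `D` from above with relative error `ε`. -/
def Approx (D : ℝ → ℝ) (ε : ℝ) (p q : ℝ × ℝ) : Prop :=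
  ∀ s, p.1 ≤ s → s < q.1 →
    D s ≤ p.2 + slope2 p q * (s - p.1) ∧ p.2 + slope2 p q * (s - p.1) ≤ (1 + ε) * D s

/-- Consecutive samples, the later one first, between which `D` is concave and the tangents are
close to the chord. -/
structure Link (D : ℝ → ℝ) (ε : ℝ) (q p : Sample) : Prop where
  lt : p.time < q.time
  fst : IsSample D p.time p
  snd : IsSample D q.time q
  concave : ConcaveBetween D p.time q.time
  mae_le : mae p q ≤ ε * min p.val q.val

theorem Link.left_le_right {ε : ℝ} (h : Link D ε q p) : q.left ≤ p.right :=
  h.concave.left_le_right h.fst h.snd le_rfl h.lt le_rfl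

theorem Link.min_le {ε : ℝ} (h : Link D ε q p) {s : ℝ} (h₁ : p.time ≤ s) (h₂ : s ≤ q.time) :
    min p.val q.val ≤ D s := by
  have := h.concave p.time q.time s le_rfl h₁ h₂ le_rfl
  rw [h.fst.val, h.snd.val]
  have hlt := h.lt
  have a₁ := mul_le_mul_of_nonneg_right (min_le_left (D p.time) (D q.time)) (sub_nonneg.2 h₂)
  have a₂ := mul_le_mul_of_nonneg_right (min_le_right (D p.time) (D q.time)) (sub_nonneg.2 h₁)
  refine le_of_mul_le_mul_right ?_ (sub_pos.2 hlt)
  linarith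

/-- Without a kink, the samples are joined directly. -/
theorem Link.approx {ε : ℝ} (hε : 0 < ε) (h₀ : ∀ t, 0 ≤ D t) (h : Link D ε q p)
    (hn : ¬ q.left < p.right) : Approx D ε (p.time, p.val) (q.time, q.val) := by
  intro s h₁ h₂
  simp only at h₁ h₂
  have he : q.left = p.right := le_antisymm h.left_le_right (not_lt.1 hn)
  have hlt := h.lt
  have hd : 0 < q.time - p.time := sub_pos.2 hlt
  have t₁ := h.concave.le_right h.fst le_rfl hlt hlt.le le_rfl
  have t₂ := h.concave.le_left h.snd hlt le_rfl le_rfl hlt.le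
  have hs : slope2 (p.time, p.val) (q.time, q.val) = p.right := by
    unfold slope2
    simp only
    rw [h.fst.val, h.snd.val, div_eq_iff hd.ne']
    rw [he] at t₂
    linarith
  simp only
  rw [hs, h.fst.val]
  have t₃ := h.concave.le_right h.fst le_rfl hlt h₁ h₂.le
  refine ⟨t₃, ?_⟩
  have hc := h.concave p.time q.time s le_rfl h₁ h₂.le le_rfl
  have e : D q.time = D p.time + p.right * (q.time - p.time) := by
    rw [he] at t₂
    linarith
  rw [e] at hc
  have : D p.time + p.right * (s - p.time) ≤ D s := by
    refine le_of_mul_le_mul_right ?_ hd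
    linarith
  have := mul_nonneg hε.le (h₀ s)
  linarith

/-- With a kink, both tangents approximate. -/
theorem Link.approx_kink {ε : ℝ} (hε : 0 < ε) (h : Link D ε q p) (hk : q.left < p.right) :
    Approx D ε (p.time, p.val) (kink p q, p.val + p.right * (kink p q - p.time)) ∧
    Approx D ε (kink p q, p.val + p.right * (kink p q - p.time)) (q.time, q.val) := by
  have hlt := h.lt
  have hd : 0 < q.time - p.time := sub_pos.2 hlt
  have hr : 0 < p.right - q.left := sub_pos.2 hk
  have t₁ := h.concave.le_right h.fst le_rfl hlt hlt.le le_rfl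
  have t₂ := h.concave.le_left h.snd hlt le_rfl le_rfl hlt.le
  obtain ⟨m, hm⟩ : ∃ m, m = kink p q := ⟨_, rfl⟩
  have hmul : m * (p.right - q.left) =
      q.val - p.val + p.time * p.right - q.time * q.left := by
    rw [hm]
    unfold kink
    field_simp
  rw [h.fst.val, h.snd.val] at hmul
  have hm₁ : p.time ≤ m := le_of_mul_le_mul_right (by linarith) hr
  have hm₂ : m ≤ q.time := le_of_mul_le_mul_right (by linarith) hr
  have hmae := h.mae_le
  unfold mae at hmae
  rw [← hm] at hmae ⊢
  -- The quantity `mae` is the vertical gap between tangents and chord at the kink.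
  have hE : (p.right - q.left) * ((m - p.time) * (q.time - m) / (q.time - p.time)) =
      (D p.time + p.right * (m - p.time)) -
        (D p.time * (q.time - m) + D q.time * (m - p.time)) / (q.time - p.time) := by
    have e : D q.time = D p.time + p.right * (m - p.time) + q.left * (q.time - m) := by
      linarith
    rw [e]
    field_simp
    ring
  rw [hE] at hmae
  have hchord : ∀ s, p.time ≤ s → s ≤ q.time →
      (D p.time * (q.time - s) + D q.time * (s - p.time)) / (q.time - p.time) ≤ D s := by
    intro s h₁ h₂
    rw [div_le_iff₀ hd]
    exact h.concave p.time q.time s le_rfl h₁ h₂ le_rfl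
  have hc : ∀ s, (D p.time * (q.time - s) + D q.time * (s - p.time)) / (q.time - p.time) =
      D p.time + (D q.time - D p.time) / (q.time - p.time) * (s - p.time) := by
    intro s
    field_simp
    ring
  obtain ⟨c, hcd⟩ : ∃ c, c = (D q.time - D p.time) / (q.time - p.time) := ⟨_, rfl⟩
  have hcmul : c * (q.time - p.time) = D q.time - D p.time := by rw [hcd]; field_simp
  have hc₁ : c ≤ p.right := le_of_mul_le_mul_right (by linarith) hd
  have hc₂ : q.left ≤ c := le_of_mul_le_mul_right (by linarith) hd
  rw [hc, ← hcd] at hmae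
  refine ⟨?_, ?_⟩
  · intro s h₁ h₂
    simp only at h₁ h₂
    have hs : slope2 (p.time, p.val) (m, p.val + p.right * (m - p.time)) = p.right := by
      unfold slope2
      -- If the kink coincides with a sample, the degenerate segment contains no `s`, since `Approx`
      -- excludes the right end.
      have : m - p.time ≠ 0 := by linarith
      simp only
      field_simp
      ring
    have hsq : s ≤ q.time := by linarith
    simp only
    rw [hs, h.fst.val]
    refine ⟨h.concave.le_right h.fst le_rfl hlt h₁ hsq, ?_⟩
    have b₁ := hchord s h₁ hsq
    rw [hc, ← hcd] at b₁
    have b₂ := mul_le_mul_of_nonneg_left (h.min_le h₁ hsq) hε.le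
    -- The gap between tangent and chord grows linearly up to the kink, so it never exceeds `mae`.
    have b₃ := mul_le_mul_of_nonneg_left h₂.le (sub_nonneg.2 hc₁)
    linarith
  · intro s h₁ h₂
    simp only at h₁ h₂
    have e : q.val - (p.val + p.right * (m - p.time)) = q.left * (q.time - m) := by
      rw [h.fst.val, h.snd.val]
      linarith
    have hs : slope2 (m, p.val + p.right * (m - p.time)) (q.time, q.val) = q.left := by
      unfold slope2
      have : q.time - m ≠ 0 := by linarith
      simp only
      rw [e]
      field_simp
    have hps : p.time ≤ s := by linarith
    simp only
    rw [hs]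
    have e' : p.val + p.right * (m - p.time) + q.left * (s - m) =
        D q.time + q.left * (s - q.time) := by
      rw [h.snd.val] at e
      linarith
    refine ⟨e' ▸ h.concave.le_left h.snd hlt le_rfl hps h₂.le, ?_⟩
    rw [h.fst.val]
    have b₁ := hchord s hps h₂.le
    rw [hc, ← hcd] at b₁
    have b₂ := mul_le_mul_of_nonneg_left (h.min_le hps h₂.le) hε.le
    have b₃ := mul_le_mul_of_nonneg_left h₁ (sub_nonneg.2 hc₂)
    linarith

end Tangents

/-! ### Bisection trees -/

/-- Recursive bisection of `[a, b]` with `k` midpoints down to intervals with property `I`. -/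
inductive BisectionTree (I : ℝ → ℝ → Prop) : ℝ → ℝ → ℕ → Prop
  | leaf {a b} : I a b → BisectionTree I a b 0
  | node {a b k l} : BisectionTree I a ((a + b) / 2) k → BisectionTree I ((a + b) / 2) b l →
      BisectionTree I a b (k + l + 1)

/-- Each halving doubles the ratio of the distance from the ends to the length, or more. After `j`
rounds all intervals are far from both ends, and the full binary tree has 2^j - 1 midpoints. -/
theorem exists_bisectionTree_inner {I : ℝ → ℝ → Prop} {a b M : ℝ}
    (hfar : ∀ x y, a ≤ x → x < y → y ≤ b → M * (y - x) ≤ x - a → M * (y - x) ≤ b - y → I x y)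
    (j : ℕ) {x y : ℝ} (hax : a ≤ x) (hxy : x < y) (hyb : y ≤ b)
    (h₁ : M * (y - x) ≤ 2 ^ j * (x - a)) (h₂ : M * (y - x) ≤ 2 ^ j * (b - y)) :
    ∃ k, k + 1 ≤ 2 ^ j ∧ BisectionTree I x y k := by
  induction j generalizing x y with
  | zero => exact ⟨0, by simp, .leaf (hfar x y hax hxy hyb (by simpa using h₁) (by simpa using h₂))⟩
  | succ j ih =>
    rw [pow_succ] at h₁ h₂
    have h2 : (0 : ℝ) < 2 ^ j := by positivity
    have e₁ : M * (y - x) / 2 ≤ 2 ^ j * (x - a) := by linarith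
    have e₂ : M * (y - x) / 2 ≤ 2 ^ j * (b - y) := by linarith
    have e₃ : 2 ^ j * (x - a) ≤ 2 ^ j * ((x + y) / 2 - a) :=
      mul_le_mul_of_nonneg_left (by linarith) h2.le
    have e₄ : 2 ^ j * (b - y) ≤ 2 ^ j * (b - (x + y) / 2) :=
      mul_le_mul_of_nonneg_left (by linarith) h2.le
    have f₁ : (x + y) / 2 - x = (y - x) / 2 := by ring
    have f₂ : y - (x + y) / 2 = (y - x) / 2 := by ring
    obtain ⟨k, hk, hk'⟩ := ih (x := x) (y := (x + y) / 2) hax (by linarith) (by linarith)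
      (by rw [f₁]; linarith) (by rw [f₁]; linarith)
    obtain ⟨l, hl, hl'⟩ := ih (x := (x + y) / 2) (y := y) (by linarith) (by linarith) hyb
      (by rw [f₂]; linarith) (by rw [f₂]; linarith)
    exact ⟨_, by rw [pow_succ]; omega, .node hk' hl'⟩

/-- Next to the end `a`, the outer half of an interval is as far from `a` as it is long, so
`exists_bisectionTree_inner` finishes it with fewer than 2^j midpoints. Only the half that touches
`a` is pursued, and after `d` halvings it is short. -/
theorem exists_bisectionTree_left {I : ℝ → ℝ → Prop} {a b M h₀ : ℝ} {j : ℕ}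
    (hfar : ∀ x y, a ≤ x → x < y → y ≤ b → M * (y - x) ≤ x - a → M * (y - x) ≤ b - y → I x y)
    (hshort : ∀ x y, a ≤ x → x < y → y ≤ b → y - x ≤ h₀ → I x y) (hM : M ≤ 2 ^ j)
    (d : ℕ) {y : ℝ} (hay : a < y) (hyb : y - a ≤ b - y)
    (hd : y - a ≤ 2 ^ d * h₀) : ∃ k, k ≤ d * 2 ^ j ∧ BisectionTree I a y k := by
  induction d generalizing y with
  | zero => exact ⟨0, by simp, .leaf (hshort a y le_rfl hay (by linarith) (by simpa using hd))⟩
  | succ d ih =>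
    rw [pow_succ] at hd
    have f₂ : y - (a + y) / 2 = (y - a) / 2 := by ring
    obtain ⟨k, hk, hk'⟩ := ih (y := (a + y) / 2) (by linarith) (by linarith) (by linarith)
    obtain ⟨l, hl, hl'⟩ := exists_bisectionTree_inner hfar j (x := (a + y) / 2) (y := y)
      (by linarith) (by linarith) (by linarith)
      (by
        rw [f₂, show (a + y) / 2 - a = (y - a) / 2 by ring]
        exact mul_le_mul_of_nonneg_right hM (by linarith))
      (by
        rw [f₂]
        exact (mul_le_mul_of_nonneg_right hM (by linarith)).trans
          (mul_le_mul_of_nonneg_left (by linarith) (by positivity)))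
    refine ⟨_, ?_, .node hk' hl'⟩
    rw [add_mul]
    omega

theorem exists_bisectionTree_right {I : ℝ → ℝ → Prop} {a b M h₀ : ℝ} {j : ℕ}
    (hfar : ∀ x y, a ≤ x → x < y → y ≤ b → M * (y - x) ≤ x - a → M * (y - x) ≤ b - y → I x y)
    (hshort : ∀ x y, a ≤ x → x < y → y ≤ b → y - x ≤ h₀ → I x y) (hM : M ≤ 2 ^ j)
    (d : ℕ) {x : ℝ} (hxb : x < b) (hax : b - x ≤ x - a)
    (hd : b - x ≤ 2 ^ d * h₀) : ∃ k, k ≤ d * 2 ^ j ∧ BisectionTree I x b k := by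
  induction d generalizing x with
  | zero => exact ⟨0, by simp, .leaf (hshort x b (by linarith) hxb le_rfl (by simpa using hd))⟩
  | succ d ih =>
    rw [pow_succ] at hd
    have f₁ : (x + b) / 2 - x = (b - x) / 2 := by ring
    obtain ⟨k, hk, hk'⟩ := ih (x := (x + b) / 2) (by linarith) (by linarith) (by linarith)
    obtain ⟨l, hl, hl'⟩ := exists_bisectionTree_inner hfar j (x := x) (y := (x + b) / 2)
      (by linarith) (by linarith) (by linarith)
      (by
        rw [f₁]
        exact (mul_le_mul_of_nonneg_right hM (by linarith)).trans
          (mul_le_mul_of_nonneg_left (by linarith) (by positivity)))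
      (by
        rw [f₁, show b - (x + b) / 2 = (b - x) / 2 by ring]
        exact mul_le_mul_of_nonneg_right hM (by linarith))
    refine ⟨_, ?_, .node hl' hk'⟩
    rw [add_mul]
    omega

/-- A concave piece is bisected at few points. -/
theorem exists_bisectionTree {I : ℝ → ℝ → Prop} {a b M h₀ : ℝ} {j : ℕ}
    (hfar : ∀ x y, a ≤ x → x < y → y ≤ b → M * (y - x) ≤ x - a → M * (y - x) ≤ b - y → I x y)
    (hshort : ∀ x y, a ≤ x → x < y → y ≤ b → y - x ≤ h₀ → I x y) (hM : M ≤ 2 ^ j)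
    (d : ℕ) (hab : a < b) (hd : b - a ≤ 2 ^ d * h₀) :
    ∃ k, k ≤ 2 * (d * 2 ^ j) + 1 ∧ BisectionTree I a b k := by
  obtain ⟨k, hk, hk'⟩ := exists_bisectionTree_left hfar hshort hM d (y := (a + b) / 2)
    (by linarith) (by linarith) (by linarith)
  obtain ⟨l, hl, hl'⟩ := exists_bisectionTree_right hfar hshort hM d (x := (a + b) / 2)
    (by linarith) (by linarith) (by linarith)
  exact ⟨_, by omega, .node hk' hl'⟩

/-! ## Summaries from a landmark -/

theorem push_runs (s : Fin n → Sample) (vs : List (Fin n)) (hvs : vs.Nodup)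
    (lbp : Fin n → List Sample) :
    Runs (push s vs lbp) vs.length
      (fun l => ∀ v, l v = if v ∈ vs then s v :: lbp v else lbp v) := by
  refine (Runs.foldlM_le (fun done (l : Fin n → List Sample) =>
    ∀ v, l v = if v ∈ done then s v :: lbp v else lbp v) 1 (by simp) ?_).mono (by simp)
    fun _ h => h
  intro done x rest l hl hI
  refine Runs.tick (b := 0) (Runs.pure ?_ 0)
  intro v
  have hx : x ∉ done := by
    rw [hl, List.nodup_append] at hvs
    intro hx
    exact hvs.2.2 x hx x (by simp) rfl
  by_cases hv : v = x
  · subst hv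
    simp [hI, hx]
  · simp [hI, hv]

theorem nodup_length_le (l : List (Fin n)) (h : l.Nodup) : l.length ≤ n := by
  simpa using h.length_le_card

/-- No function is bisected between `a` and `b`. -/
def Quiet (D : Fin n → ℝ → ℝ) (ε a b : ℝ) : Prop :=
  ∀ v p q, IsSample (D v) a p → IsSample (D v) b q → mae p q ≤ ε * min p.val q.val

namespace Network

variable {G : Network n} {m : ℕ}

/-- The cost of a bisection with `k` midpoints. -/
def bisectCost (n m k : ℕ) : ℕ := k * (probeCost n m + 2 * n + 1) + (k + 1) * (1 + n)

/-- One tree, whose leaves are quiet for all destinations at once, bounds the concurrent recursion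
from above. A run may stop earlier, once no vertex is active. A vertex that is dropped at a node has
met the error bound there, so its two end samples are linked directly. -/
theorem Regular.bisect_runs (hG : G.Regular m) {ε : ℝ} {ℓ : Fin n} {a b : ℝ}
    (hc : ∀ v, ConcaveBetween (G.dist ℓ v) a b) {x y : ℝ} {k : ℕ}
    (ht : BisectionTree (Quiet (G.dist ℓ) ε) x y k) (hax : a ≤ x) (hxy : x < y) (hyb : y ≤ b)
    {s f : Fin n → Sample} (hs : ∀ v, IsSample (G.dist ℓ v) x (s v))
    (hf : ∀ v, IsSample (G.dist ℓ v) y (f v)) (active : List (Fin n)) (hact : active.Nodup)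
    (lbp : Fin n → List Sample) :
    Runs (bisect G ε ℓ s f x y active lbp) (bisectCost n m k) (fun lbp' =>
      ∀ v, ∃ new, lbp' v = new ++ lbp v ∧ new.length ≤ k ∧ (v ∉ active → new = []) ∧
        (v ∈ active → List.IsChain (Link (G.dist ℓ v) ε) (f v :: (new ++ [s v])))) := by
  have hlink : ∀ {x y : ℝ} {s f : Fin n → Sample}, a ≤ x → x < y → y ≤ b →
      (∀ v, IsSample (G.dist ℓ v) x (s v)) → (∀ v, IsSample (G.dist ℓ v) y (f v)) →
      ∀ v, mae (s v) (f v) ≤ ε * min (s v).val (f v).val →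
      List.IsChain (Link (G.dist ℓ v) ε) (f v :: ([] ++ [s v])) := by
    intro x y s f hax hxy hyb hs hf v hm
    rw [List.nil_append, List.isChain_pair]
    have e₁ := (hs v).time
    have e₂ := (hf v).time
    refine ⟨by rw [e₁, e₂]; exact hxy, by rw [e₁]; exact hs v, by rw [e₂]; exact hf v, ?_, hm⟩
    rw [e₁, e₂]
    exact (hc v).mono hax hyb
  induction ht generalizing s f active lbp with
  | @leaf x y hI =>
    have hn := nodup_length_le active hact
    rw [bisect]
    have hempty : active.filter
        (fun v => decide (ε * min (s v).val (f v).val < mae (s v) (f v))) = [] := by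
      rw [List.filter_eq_nil_iff]
      intro v _
      simpa using hI v _ _ (hs v) (hf v)
    simp only [hempty, List.isEmpty_nil, if_true]
    refine Runs.tick_pure ?_ ?_
    swap
    · unfold bisectCost
      omega
    intro v
    refine ⟨[], by simp, by simp, fun _ => rfl, fun _ => ?_⟩
    exact hlink hax hxy hyb hs hf v (hI v _ _ (hs v) (hf v))
  | @node x y k l _ _ ih₁ ih₂ =>
    have hn := nodup_length_le active hact
    rw [bisect]
    obtain ⟨act, hact'⟩ : ∃ act, act = active.filter
        (fun v => decide (ε * min (s v).val (f v).val < mae (s v) (f v))) := ⟨_, rfl⟩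
    simp only [← hact']
    have hnd : act.Nodup := hact' ▸ hact.filter _
    have hna := nodup_length_le act hnd
    have hmem : ∀ v, v ∈ act ↔ v ∈ active ∧ ε * min (s v).val (f v).val < mae (s v) (f v) := by
      intro v
      simp [hact']
    by_cases he : act.isEmpty = true
    · rw [if_pos he]
      rw [List.isEmpty_iff] at he
      refine Runs.tick_pure ?_ ?_
      swap
      · unfold bisectCost
        have : (k + l + 1 + 1) * (1 + n) = (k + l + 1) * (1 + n) + (1 + n) := by ring
        omega
      intro v
      refine ⟨[], by simp, by simp, fun _ => rfl, fun hv => ?_⟩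
      refine hlink hax hxy hyb hs hf v ?_
      by_contra hlt
      have := (hmem v).2 ⟨hv, not_le.1 hlt⟩
      simp [he] at this
    · rw [if_neg he]
      refine (Runs.tick ((hG.probe_runs ℓ ((x + y) / 2)).bind fun mid hmid =>
        (ih₁ hax (by linarith) (by linarith) hs hmid act hnd lbp).bind fun lbp₁ h₁ =>
          (push_runs mid act hnd lbp₁).bind fun lbp₂ h₂ =>
            (ih₂ (by linarith) (by linarith) hyb hmid hf act hnd lbp₂).mono le_rfl ?_)).mono ?_
        fun _ h => h
      · intro lbp₃ h₃ v
        obtain ⟨new₁, e₁, l₁, n₁, c₁⟩ := h₁ v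
        obtain ⟨new₂, e₂, l₂, n₂, c₂⟩ := h₃ v
        have e := h₂ v
        by_cases hv : v ∈ act
        · rw [if_pos hv] at e
          refine ⟨new₂ ++ mid v :: new₁, by simp [e₂, e, e₁], by simp; omega, ?_, ?_⟩
          · intro hv'
            exact absurd ((hmem v).1 hv).1 hv'
          · intro _
            have := (List.isChain_split (l₁ := f v :: new₂)).2 ⟨c₂ hv, c₁ hv⟩
            simpa using this
        · rw [if_neg hv] at e
          refine ⟨[], by simp [e₂, e, e₁, n₁ hv, n₂ hv], by simp, fun _ => rfl, fun hva => ?_⟩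
          refine hlink hax hxy hyb hs hf v ?_
          by_contra hlt
          exact hv ((hmem v).2 ⟨hva, not_le.1 hlt⟩)
      · unfold bisectCost
        have e₁ : (k + l + 1 + 1) * (1 + n) = (k + 1) * (1 + n) + (l + 1) * (1 + n) := by ring
        have e₂ : (k + l + 1) * (probeCost n m + 2 * n + 1) =
          k * (probeCost n m + 2 * n + 1) + l * (probeCost n m + 2 * n + 1) +
            (probeCost n m + 2 * n + 1) := by ring
        omega

/-- On the pieces between consecutive cut points all travel times from `ℓ` are concave, and few
bisections are needed. -/
def GoodCuts (G : Network n) (ε : ℝ) (ℓ : Fin n) (N : ℕ) (t c : ℝ) : Prop :=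
  t < c ∧ (∀ v, ConcaveBetween (G.dist ℓ v) t c) ∧
    ∃ k, k ≤ N ∧ BisectionTree (Quiet (G.dist ℓ) ε) t c k

/-- Sample lists are kept with the latest sample first. The witness `q` exposes this head, which
sits at the final cut point, in the form that `upper` consumes. -/
theorem Regular.pieces_runs (hG : G.Regular m) {ε : ℝ} {ℓ : Fin n} {N : ℕ} (cs : List ℝ)
    (t : ℝ) (hcs : List.IsChain (G.GoodCuts ε ℓ N) (t :: cs)) (s : Fin n → Sample)
    (hs : ∀ v, IsSample (G.dist ℓ v) t (s v)) (lbp : Fin n → List Sample) :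
    Runs (pieces G ε ℓ s t cs lbp) (cs.length * (probeCost n m + bisectCost n m N + n))
      (fun lbp' => ∀ v, ∃ q new rest, lbp' v = new ++ lbp v ∧
        new.length ≤ cs.length * (N + 1) ∧ new ++ [s v] = q :: rest ∧
        IsSample (G.dist ℓ v) ((t :: cs).getLast (List.cons_ne_nil _ _)) q ∧
        List.IsChain (Link (G.dist ℓ v) ε) (new ++ [s v])) := by
  induction cs generalizing t s lbp with
  | nil =>
    rw [pieces]
    refine Runs.pure ?_ _
    intro v
    exact ⟨s v, [], [], by simp, by simp, rfl, hs v, by simp⟩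
  | cons c cs ih =>
    rw [pieces]
    rw [List.isChain_cons_cons] at hcs
    obtain ⟨⟨htc, hconc, k, hk, htree⟩, hcs⟩ := hcs
    refine ((hG.probe_runs ℓ c).bind fun f hf =>
      (hG.bisect_runs hconc htree le_rfl htc le_rfl hs hf (List.finRange n)
        (List.nodup_finRange n) lbp).bind fun lbp₁ h₁ =>
        (push_runs f (List.finRange n) (List.nodup_finRange n) lbp₁).bind fun lbp₂ h₂ =>
          (ih c hcs f hf lbp₂).mono le_rfl ?_).mono ?_ fun _ h => h
    · intro lbp₃ h₃ v
      obtain ⟨new₁, e₁, l₁, -, c₁⟩ := h₁ v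
      obtain ⟨q, new₂, rest, e₂, l₂, e₃, hq, c₂⟩ := h₃ v
      have e := h₂ v
      rw [if_pos (List.mem_finRange v)] at e
      have hsplit := List.isChain_split.2 ⟨c₂, c₁ (List.mem_finRange v)⟩
      refine ⟨q, new₂ ++ f v :: new₁, rest ++ (new₁ ++ [s v]), by simp [e₂, e, e₁], ?_, ?_, ?_, ?_⟩
      · simp only [List.length_append, List.length_cons, add_mul]
        omega
      · rw [List.append_assoc, List.cons_append, ← List.singleton_append, ← List.append_assoc,
          e₃, List.cons_append]
      · simpa using hq
      · simpa using hsplit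
    · simp only [List.length_cons, add_mul, List.length_finRange]
      have : bisectCost n m k ≤ bisectCost n m N := by
        unfold bisectCost
        gcongr
      omega

end Network

/-- The samples come in reverse order of time, so consing restores increasing order. The invariant
links the sample at the head of the input to the points already produced. -/
theorem upper_runs {D : ℝ → ℝ} {ε : ℝ} (hε : 0 < ε) (h₀ : ∀ t, 0 ≤ D t) (q : Sample)
    (l : List Sample) (hl : List.IsChain (Link D ε) (q :: l)) (acc : List (ℝ × ℝ))
    (hacc : List.IsChain (Approx D ε) ((q.time, q.val) :: acc)) :
    Runs (upper (q :: l) acc) (l.length + 1) (fun r =>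
      r.length ≤ acc.length + 2 * l.length + 1 ∧ List.IsChain (Approx D ε) r ∧
      r.head? = ((q :: l).getLast?).map (fun p => (p.time, p.val)) ∧
      r.getLast? = ((q.time, q.val) :: acc).getLast?) := by
  induction l generalizing q acc with
  | nil =>
    rw [upper]
    refine Runs.tick (b := 0) (Runs.pure ⟨by simp, hacc, by simp, rfl⟩ 0)
  | cons p l ih =>
    rw [upper]
    rw [List.isChain_cons_cons] at hl
    by_cases hk : q.left < p.right
    · rw [if_pos hk]
      have ha := hl.1.approx_kink hε hk
      refine (Runs.tick (ih p hl.2 _ ?_)).mono (by simp only [List.length_cons]; omega) ?_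
      · exact List.isChain_cons_cons.2 ⟨ha.1, List.isChain_cons_cons.2 ⟨ha.2, hacc⟩⟩
      · rintro r ⟨h₁, h₂, h₃, h₄⟩
        refine ⟨?_, h₂, ?_, ?_⟩
        · simp only [List.length_cons] at h₁ ⊢
          omega
        · rw [h₃, List.getLast?_cons_cons]
        · rw [h₄, List.getLast?_cons_cons, List.getLast?_cons_cons]
    · rw [if_neg hk]
      refine (Runs.tick (ih p hl.2 _ ?_)).mono (by simp only [List.length_cons]; omega) ?_
      · exact List.isChain_cons_cons.2 ⟨hl.1.approx hε h₀ hk, hacc⟩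
      · rintro r ⟨h₁, h₂, h₃, h₄⟩
        refine ⟨?_, h₂, ?_, ?_⟩
        · simp only [List.length_cons] at h₁ ⊢
          omega
        · rw [h₃, List.getLast?_cons_cons]
        · rw [h₄, List.getLast?_cons_cons]

/-- A summary of at most `N` points that approximates `D` on `[0, T)`. -/
structure IsSummary (D : ℝ → ℝ) (ε T : ℝ) (N : ℕ) (pts : Array (ℝ × ℝ)) : Prop where
  two_le : 2 ≤ pts.size
  size_le : pts.size ≤ N
  first : (pts.getD 0 (0, 0)).1 = 0
  last : (pts.getD (pts.size - 1) (0, 0)).1 = T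
  approx : ∀ i, i + 1 < pts.size → Approx D ε (pts.getD i (0, 0)) (pts.getD (i + 1) (0, 0))

theorem isSummary_of_chain {D : ℝ → ℝ} {ε T : ℝ} (hT : 0 < T) {N : ℕ} {l : List (ℝ × ℝ)}
    (hl : List.IsChain (Approx D ε) l) (hN : l.length ≤ N) {x y : ℝ} (h₁ : l.head? = some (0, x))
    (h₂ : l.getLast? = some (T, y)) : IsSummary D ε T N l.toArray := by
  have hget : ∀ i, (hi : i < l.length) → l.toArray.getD i (0, 0) = l[i] := by
    intro i hi
    simp [Array.getD, hi]
  have h2 : 2 ≤ l.length := by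
    match l, h₁, h₂ with
    | [], h₁, _ => simp at h₁
    | [p], h₁, h₂ =>
      simp only [List.head?_cons, List.getLast?_singleton, Option.some.injEq] at h₁ h₂
      rw [h₁, Prod.mk.injEq] at h₂
      linarith [h₂.1]
    | _ :: _ :: _, _, _ => simp
  refine ⟨by simpa using h2, by simpa using hN, ?_, ?_, ?_⟩
  · rw [hget 0 (by omega)]
    rw [List.head?_eq_getElem?, List.getElem?_eq_getElem (by omega)] at h₁
    rw [Option.some.inj h₁]
  · rw [List.size_toArray, hget _ (by omega)]
    rw [List.getLast?_eq_getElem?, List.getElem?_eq_getElem (by omega)] at h₂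
    rw [Option.some.inj h₂]
  · intro i hi
    rw [List.size_toArray] at hi
    rw [hget i (by omega), hget (i + 1) hi]
    exact List.isChain_iff_getElem.1 hl i hi

theorem IsSummary.lookup_runs {D : ℝ → ℝ} {ε T : ℝ} {N : ℕ} {pts : Array (ℝ × ℝ)} (hT : 0 < T)
    (h : IsSummary D ε T N pts) (hD : ∀ t (k : ℤ), D (t + k * T) = D t) (t : ℝ) :
    Runs (lookup T pts false t) (N + 2) (fun y => D t ≤ y.1 ∧ y.1 ≤ (1 + ε) * D t) := by
  have hm := mul_fract_mem hT t
  refine (TDOracle.lookup_runs pts false t (T * Int.fract (t / T)) (by simp) h.two_le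
    (by simp only [Bool.false_eq_true, if_false]; rw [h.first]; exact hm.1)
    (by simp only [Bool.false_eq_true, if_false]; rw [h.last]; exact hm.2)).mono ?_ ?_
  · have := Nat.clog_le_of_le_pow (b := 2) (x := pts.size) (y := pts.size)
      (Nat.lt_two_pow_self).le
    have := h.size_le
    omega
  · rintro y ⟨i, hi, hs, hy₂, hy₁⟩
    simp only [Bool.false_eq_true, if_false] at hs
    have := h.approx i hi _ hs.1 hs.2
    rw [← hy₂, ← hy₁] at this
    have e : D (T * Int.fract (t / T)) = D t := by
      rw [mul_fract_eq hT]
      have := hD t (-⌊t / T⌋)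
      rw [← this]
      congr 1
      push_cast
      ring
    rwa [e] at this

/-! ## Preprocessing -/

theorem insertCut_runs (x : ℝ) (l : List ℝ) (hl : l.Pairwise (· < ·)) :
    Runs (insertCut x l) (l.length + 1) (fun r =>
      r.Pairwise (· < ·) ∧ (∀ y, y ∈ r ↔ y = x ∨ y ∈ l) ∧ r.length ≤ l.length + 1) := by
  induction l with
  | nil =>
    rw [insertCut]
    exact Runs.tick_pure (by simp) (by simp)
  | cons y l ih =>
    rw [insertCut]
    rw [List.pairwise_cons] at hl
    refine (Runs.tick (b := l.length + 1) ?_).mono (by simp only [List.length_cons]; omega)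
      fun _ h => h
    split_ifs with h₁ h₂
    · refine Runs.pure ⟨?_, by simp, by simp⟩ _
      refine List.pairwise_cons.2 ⟨?_, List.pairwise_cons.2 hl⟩
      intro z hz
      rcases List.mem_cons.1 hz with rfl | hz
      · exact h₁
      · exact h₁.trans (hl.1 z hz)
    · subst h₂
      exact Runs.pure ⟨List.pairwise_cons.2 hl, by simp, by simp⟩ _
    · refine ((ih hl.2).bind (b' := 0) ?_).mono (by omega) fun _ h => h
      rintro r ⟨h₃, h₄, h₅⟩
      refine Runs.pure ⟨?_, ?_, by simpa using h₅⟩ 0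
      · refine List.pairwise_cons.2 ⟨fun z hz => ?_, h₃⟩
        rcases (h₄ z).1 hz with rfl | hz
        · exact lt_of_le_of_ne (not_lt.1 h₁) (Ne.symm h₂)
        · exact hl.1 z hz
      · intro z
        simp only [List.mem_cons, h₄]
        tauto

/-- A sorted list from `a` to `b`. -/
structure IsCutList (a b : ℝ) (l : List ℝ) : Prop where
  sorted : l.Pairwise (· < ·)
  left : a ∈ l
  right : b ∈ l
  bounds : ∀ x ∈ l, a ≤ x ∧ x ≤ b

theorem IsCutList.eq_cons {a b : ℝ} {l : List ℝ} (h : IsCutList a b l) :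
    l = a :: l.tail ∧ (a :: l.tail).getLast (List.cons_ne_nil _ _) = b := by
  obtain ⟨c, cs, rfl⟩ : ∃ c cs, l = c :: cs := by
    cases l with
    | nil => exact absurd h.left (by simp)
    | cons c cs => exact ⟨c, cs, rfl⟩
  have hs := List.pairwise_cons.1 h.sorted
  have hc : c = a := by
    rcases List.mem_cons.1 h.left with h' | h'
    · exact h'.symm
    · have := hs.1 a h'
      have := (h.bounds c (by simp)).1
      linarith
  subst hc
  refine ⟨rfl, ?_⟩
  simp only [List.tail_cons]
  apply le_antisymm
  · exact (h.bounds _ (List.getLast_mem _)).2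
  · obtain ⟨i, hi, hib⟩ := List.getElem_of_mem h.right
    rw [List.getLast_eq_getElem, ← hib]
    rcases Nat.lt_or_ge i ((c :: cs).length - 1) with hlt | hge
    · exact (List.pairwise_iff_getElem.1 h.sorted i _ hi (by simp) hlt).le
    · have : i = (c :: cs).length - 1 := by omega
      subst this
      exact le_rfl

theorem IsCutList.chain {a b : ℝ} {l : List ℝ} (h : IsCutList a b l) {R : ℝ → ℝ → Prop}
    (hR : ∀ x y, a ≤ x → x < y → y ≤ b → (∀ z ∈ l, z ≤ x ∨ y ≤ z) → R x y) :
    List.IsChain R l := by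
  rw [List.isChain_iff_getElem]
  intro i hi
  have hs := List.pairwise_iff_getElem.1 h.sorted
  refine hR _ _ (h.bounds _ (List.getElem_mem _)).1 (hs i (i + 1) (by omega) hi (by omega))
    (h.bounds _ (List.getElem_mem _)).2 ?_
  intro z hz
  obtain ⟨j, hj, rfl⟩ := List.getElem_of_mem hz
  rcases lt_trichotomy j i with h' | rfl | h'
  · exact .inl (hs j i hj (by omega) h').le
  · exact .inl le_rfl
  · rcases Nat.eq_or_lt_of_le h' with h' | h'
    · subst h'
      exact .inr le_rfl
    · exact .inr (hs (i + 1) j hi hj h').le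

namespace Network

variable {G : Network n} {m : ℕ}

/-- `images` lists the latest departure times for all concavity-spoiling breakpoints. -/
def ImagesSpec (G : Network n) (images : List (Fin n → Option ℝ)) : Prop :=
  ∀ u, ∀ e ∈ G.out u, ∀ τ ∈ e.2.spoilTimes, ∃ im ∈ images, ∀ ℓ, ∃ key, im ℓ = some key ∧
    ∀ y, y ≤ -key ↔ G.arr ℓ u y ≤ τ

/-- By `exists_concave_sample` the slope could increase at an interior time only if that time led to
a spoiling breakpoint. Such a time is a cut point modulo `T`, and no cut point lies strictly inside
the piece. -/
theorem ImagesSpec.concave {images : List (Fin n → Option ℝ)} (hI : G.ImagesSpec images)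
    (hG : G.Regular m) {lmin lmax : ℝ} (hs : G.BoundedSlopes lmin lmax) (h₀ : 0 ≤ lmin)
    (h₁ : lmin < 1) (h₂ : 0 ≤ lmax) {ℓ : Fin n} {x y : ℝ} (hx : 0 ≤ x) (hy : y ≤ G.T)
    (hcut : ∀ im ∈ images, ∀ key, im ℓ = some key →
      G.T * Int.fract (-key / G.T) ≤ x ∨ y ≤ G.T * Int.fract (-key / G.T)) (v : Fin n) :
    ConcaveBetween (G.dist ℓ v) x y := by
  refine concaveBetween_of_samples (hs.dist_continuous h₀ h₂ ℓ v) fun t hxt hty =>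
    hG.exists_concave_sample ℓ t (fun u e he hsp => ?_) v
  obtain ⟨im, him, hkey⟩ := hI u e he _ hsp
  obtain ⟨key, hk, hk'⟩ := hkey ℓ
  have hT := G.T_pos
  obtain ⟨k, hkk⟩ : ∃ k : ℤ, k = ⌊G.arr ℓ u t / G.T⌋ := ⟨_, rfl⟩
  rw [mul_fract_eq hT, ← hkk] at hk'
  have harr : G.arr ℓ u (t + (-k : ℤ) * G.T) = G.arr ℓ u t - k * G.T := by
    rw [hG.arr_add_period]
    push_cast
    ring
  rw [← harr] at hk'
  have hmono := hs.arr_strictMono h₁ ℓ u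
  -- Arrival is strictly increasing, so the latest departure that meets the deadline is the only one
  -- that meets it exactly.
  have hkt : -key = t + (-k : ℤ) * G.T :=
    le_antisymm (hmono.le_iff_le.1 ((hk' _).1 le_rfl)) ((hk' _).2 le_rfl)
  have hf : G.T * Int.fract (-key / G.T) = t := by
    rw [hkt]
    have e : (t + (-k : ℤ) * G.T) / G.T = t / G.T + (-k : ℤ) := by field_simp
    rw [e, Int.fract_add_intCast, Int.fract_eq_self.2
      ⟨div_nonneg (by linarith) hT.le, (div_lt_one hT).2 (by linarith)⟩]
    field_simp
  rcases hcut im him key hk with h | h <;> rw [hf] at h <;> linarith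

/-- Concave pieces are bisected at no more than `N` points. -/
def FewBisections (G : Network n) (ε : ℝ) (N : ℕ) : Prop :=
  ∀ ℓ x y, 0 ≤ x → x < y → y ≤ G.T → (∀ v, ConcaveBetween (G.dist ℓ v) x y) →
    ∃ k, k ≤ N ∧ BisectionTree (Quiet (G.dist ℓ) ε) x y k

theorem Regular.fewBisections (hG : G.Regular m) {lmin lmax ε δ : ℝ}
    (hs : G.BoundedSlopes lmin lmax) (h₀ : 0 ≤ lmin) (h₂ : 0 ≤ lmax) (hε : 0 < ε)
    (hδ : ∀ u, ∀ e ∈ G.out u, ∀ t : ℝ, δ ≤ e.2.delay t) {j d : ℕ}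
    (hj : 1 ≤ ε * 2 ^ j) (hd : (lmax + lmin + 1) * G.T ≤ 2 ^ d * (4 * ε * δ)) :
    G.FewBisections ε (2 * (d * 2 ^ j) + 1) := by
  intro ℓ x y hx hxy hy hc
  have hpos : 0 < lmax + lmin + 1 := by linarith
  -- The choice `M = 2 ^ j` satisfies `1 ≤ ε * M`. The added 1 in the denominator covers the case
  -- that both slope bounds vanish.
  refine exists_bisectionTree (M := 2 ^ j) (h₀ := 4 * ε * δ / (lmax + lmin + 1)) ?_ ?_ le_rfl d
    hxy ?_
  · intro x' y' h₁ h₂ h₃ h₄ h₅ v p q hp hq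
    exact (hc v).mae_le_of_far (hG.dist_nonneg ℓ v) hε (one_le_pow₀ (by norm_num)) hj hp hq
      h₁ h₂ h₃ h₄ h₅
  · intro x' y' h₁ h₂ h₃ h₄ v p q hp hq
    refine (hc v).mae_le_of_short (δ := δ) (fun s t hst => hs.dist_sub ℓ v hst) hp hq h₁ h₂ h₃
      hε ?_ ?_
    · by_cases hv : ℓ = v
      · subst hv
        exact .inl (hG.dist_self ℓ)
      · exact .inr (hG.le_dist hδ hv)
    · rw [le_div_iff₀ hpos] at h₄
      nlinarith
  · rw [mul_div_assoc', le_div_iff₀ hpos]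
    nlinarith

/-- The number of points of a summary, for `K` spoiling breakpoints. -/
def summarySize (K N : ℕ) : ℕ := 2 * ((K + 1) * (N + 1) + 1)

/-- The cost of the summaries from one landmark. -/
def summaryCost (n m K N : ℕ) : ℕ :=
  K * (K + 4) + (probeCost n m + (n + ((K + 1) * (probeCost n m + bisectCost n m N + n) +
    n * (2 * summarySize K N + 1))))

theorem Regular.summaries_runs (hG : G.Regular m) {lmin lmax ε : ℝ} {N : ℕ}
    (hs : G.BoundedSlopes lmin lmax) (h₀ : 0 ≤ lmin) (h₁ : lmin < 1) (h₂ : 0 ≤ lmax)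
    (hε : 0 < ε) (hN : G.FewBisections ε N) (images : List (Fin n → Option ℝ))
    (hI : G.ImagesSpec images) (ℓ : Fin n) :
    Runs (summaries G ε images ℓ) (summaryCost n m images.length N) (fun row =>
      ∀ v, IsSummary (G.dist ℓ v) ε G.T (summarySize images.length N) (row v)) := by
  unfold summaries summaryCost
  have hT := G.T_pos
  refine (Runs.foldlM_le (fun done (l : List ℝ) => IsCutList 0 G.T l ∧
    l.length ≤ done.length + 2 ∧ ∀ im ∈ done, ∀ key, im ℓ = some key →
      G.T * Int.fract (-key / G.T) ∈ l) (images.length + 4) ?_ ?_).bind ?_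
  · exact ⟨⟨by simpa using hT, by simp, by simp, by simp [hT.le]⟩, by simp, by simp⟩
  · rintro done im rest l hl ⟨hc, hlen, hmem⟩
    have hdone : done.length + 1 ≤ images.length := by
      rw [hl]
      simp
    cases him : im ℓ with
    | none =>
      refine Runs.tick_pure ⟨hc, by simp; omega, ?_⟩ (by omega)
      intro im' h' key hk
      rcases List.mem_append.1 h' with h' | h'
      · exact hmem im' h' key hk
      · rw [List.mem_singleton.1 h', him] at hk
        simp at hk
    | some key =>
      refine (Runs.tick (insertCut_runs _ l hc.sorted)).mono (by omega) ?_
      rintro r ⟨r₁, r₂, r₃⟩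
      have hm := mul_fract_mem hT (-key)
      refine ⟨⟨r₁, (r₂ _).2 (.inr hc.left), (r₂ _).2 (.inr hc.right), ?_⟩, by simp; omega, ?_⟩
      · intro z hz
        rcases (r₂ z).1 hz with rfl | hz
        · exact ⟨hm.1, hm.2.le⟩
        · exact hc.bounds z hz
      · intro im' h' key' hk
        rcases List.mem_append.1 h' with h' | h'
        · exact (r₂ _).2 (.inr (hmem im' h' key' hk))
        · rw [List.mem_singleton.1 h', him] at hk
          obtain rfl := Option.some.inj hk
          exact (r₂ _).2 (.inl rfl)
  · rintro cuts ⟨hc, hlen, hmem⟩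
    -- Consecutive entries of the sorted list have no other cut point between them.
    have hchain : List.IsChain (G.GoodCuts ε ℓ N) cuts := by
      refine hc.chain fun x y hx hxy hy hz => ?_
      have hconc := hI.concave hG hs h₀ h₁ h₂ (ℓ := ℓ) hx hy
        fun im him key hk => hz _ (hmem im him key hk)
      exact ⟨hxy, hconc, hN ℓ x y hx hxy hy hconc⟩
    obtain ⟨e₁, e₂⟩ := hc.eq_cons
    rw [e₁] at hchain
    have htail : cuts.tail.length ≤ images.length + 1 := by simp; omega
    refine (hG.probe_runs ℓ 0).bind fun s hsm =>
      ((push_runs s (List.finRange n) (List.nodup_finRange n) (fun _ => [])).mono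
        (by simp) fun _ h => h).bind fun lbp₀ hp =>
      ((hG.pieces_runs cuts.tail 0 hchain s hsm lbp₀).mono
        (Nat.mul_le_mul_right _ htail) fun _ h => h).bind fun lbp hlbp => ?_
    refine (Runs.foldlM_le (fun done (row : Fin n → Array (ℝ × ℝ)) => ∀ v ∈ done,
      IsSummary (G.dist ℓ v) ε G.T (summarySize images.length N) (row v))
      (2 * summarySize images.length N + 1) (by simp) ?_).mono (by simp) ?_
    · intro done v rest row _ hrow
      obtain ⟨q, new, r, h₃, h₄, h₅, h₆, h₇⟩ := hlbp v
      have hv := hp v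
      rw [if_pos (List.mem_finRange v)] at hv
      rw [hv, h₅] at h₃
      rw [h₅] at h₇
      have hlen' : r.length ≤ (images.length + 1) * (N + 1) := by
        have := congrArg List.length h₅
        simp only [List.length_append, List.length_cons, List.length_nil] at this
        have := Nat.mul_le_mul_right (N + 1) htail
        omega
      rw [h₃]
      refine ((upper_runs hε (hG.dist_nonneg ℓ v) q r h₇ [] (by simp)).bind
        (b' := summarySize images.length N + 1) ?_).mono
        (by unfold summarySize; omega) fun _ h => h
      rintro l ⟨l₁, l₂, l₃, l₄⟩
      have hlN : l.length ≤ summarySize images.length N := by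
        unfold summarySize
        simp only [List.length_nil] at l₁
        omega
      refine Runs.tick_pure ?_ (by omega)
      intro w hw
      by_cases hwv : w = v
      · subst hwv
        rw [Function.update_self]
        have hlast : (q :: r).getLast? = some (s w) := by rw [← h₅]; simp
        rw [hlast] at l₃
        rw [e₂] at h₆
        refine isSummary_of_chain hT l₂ hlN (x := (s w).val) (y := q.val) ?_ ?_
        · rw [l₃, Option.map_some, (hsm w).time]
        · rw [l₄, List.getLast?_singleton, h₆.time]
      · rw [Function.update_of_ne hwv]
        refine hrow w ?_
        simpa [hwv] using hw
    · intro row hrow v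
      exact hrow v (List.mem_finRange v)

/-! ### The reverse network -/

theorem reverseAdj_runs (G : Network n) :
    Runs (reverseAdj G) (n + ∑ u, (G.out u).length) (fun adj =>
      (∀ v w P, (w, P) ∈ adj v ↔ (v, P) ∈ G.out w) ∧
        ∑ v, (adj v).length = ∑ u, (G.out u).length) := by
  unfold reverseAdj
  refine (Runs.foldlM (fun done (adj : Fin n → List (Fin n × Profile G.T)) =>
    (∀ v w P, (w, P) ∈ adj v ↔ w ∈ done ∧ (v, P) ∈ G.out w) ∧
      ∑ v, (adj v).length = (done.map (fun u => (G.out u).length)).sum)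
    (fun u => 1 + (G.out u).length) (by simp) ?_).mono ?_ ?_
  · rintro done u rest adj _ ⟨h₁, h₂⟩
    refine Runs.tick ((Runs.foldlM_le (fun done' (adj' : Fin n → List (Fin n × Profile G.T)) =>
      (∀ v w P, (w, P) ∈ adj' v ↔ (w, P) ∈ adj v ∨ (w = u ∧ (v, P) ∈ done')) ∧
        ∑ v, (adj' v).length = ∑ v, (adj v).length + done'.length) 1 (by simp) ?_).mono
        (by simp) ?_)
    · rintro done' e rest' adj' _ ⟨h₃, h₄⟩
      refine Runs.tick_pure ⟨?_, ?_⟩ le_rfl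
      · intro v w P
        by_cases hv : v = e.1
        · subst hv
          rw [Function.update_self, List.mem_cons, h₃, List.mem_append, List.mem_singleton,
            Prod.mk.injEq]
          constructor
          · rintro (⟨rfl, rfl⟩ | h | h)
            · exact .inr ⟨rfl, .inr rfl⟩
            · exact .inl h
            · exact .inr ⟨h.1, .inl h.2⟩
          · rintro (h | ⟨h, h' | h'⟩)
            · exact .inr (.inl h)
            · exact .inr (.inr ⟨h, h'⟩)
            · refine .inl ⟨h, ?_⟩
              rw [← h']
        · rw [Function.update_of_ne hv, h₃, List.mem_append, List.mem_singleton]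
          have : (v, P) ≠ e := fun h => hv (by rw [← h])
          simp [this]
      · have : ∑ v, (Function.update adj' e.1 ((u, e.2) :: adj' e.1) v).length =
            ∑ v, (adj' v).length + 1 := by
          rw [Fintype.sum_eq_add_sum_compl e.1, Fintype.sum_eq_add_sum_compl e.1
            (fun v => (adj' v).length)]
          have : ∑ v ∈ {e.1}ᶜ, (Function.update adj' e.1 ((u, e.2) :: adj' e.1) v).length =
              ∑ v ∈ {e.1}ᶜ, (adj' v).length := by
            refine Finset.sum_congr rfl fun v hv => ?_
            rw [Function.update_of_ne (by simpa using hv)]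
          rw [this]
          simp
          omega
        rw [this, h₄]
        simp
        omega
    · rintro adj' ⟨h₃, h₄⟩
      refine ⟨?_, ?_⟩
      · intro v w P
        rw [h₃, h₁, List.mem_append, List.mem_singleton]
        constructor
        · rintro (h | ⟨rfl, h⟩)
          · exact ⟨.inl h.1, h.2⟩
          · exact ⟨.inr rfl, h⟩
        · rintro ⟨h | rfl, h'⟩
          · exact .inl ⟨h, h'⟩
          · exact .inr ⟨rfl, h'⟩
      · rw [h₄, h₂]
        simp
  · rw [List.sum_map_add, ← Fin.sum_univ_def, ← Fin.sum_univ_def]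
    simp
  · rintro adj ⟨h₁, h₂⟩
    exact ⟨fun v w P => by simp [h₁], by rw [h₂, ← Fin.sum_univ_def]⟩

theorem spoilingPoints_runs (G : Network n) :
    Runs (spoilingPoints G) (n + (∑ u, (G.out u).length + G.numBreakpoints)) (fun l =>
      (∀ u, ∀ e ∈ G.out u, ∀ τ ∈ e.2.spoilTimes, (u, τ) ∈ l) ∧
        l.length = G.disconcavity) := by
  unfold spoilingPoints
  refine (Runs.foldlM (fun done (l : List (Fin n × ℝ)) =>
    (∀ u ∈ done, ∀ e ∈ G.out u, ∀ τ ∈ e.2.spoilTimes, (u, τ) ∈ l) ∧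
      l.length = (done.map
        (fun u => ((G.out u).map (fun e => e.2.spoilTimes.length)).sum)).sum)
    (fun u => 1 + ((G.out u).length + ((G.out u).map (fun e => e.2.pts.size)).sum))
    (by simp) ?_).mono ?_ ?_
  · rintro done u rest l _ ⟨h₁, h₂⟩
    refine Runs.tick ((Runs.foldlM (fun done' (l' : List (Fin n × ℝ)) =>
      (∀ y ∈ l, y ∈ l') ∧ (∀ e ∈ done', ∀ τ ∈ e.2.spoilTimes, (u, τ) ∈ l') ∧
        l'.length = l.length + (done'.map (fun e => e.2.spoilTimes.length)).sum)
        (fun e => 1 + e.2.pts.size) (by simp) ?_).mono ?_ ?_)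
    · rintro done' e rest' l' _ ⟨h₃, h₄, h₅⟩
      refine Runs.tick_pure ⟨?_, ?_, ?_⟩ le_rfl
      · intro y hy
        exact List.mem_append_right _ (h₃ y hy)
      · intro e' he' τ hτ
        rcases List.mem_append.1 he' with h | h
        · exact List.mem_append_right _ (h₄ e' h τ hτ)
        · rw [List.mem_singleton.1 h] at hτ
          exact List.mem_append_left _ (List.mem_map.2 ⟨τ, hτ, rfl⟩)
      · simp [h₅]
        omega
    · rw [List.sum_map_add]
      simp
    · rintro l' ⟨h₃, h₄, h₅⟩
      refine ⟨?_, ?_⟩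
      · intro w hw e he τ hτ
        rcases List.mem_append.1 hw with h | h
        · exact h₃ _ (h₁ w h e he τ hτ)
        · obtain rfl := List.mem_singleton.1 h
          exact h₄ e he τ hτ
      · rw [h₅, h₂]
        simp
  · rw [List.sum_map_add, List.sum_map_add, ← Fin.sum_univ_def, ← Fin.sum_univ_def,
      ← Fin.sum_univ_def]
    simp [numBreakpoints]
  · rintro l ⟨h₁, h₂⟩
    refine ⟨fun u => h₁ u (List.mem_finRange u), ?_⟩
    rw [h₂, ← Fin.sum_univ_def]
    rfl

/-- The adjunctions of the single arcs compose along paths: tree arcs show that departing by `-key`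
is early enough, and relaxation shows that no path allows a later departure. -/
theorem Regular.back_runs (hG : G.Regular m) {adj : Fin n → List (Fin n × Profile G.T)}
    (hadj : ∀ v w P, (w, P) ∈ adj v ↔ (v, P) ∈ G.out w)
    (hlen : ∑ v, (adj v).length = ∑ u, (G.out u).length) (u : Fin n) (τ : ℝ) :
    Runs (dijkstra adj stepBack (fun _ => false) u (-τ)) (dijkstraCost m (2 * n) (2 * n))
      (fun B => ∀ ℓ, ∃ key, B.settled ℓ = some key ∧ ∀ y, y ≤ -key ↔ G.arr ℓ u y ≤ τ) := by
  have hspec : ∀ w, ∀ e ∈ adj w, ∀ key : ℝ, Runs (stepBack e.2 key)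
      (Nat.clog 2 e.2.pts.size + 2) (fun k => k = e.2.back key) ∧
      ∀ y, y ≤ -e.2.back key ↔ y + e.2.delay y ≤ -key := fun w e he key =>
    stepBack_runs e.2 G.T_pos (fun _ _ h => hG.arc_mono ((hadj w e.1 e.2).1 he) h) key
  have hc : Computes adj stepBack (fun P key => P.back key) m := fun w e he key =>
    (hspec w e he key).1.mono (hG.arcCost e.1 (w, e.2) ((hadj w e.1 e.2).1 he)) fun _ h => h
  have hf : ∀ w, ∀ e ∈ adj w, ∀ key : ℝ, key < e.2.back key := fun w e he key =>
    e.2.lt_back G.T_pos (fun _ _ h => hG.arc_mono ((hadj w e.1 e.2).1 he) h) key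
  refine (dijkstra_full_runs hc hf u (-τ) (hlen.trans_le hG.arcs_le) ?_).mono le_rfl ?_
  · intro P h₀ hs v
    obtain ⟨p, hp⟩ := hG.strong v u
    induction p generalizing v with
    | nil => obtain rfl : v = u := hp; exact h₀
    | cons e p ih => exact hs e.1 (ih e.1 hp.2) (v, e.2) ((hadj e.1 v e.2).2 hp.1)
  · rintro B ⟨key, hB, h₀, hr, ht⟩ ℓ
    refine ⟨key ℓ, hB ℓ, fun y => ⟨?_, ?_⟩⟩
    · revert y
      refine ht (fun v => ∀ y, y ≤ -key v → G.arr v u y ≤ τ) ?_ ?_ ℓ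
      · intro y hy
        rw [h₀, neg_neg] at hy
        rwa [hG.arr_self]
      · intro w hw e he hk y hy
        rw [hk] at hy
        exact (hG.arr_cons u ((hadj w e.1 e.2).1 he) y).trans
          (hw _ (((hspec w e he (key w)).2 y).1 hy))
    · intro hy
      have hgen : ∀ (p : List (Fin n × Profile G.T)) (w : Fin n) (z : ℝ),
          G.IsPath w p u → G.pathArr p z ≤ τ → z ≤ -key w := by
        intro p
        induction p with
        | nil =>
          intro w z hp hz
          obtain rfl : w = u := hp
          rw [h₀, neg_neg]
          exact hz
        | cons e p ih =>
          intro w z hp hz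
          have he := (hadj e.1 w e.2).2 hp.1
          have h₁ := ((hspec e.1 _ he (key e.1)).2 z).2 (ih e.1 _ hp.2 hz)
          have h₂ := hr e.1 _ he
          simp only at h₁ h₂
          linarith
      obtain ⟨p, hp, hpt⟩ := hG.exists_path ℓ u y
      exact hgen p ℓ y hp (hpt.trans_le hy)

/-- A correct oracle for the landmark set `L`. -/
def OracleSpec (G : Network n) (ε : ℝ) (N : ℕ) (L : Finset (Fin n)) (O : Oracle n) : Prop :=
  ∀ ℓ, (ℓ ∉ L → O.row ℓ = none) ∧
    (ℓ ∈ L → ∃ row, O.row ℓ = some row ∧ ∀ v, IsSummary (G.dist ℓ v) ε G.T N (row v))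

/-- The cost of the preprocessing that does not depend on the landmarks. -/
def baseCost (G : Network n) (m : ℕ) : ℕ :=
  3 * n + (3 * n + G.numBreakpoints) +
    (G.disconcavity * (1 + dijkstraCost m (2 * n) (2 * n)) + n)

/-- The bound is affine in the number of landmarks, so its expectation needs only the expected
number of landmarks. -/
theorem Regular.preprocess_runs (hG : G.Regular m) {lmin lmax ε : ℝ} {N : ℕ}
    (hs : G.BoundedSlopes lmin lmax) (h₀ : 0 ≤ lmin) (h₁ : lmin < 1) (h₂ : 0 ≤ lmax)
    (hε : 0 < ε) (hN : G.FewBisections ε N) (L : Finset (Fin n)) :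
    Runs (preprocess G ε L) (G.baseCost m + L.card * summaryCost n m G.disconcavity N)
      (G.OracleSpec ε (summarySize G.disconcavity N) L) := by
  have harcs := hG.arcs_le
  unfold preprocess
  refine ((reverseAdj_runs G).bind (b' := (3 * n + G.numBreakpoints) +
    (G.disconcavity * (1 + dijkstraCost m (2 * n) (2 * n)) + (n +
      L.card * summaryCost n m G.disconcavity N))) ?_).mono (by unfold baseCost; omega)
      fun _ h => h
  rintro rev ⟨hrev, hlen⟩
  refine ((spoilingPoints_runs G).mono (by omega) fun _ h => h).bind ?_
  rintro sp ⟨hsp, hsplen⟩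
  rw [← hsplen]
  refine (Runs.foldlM_le (fun done (images : List (Fin n → Option ℝ)) =>
    images.length = done.length ∧ ∀ y ∈ done, ∃ im ∈ images, ∀ ℓ, ∃ key, im ℓ = some key ∧
      ∀ z, z ≤ -key ↔ G.arr ℓ y.1 z ≤ y.2) (1 + dijkstraCost m (2 * n) (2 * n))
      (by simp) ?_).bind ?_
  · rintro done y rest images _ ⟨hl, hI⟩
    refine Runs.tick (((hG.back_runs hrev hlen y.1 y.2).bind (b' := 0) ?_).mono le_rfl
      fun _ h => h)
    intro B hB
    refine Runs.pure ⟨by simp [hl], ?_⟩ 0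
    intro y' hy'
    rcases List.mem_append.1 hy' with h | h
    · obtain ⟨im, him, h'⟩ := hI y' h
      exact ⟨im, List.mem_cons_of_mem _ him, h'⟩
    · obtain rfl := List.mem_singleton.1 h
      exact ⟨B.settled, List.mem_cons_self, hB⟩
  · rintro images ⟨hl, hI⟩
    have hspec : G.ImagesSpec images := fun u e he τ hτ => hI (u, τ) (hsp u e he τ hτ)
    rw [← hl]
    refine (Runs.foldlM (fun done (rows : Fin n → Option (Fin n → Array (ℝ × ℝ))) =>
      ∀ ℓ, (ℓ ∉ L ∨ ℓ ∉ done → rows ℓ = none) ∧ (ℓ ∈ L → ℓ ∈ done → ∃ row, rows ℓ = some row ∧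
        ∀ v, IsSummary (G.dist ℓ v) ε G.T (summarySize images.length N) (row v)))
      (fun v => 1 + if v ∈ L then summaryCost n m images.length N else 0) (by simp) ?_).bind
        (b' := 0) ?_ |>.mono ?_ fun _ h => h
    · intro done w rest rows hdr hrows
      have hw : w ∉ done := by
        have := List.nodup_finRange n
        rw [hdr, List.nodup_append] at this
        intro hw
        exact this.2.2 w hw w (by simp) rfl
      refine Runs.tick ?_
      by_cases hwL : w ∈ L
      · rw [if_pos hwL, if_pos hwL]
        refine ((hG.summaries_runs hs h₀ h₁ h₂ hε hN images hspec w).bind (b' := 0) ?_).mono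
          le_rfl fun _ h => h
        intro row hrow
        refine Runs.pure ?_ 0
        intro ℓ
        by_cases hℓ : ℓ = w
        · subst hℓ
          simp only [Function.update_self, List.mem_append, List.mem_singleton, or_true,
            not_true_eq_false, or_false]
          exact ⟨fun h => absurd hwL h, fun _ _ => ⟨row, rfl, hrow⟩⟩
        · rw [Function.update_of_ne hℓ]
          simpa [hℓ] using hrows ℓ
      · rw [if_neg hwL, if_neg hwL]
        refine Runs.pure ?_ 0
        intro ℓ
        by_cases hℓ : ℓ = w
        · subst hℓ
          exact ⟨fun _ => (hrows ℓ).1 (.inl hwL), fun h => absurd h hwL⟩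
        · simpa [hℓ] using hrows ℓ
    · intro rows hrows
      refine Runs.pure ?_ 0
      intro ℓ
      exact ⟨fun h => (hrows ℓ).1 (.inl h), fun h => (hrows ℓ).2 h (List.mem_finRange ℓ)⟩
    · rw [List.sum_map_add, ← Fin.sum_univ_def, ← Fin.sum_univ_def, ← Finset.sum_filter]
      simp

theorem space_le (hG : G.Regular m) {ε : ℝ} {N : ℕ} {L : Finset (Fin n)} {O : Oracle n}
    (hO : G.OracleSpec ε N L O) :
    space G O ≤ 6 * n + 2 * G.numBreakpoints + L.card * (n * (1 + 2 * N)) := by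
  have h₁ : ∑ u, ((G.out u).map (fun e => 2 + 2 * e.2.pts.size)).sum ≤
      4 * n + 2 * G.numBreakpoints := by
    have : ∀ u, ((G.out u).map (fun e => 2 + 2 * e.2.pts.size)).sum =
        2 * (G.out u).length + 2 * ((G.out u).map (fun e => e.2.pts.size)).sum := by
      intro u
      rw [List.sum_map_add, List.sum_map_mul_left]
      simp [mul_comm]
    simp only [this]
    rw [Finset.sum_add_distrib, ← Finset.mul_sum, ← Finset.mul_sum]
    have := hG.arcs_le
    unfold numBreakpoints
    omega
  have h₂ : (∑ ℓ, match O.row ℓ with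
      | none => 0
      | some row => ∑ v, (1 + 2 * (row v).size)) ≤ L.card * (n * (1 + 2 * N)) := by
    have : ∀ ℓ, (match O.row ℓ with
      | none => 0
      | some row => ∑ v, (1 + 2 * (row v).size)) ≤ if ℓ ∈ L then n * (1 + 2 * N) else 0 := by
      intro ℓ
      by_cases hℓ : ℓ ∈ L
      · obtain ⟨row, hrow, hS⟩ := (hO ℓ).2 hℓ
        rw [if_pos hℓ, hrow]
        refine (Finset.sum_le_sum fun v _ => ?_ : _ ≤ ∑ v : Fin n, (1 + 2 * N)).trans ?_
        · have := (hS v).size_le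
          omega
        · simp
      · rw [(hO ℓ).1 hℓ]
        simp
    refine (Finset.sum_le_sum fun ℓ _ => this ℓ).trans ?_
    rw [← Finset.sum_filter]
    simp
  exact (Nat.add_le_add (Nat.add_le_add_left h₁ n) (Nat.add_le_add_left h₂ n)).trans (by omega)

end Network

/-! ## Queries -/

section Growth

variable {κ : Type} [LinearOrder κ] {T : ℝ} {adj : Fin n → List (Fin n × Profile T)}
  {step : Profile T → κ → Prog κ} {halt : Fin n → Bool} {S : Fin n → Option κ}
  {H : Heap (κ × Fin n)} {B B' : Ball n κ} {o o' : List (Fin n)}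

theorem Growth.unique (h : Growth adj step halt S H B o) (h' : Growth adj step halt S H B' o') :
    B = B' := by
  induction h generalizing B' o' with
  | leaf S =>
    cases h'
    rfl
  | skip h₁ hv hB ih =>
    cases h' with
    | skip h₁' hv' hB' =>
      obtain ⟨rfl, rfl⟩ := h₁.unique h₁'
      exact ih hB'
    | halts h₁' hv' h₂' hh' => simp [hv'] at hv
    | next h₁' hv' h₂' hh' hB' => simp [hv'] at hv
  | halts h₁ hv h₂ hh =>
    cases h' with
    | skip h₁' hv' hB' => simp [hv] at hv'
    | halts h₁' hv' h₂' hh' =>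
      obtain ⟨rfl, rfl⟩ := h₁.unique h₁'
      obtain ⟨rfl, rfl⟩ := h₂.unique h₂'
      rfl
    | next h₁' hv' h₂' hh' hB' => simp [hh] at hh'
  | next h₁ hv h₂ hh hB ih =>
    cases h' with
    | skip h₁' hv' hB' => simp [hv] at hv'
    | halts h₁' hv' h₂' hh' => simp [hh] at hh'
    | next h₁' hv' h₂' hh' hB' =>
      obtain ⟨rfl, rfl⟩ := h₁.unique h₁'
      obtain ⟨rfl, rfl⟩ := h₂.unique h₂'
      exact ih hB'

theorem Growth.queue_length {f : Profile T → κ → κ} {cs : ℕ} (hc : Computes adj step f cs)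
    (h : Growth adj step halt S H B o) (L : H.Leftist) (O : H.Ordered) :
    B.queue.toList.length ≤ H.toList.length + outArcs adj o := by
  induction h with
  | leaf S => simp [Heap.toList]
  | skip h₁ hv hB ih =>
    obtain ⟨-, L₁, O₁, P₁⟩ := (Heap.merge_runs _ _ L.2.2.1 L.2.2.2 O.2.1 O.2.2).post h₁
    have := ih L₁ O₁
    rw [P₁.length_eq] at this
    simp only [Heap.toList, List.length_cons]
    omega
  | @halts _ _ key v _ _ H₁ _ _ _ h₁ hv h₂ hh =>
    obtain ⟨-, L₁, O₁, P₁⟩ := (Heap.merge_runs _ _ L.2.2.1 L.2.2.2 O.2.1 O.2.2).post h₁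
    obtain ⟨-, L₂, O₂, P₂⟩ := (relax_runs hc v key H₁ _ L₁ O₁ le_rfl).post h₂
    simp only [P₂.length_eq, List.length_append, P₁.length_eq, Heap.toList, List.length_cons,
      List.length_map, outArcs, List.map_cons, List.map_nil, List.sum_cons, List.sum_nil]
    omega
  | @next _ _ key v _ _ H₁ _ _ _ _ _ h₁ hv h₂ hh hB ih =>
    obtain ⟨-, L₁, O₁, P₁⟩ := (Heap.merge_runs _ _ L.2.2.1 L.2.2.2 O.2.1 O.2.2).post h₁
    obtain ⟨-, L₂, O₂, P₂⟩ := (relax_runs hc v key H₁ _ L₁ O₁ le_rfl).post h₂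
    have := ih L₂ O₂
    simp only [P₂.length_eq, List.length_append, P₁.length_eq, List.length_map] at this
    simp only [Heap.toList, List.length_cons, outArcs, List.map_cons, List.sum_cons,
      List.length_append] at this ⊢
    omega

end Growth

namespace Network

variable {G : Network n} {m : ℕ}

/-! ### Balls -/

/-- The vertices that end the growth of a ball. -/
def haltAt (d : Fin n) (L : Finset (Fin n)) (v : Fin n) : Bool := decide (v = d ∨ v ∈ L)

/-- The ball around `(w, t)` for the destination `d` and the landmarks `L`. -/
def IsBall (G : Network n) (d : Fin n) (L : Finset (Fin n)) (w : Fin n) (t : ℝ) (B : Ball n ℝ)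
    (o : List (Fin n)) : Prop :=
  Growth G.out stepTime (haltAt d L) (fun _ => none) (.node 1 (t, w) .leaf .leaf) B o

theorem Regular.outArcs_le (hG : G.Regular m) (o : List (Fin n)) :
    outArcs G.out o ≤ 2 * o.length := by
  unfold outArcs
  induction o with
  | nil => simp
  | cons u o ih =>
    have := hG.degree u
    simp only [List.map_cons, List.sum_cons, List.length_cons]
    omega

/-- The cost of a ball of `s` vertices. -/
def growCost (n m s : ℕ) : ℕ := dijkstraCost m (2 * n) (2 * s)

theorem Regular.ball_ret (hG : G.Regular m) (d : Fin n) (L : Finset (Fin n)) (w : Fin n)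
    (t : ℝ) :
    ∃ B k o, Ret (dijkstra G.out stepTime (haltAt d L) w t) B k ∧ G.IsBall d L w t B o ∧
      BallSpec G.out (fun P t => t + P.delay t) (haltAt d L) w t B ∧
      k ≤ growCost n m o.length ∧ B.queue.toList.length ≤ 1 + 2 * o.length := by
  obtain ⟨B, k, o, h₁, h₂, h₃, h₄⟩ := dijkstra_ret hG.computes_time
    (fun _ e _ k => lt_arc G.T_pos e.2 k) (haltAt d L) w t hG.arcs_le
  refine ⟨B, k, o, h₁, h₂, h₃, h₄.trans ?_, ?_⟩
  · have := hG.outArcs_le o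
    unfold growCost dijkstraCost
    gcongr
  · have := h₂.queue_length hG.computes_time (by simp [Heap.Leftist, Heap.rank])
      (by simp [Heap.Ordered, Heap.toList])
    have := hG.outArcs_le o
    simp only [Heap.toList, List.append_nil, List.length_cons, List.length_nil] at *
    omega

section BallFacts

variable {halt : Fin n → Bool} {w : Fin n} {t : ℝ} {B : Ball n ℝ}

/-- A path either stays among settled vertices or leaves the ball through the queue. -/
theorem BallSpec.path_cases (hB : BallSpec G.out (fun P t => t + P.delay t) halt w t B)
    (hG : G.Regular m) {v : Fin n} (p : List (Fin n × Profile G.T)) {u : Fin n} {k s : ℝ}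
    (hu : B.settled u = some k) (hks : k ≤ s) (hp : G.IsPath u p v) :
    (∃ k', B.settled v = some k' ∧ k' ≤ G.pathArr p s) ∨
      ∃ y ∈ B.queue.toList, B.settled y.2 = none ∧ G.arr y.2 v y.1 ≤ G.pathArr p s := by
  induction p generalizing u k s with
  | nil =>
    obtain rfl : u = v := hp
    exact .inl ⟨k, hu, hks⟩
  | cons e p ih =>
    have hle : k + e.2.delay k ≤ s + e.2.delay s := hG.arc_mono hp.1 hks
    rcases hB.inv.relaxed u k hu e hp.1 with ⟨k', h₁, h₂⟩ | h
    · exact ih h₁ (h₂.trans hle) hp.2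
    · cases hs : B.settled e.1 with
      | some k' => exact ih hs ((hB.inv.le e.1 k' hs _ h).trans hle) hp.2
      | none =>
        refine .inr ⟨_, h, hs, ?_⟩
        exact (arr_le hp.2 _).trans (hG.pathArr_mono hp.2 hle)

theorem BallSpec.arr_le_key (hB : BallSpec G.out (fun P t => t + P.delay t) halt w t B)
    (hG : G.Regular m) : ∀ v k, B.settled v = some k → G.arr w v t ≤ k := by
  refine hB.inv.tree_induction (fun _ e _ k => lt_arc G.T_pos e.2 k) _ (hG.arr_self w t).le ?_
  intro u k _ hk e he _
  exact (hG.arr_arc w he t).trans (hG.arc_mono he hk)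

theorem BallSpec.arr_le_queue (hB : BallSpec G.out (fun P t => t + P.delay t) halt w t B)
    (hG : G.Regular m) : ∀ y ∈ B.queue.toList, G.arr w y.2 t ≤ y.1 := by
  intro y hy
  rcases hB.inv.queue y hy with ⟨h₁, h₂⟩ | ⟨u, ku, e, h₁, h₂, h₃, h₄⟩
  · rw [h₁, h₂, hG.arr_self]
  · rw [← h₃, ← h₄]
    exact (hG.arr_arc w h₂ t).trans (hG.arc_mono h₂ (BallSpec.arr_le_key hB hG u ku h₁))

/-- Settled keys are exact because every path that leaves the ball passes through a queue entry, and
those are no smaller. If `v` is not settled, an optimal path supplies an unsettled entry from which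
`v` is still reached in time: the vertex that the recursion has to guess. -/
theorem BallSpec.arr_cases (hB : BallSpec G.out (fun P t => t + P.delay t) halt w t B)
    (hG : G.Regular m) (v : Fin n) :
    B.settled v = some (G.arr w v t) ∨ (B.settled v = none ∧
      ∃ y ∈ B.queue.toList, B.settled y.2 = none ∧ G.arr y.2 v y.1 ≤ G.arr w v t) := by
  obtain ⟨p, hp, hpt⟩ := hG.exists_path w v t
  have hcase : (∃ k', B.settled v = some k' ∧ k' ≤ G.arr w v t) ∨
      ∃ y ∈ B.queue.toList, B.settled y.2 = none ∧ G.arr y.2 v y.1 ≤ G.arr w v t := by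
    rcases hB.inv.source with ⟨k, hk, hkt⟩ | h
    · rw [← hpt]
      exact BallSpec.path_cases hB hG p hk hkt hp
    · cases hs : B.settled w with
      | some k =>
        rw [← hpt]
        exact BallSpec.path_cases hB hG p hs (hB.inv.le w k hs _ h) hp
      | none => exact .inr ⟨_, h, hs, le_rfl⟩
  have hset : ∀ k, B.settled v = some k → k ≤ G.arr w v t := by
    intro k hk
    rcases hcase with ⟨k', hk', hle⟩ | ⟨y, hy, -, hle⟩
    · rw [hk] at hk'
      obtain rfl := Option.some.inj hk'
      exact hle
    · exact ((hB.inv.le v k hk y hy).trans (hG.le_arr _ _ _)).trans hle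
  cases hs : B.settled v with
  | some k =>
    rw [le_antisymm (hset k hs) (BallSpec.arr_le_key hB hG v k hs)]
    exact .inl rfl
  | none =>
    refine .inr ⟨rfl, ?_⟩
    rcases hcase with ⟨k', hk', -⟩ | h
    · rw [hs] at hk'
      simp at hk'
    · exact h

end BallFacts

/-- The candidate through a landmark at distance `R`. -/
theorem Regular.landmark_le (hG : G.Regular m) {lmin lmax ε ζ : ℝ}
    (hs : G.BoundedSlopes lmin lmax) (h₂ : 0 ≤ lmax) (hε : 0 < ε) (hζ : 1 ≤ ζ)
    (ho : G.BoundedOpposite ζ) (w ℓ d : Fin n) (t : ℝ) :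
    G.arr w ℓ t + (1 + ε) * G.dist ℓ d (G.arr w ℓ t) ≤
      t + (1 + ε) * G.dist w d t + psi ε ζ lmax * G.dist w ℓ t := by
  obtain ⟨x, hx⟩ : ∃ x, x = G.arr w ℓ t := ⟨_, rfl⟩
  obtain ⟨R, hR⟩ : ∃ R, R = G.dist w ℓ t := ⟨_, rfl⟩
  obtain ⟨a, ha⟩ : ∃ a, a = G.dist ℓ w x := ⟨_, rfl⟩
  have hxR : x = t + R := by rw [hx, hR]; unfold dist; ring
  have hR₀ : 0 ≤ R := hR ▸ hG.dist_nonneg _ _ _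
  have ha₀ : 0 ≤ a := ha ▸ hG.dist_nonneg _ _ _
  -- The way back from the landmark is compared with the way out at the same departure time `t + R`,
  -- and that with the way out at time `t`.
  have h1 : a ≤ ζ * (1 + lmax) * R := by
    have e₁ := BoundedOpposite.dist_le hG ho ℓ w x
    have e₂ := (hs.dist_sub w ℓ (show t ≤ x by linarith)).2
    rw [← ha] at e₁
    rw [← hR, hxR] at e₂
    rw [hxR] at e₁
    have e₃ : G.dist w ℓ (t + R) ≤ (1 + lmax) * R := by linarith
    have := mul_le_mul_of_nonneg_left e₃ (by linarith : 0 ≤ ζ)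
    linarith
  -- A trip from `ℓ` may return to `w` and then follow the original trip, which starts late by `R +
  -- a`.
  have h3 : G.dist ℓ d x ≤ a + G.dist w d t + lmax * (R + a) := by
    have e₁ := hG.arr_triangle ℓ w d x
    have e₂ : G.arr ℓ w x = x + a := by rw [ha]; unfold dist; ring
    have e₃ := (hs.dist_sub w d (show t ≤ x + a by linarith)).2
    rw [e₂] at e₁
    have e₄ : x + a - t = R + a := by linarith
    rw [e₄] at e₃
    have e₅ : G.dist ℓ d x = G.arr ℓ d x - x := rfl
    have e₆ : G.dist w d (x + a) = G.arr w d (x + a) - (x + a) := rfl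
    linarith
  rw [← hx, ← hR]
  have h4 : G.dist ℓ d x ≤ G.dist w d t + (ζ * (1 + lmax) * (1 + lmax) + lmax) * R := by
    have := mul_le_mul_of_nonneg_right h1 (by linarith : 0 ≤ 1 + lmax)
    linarith
  have h5 := mul_le_mul_of_nonneg_left h4 (by linarith : 0 ≤ 1 + ε)
  unfold psi
  linarith

/-- The cost of one step of a query, with a ball of `s` vertices. -/
def ballCost (n m N s : ℕ) : ℕ := growCost n m s + N + 2 * s + 5

/-- What `ballQuery` returns. -/
structure IsBallAnswer (G : Network n) (ε ψ : ℝ) (d : Fin n) (L : Finset (Fin n)) (w : Fin n)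
    (t : ℝ) (B : Ball n ℝ) (b : ℝ × List (ℝ × Fin n)) : Prop where
  sound : G.arr w d t ≤ b.1
  sound' : ∀ y ∈ b.2, G.arr w d t ≤ G.arr y.2 d y.1
  close : b.1 ≤ t + (1 + ε) * G.dist w d t ∨ ∃ R, 0 ≤ R ∧ R ≤ G.dist w d t ∧
    b.1 ≤ t + (1 + ε) * G.dist w d t + ψ * R ∧
      ∃ y ∈ b.2, G.arr y.2 d y.1 = G.arr w d t ∧ t + R ≤ y.1
  fringe : ∀ y ∈ b.2, ∃ ℓ ∈ L, ∃ x, B.last = some (ℓ, x) ∧ y ∈ B.queue.toList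

theorem Regular.ballQuery_ret (hG : G.Regular m) {lmin lmax ε ζ : ℝ} {N : ℕ}
    (hs : G.BoundedSlopes lmin lmax) (h₂ : 0 ≤ lmax) (hε : 0 < ε) (hζ : 1 ≤ ζ)
    (ho : G.BoundedOpposite ζ) {L : Finset (Fin n)} {O : Oracle n} (hO : G.OracleSpec ε N L O)
    (d w : Fin n) (t : ℝ) :
    ∃ B o, G.IsBall d L w t B o ∧ Runs (ballQuery G O d w t) (ballCost n m N o.length)
      (fun b => G.IsBallAnswer ε (psi ε ζ lmax) d L w t B b ∧ b.2.length ≤ 1 + 2 * o.length) := by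
  obtain ⟨B, k, o, hret, hball, hB, hk, hq⟩ := hG.ball_ret d L w t
  refine ⟨B, o, hball, ?_⟩
  have hhalt : (fun v => decide (v = d) || (O.row v).isSome) = haltAt d L := by
    funext v
    unfold haltAt
    by_cases hv : v ∈ L
    · obtain ⟨row, hrow, -⟩ := (hO v).2 hv
      simp [hrow, hv]
    · simp [(hO v).1 hv, hv]
  have hdist₀ := hG.dist_nonneg w d t
  have hD : ∀ ℓ, ∀ s (k : ℤ), G.dist ℓ d (s + k * G.T) = G.dist ℓ d s :=
    fun ℓ s k => hG.dist_add_period ℓ d s k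
  unfold ballQuery
  by_cases hw : w ∈ L
  · obtain ⟨row, hrow, hS⟩ := (hO w).2 hw
    simp only [hrow]
    refine (Runs.tick (((hS d).lookup_runs G.T_pos (hD w) t).bind (b' := 0) fun y hy =>
      Runs.pure ?_ 0)).mono (by unfold ballCost; omega) fun _ h => h
    refine ⟨⟨?_, by simp, .inl ?_, by simp⟩, by simp⟩
    · have := hy.1
      unfold dist at this
      simp only
      linarith
    · have := hy.2
      simp only
      linarith
  · simp only [(hO w).1 hw, hhalt]
    refine (Runs.tick (Runs.bind_ret hret (b := N + 2 * o.length + 4) ?_)).mono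
      (by unfold ballCost; omega) fun _ h => h
    rcases BallSpec.arr_cases hB hG d with hd | ⟨hd, y, hy, hyn, hyd⟩
    · simp only [hd]
      refine Runs.pure ⟨⟨le_rfl, by simp, .inl ?_, by simp⟩, by simp⟩ _
      have := mul_nonneg hε.le hdist₀
      unfold dist at this ⊢
      simp only
      linarith
    · cases hl : B.last with
      | none =>
        -- A growth that never halts exhausts its queue, but `y` is in it; hence this diverging
        -- branch is not reached.
        rw [hball.last_none hl] at hy
        simp [Heap.toList] at hy
      | some p =>
        obtain ⟨ℓ, x⟩ := p
        obtain ⟨hℓ, hh, -, hx⟩ := hB.last ℓ x hl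
        have hℓL : ℓ ∈ L := by
          have : ℓ = d ∨ ℓ ∈ L := by simpa [haltAt] using hh
          rcases this with rfl | h
          · rw [hd] at hℓ
            simp at hℓ
          · exact h
        obtain ⟨row, hrow, hS⟩ := (hO ℓ).2 hℓL
        have hxa : x = G.arr w ℓ t := by
          rcases BallSpec.arr_cases hB hG ℓ with h | ⟨h, -⟩ <;> rw [hℓ] at h
          · exact Option.some.inj h
          · simp at h
        simp only [hd, hrow]
        refine (((hS d).lookup_runs G.T_pos (hD ℓ) x).bind (b' := 1 + B.queue.toList.length)
          fun z hz => Runs.tick_pure ?_ le_rfl).mono (by omega) fun _ h => h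
        have hsound : ∀ y ∈ B.queue.toList, G.arr w d t ≤ G.arr y.2 d y.1 := fun y hy =>
          (hG.arr_triangle w y.2 d t).trans (hG.arr_mono _ _ (BallSpec.arr_le_queue hB hG y hy))
        refine ⟨⟨?_, ?_, .inr ⟨G.dist w ℓ t, hG.dist_nonneg _ _ _, ?_, ?_, y, ?_, ?_, ?_⟩, ?_⟩,
          ?_⟩
        · have h₁ := hG.arr_triangle w ℓ d t
          rw [← hxa] at h₁
          have h₃ := hz.1
          have : G.dist ℓ d x = G.arr ℓ d x - x := rfl
          simp only
          linarith
        · intro y hy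
          exact hsound y (List.mem_filter.1 hy).1
        -- The landmark is settled no later than any queue entry, and `y` lies on an optimal trip to
        -- `d`, so `R` is at most the travel time.
        · have h₁ := hx y hy
          have h₃ := hG.le_arr y.2 d y.1
          unfold dist
          rw [← hxa]
          linarith
        · have h₁ := hG.landmark_le hs h₂ hε hζ ho w ℓ d t
          rw [← hxa] at h₁
          have h₃ := hz.2
          simp only
          linarith
        · rw [List.mem_filter]
          exact ⟨hy, by simp [hyn]⟩
        · exact le_antisymm hyd (hsound y hy)
        · have h₁ := hx y hy
          unfold dist
          rw [← hxa]
          linarith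
        · intro y hy
          exact ⟨ℓ, hℓL, x, hl, (List.mem_filter.1 hy).1⟩
        · exact (List.length_filter_le _ _).trans hq

end Network

/-! ### The approximation guarantee -/

section Constants

variable {ε ζ lmax : ℝ}

theorem psi_pos (hε : 0 < ε) (hζ : 1 ≤ ζ) (hmax : 0 ≤ lmax) : 0 < psi ε ζ lmax := by
  unfold psi
  have hζ₀ : 0 ≤ ζ := by linarith
  positivity

theorem one_lt_growth (hε : 0 < ε) (hζ : 1 ≤ ζ) (hmax : 0 ≤ lmax) (r : ℕ) :
    1 < (1 + ε / psi ε ζ lmax) ^ (r + 1) :=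
  one_lt_pow₀ (by linarith [div_pos hε (psi_pos hε hζ hmax)]) (Nat.succ_ne_zero r)

theorem one_lt_gam (hε : 0 < ε) (hζ : 1 ≤ ζ) (hmax : 0 ≤ lmax) (r : ℕ) :
    1 < gam ε ζ lmax r := by
  unfold gam
  have h := one_lt_growth hε hζ hmax r
  rw [one_lt_div (by linarith)]
  linarith

/-- Without recursion the candidate exceeds the optimum by at most εD + ψR with R ≤ D, so the excess
factor is ε + ψ. -/
theorem gam_zero (hε : 0 < ε) (hζ : 1 ≤ ζ) (hmax : 0 ≤ lmax) :
    ε * gam ε ζ lmax 0 = ε + psi ε ζ lmax := by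
  have hψ := psi_pos hε hζ hmax
  unfold gam
  rw [zero_add, pow_one, add_sub_cancel_left]
  field_simp
  ring

/-- Either the candidate through the landmark is good, or the ball is large. -/
theorem gam_succ (hε : 0 < ε) (hζ : 1 ≤ ζ) (hmax : 0 ≤ lmax) (r : ℕ) {D R : ℝ} :
    ε * D + psi ε ζ lmax * R ≤ ε * gam ε ζ lmax (r + 1) * D ∨
      ε * gam ε ζ lmax r * (D - R) ≤ ε * gam ε ζ lmax (r + 1) * D := by
  have hψ := psi_pos hε hζ hmax
  rw [or_iff_not_imp_left, not_le]
  intro h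
  obtain ⟨q, hq⟩ : ∃ q, q = 1 + ε / psi ε ζ lmax := ⟨_, rfl⟩
  obtain ⟨Q, hQ⟩ : ∃ Q, Q = q ^ (r + 1) := ⟨_, rfl⟩
  have hQ₁ : 1 < Q := by
    rw [hQ, hq]
    exact one_lt_growth hε hζ hmax r
  have hq₁ : 1 < q := by
    rw [hq]
    linarith [div_pos hε hψ]
  have hqQ : 1 < q * Q := by nlinarith
  have hε' : ε = (q - 1) * psi ε ζ lmax := by
    rw [hq]
    field_simp
    ring
  have e₁ : gam ε ζ lmax r = Q / (Q - 1) := by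
    unfold gam
    rw [← hq, ← hQ]
  have e₂ : gam ε ζ lmax (r + 1) = q * Q / (q * Q - 1) := by
    unfold gam
    rw [← hq, pow_succ, ← hQ, mul_comm Q q]
  rw [e₁, e₂]
  rw [e₂] at h
  have hd₁ : 0 < Q - 1 := by linarith
  have hd₂ : 0 < q * Q - 1 := by linarith
  -- If the landmark candidate is too long, then R is at least the fraction (q-1)/(qQ-1) of D. At
  -- this threshold the inequality for the recursive answer becomes an equality.
  have hR : (q - 1) * D ≤ R * (q * Q - 1) := by
    have h₁ : ε * (q * Q / (q * Q - 1)) * D = ε * D + ε * D / (q * Q - 1) := by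
      field_simp
      ring
    rw [h₁] at h
    have h₂ : ε * D / (q * Q - 1) < psi ε ζ lmax * R := by linarith
    rw [div_lt_iff₀ hd₂] at h₂
    have h₃ : psi ε ζ lmax * ((q - 1) * D) < psi ε ζ lmax * (R * (q * Q - 1)) := by
      have : ε * D = psi ε ζ lmax * ((q - 1) * D) := by
        conv_lhs => rw [hε']
        ring
      linarith
    exact (lt_of_mul_lt_mul_left h₃ hψ.le).le
  have h₄ : Q / (Q - 1) * (D - R) ≤ q * Q / (q * Q - 1) * D := by
    rw [div_mul_eq_mul_div, div_mul_eq_mul_div, div_le_div_iff₀ hd₁ hd₂]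
    have := mul_le_mul_of_nonneg_left hR (by linarith : 0 ≤ Q)
    linarith
  have := mul_le_mul_of_nonneg_left h₄ hε.le
  linarith

end Constants

namespace Network

variable {G : Network n} {m : ℕ}

/-- The queue of the ball around `(w, t)` that is stopped by `d` or `ℓ`. -/
def fringe (G : Network n) (d w : Fin n) (t : ℝ) (ℓ : Fin n) : List (ℝ × Fin n) :=
  ((dijkstra G.out stepTime (haltAt d {ℓ}) w t).run 0).elim [] (fun B => B.1.queue.toList)

/-- All centers of balls that a query with budget `r` may visit. -/
def centers (G : Network n) (d : Fin n) : ℕ → Fin n → ℝ → List (ℝ × Fin n)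
  | 0, w, t => [(t, w)]
  | r + 1, w, t => (t, w) :: (List.finRange n).flatMap
      (fun ℓ => (G.fringe d w t ℓ).flatMap (fun y => centers G d r y.2 y.1))

/-- The balls around `(w, t)` have at most `s` vertices. -/
def SmallBall (G : Network n) (d : Fin n) (L : Finset (Fin n)) (s : ℕ) (w : Fin n) (t : ℝ) :
    Prop := ∀ B o, G.IsBall d L w t B o → o.length ≤ s

theorem Regular.fringe_length (hG : G.Regular m) (d w : Fin n) (t : ℝ) (ℓ : Fin n) :
    (G.fringe d w t ℓ).length ≤ 2 * n + 1 := by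
  obtain ⟨B, k, o, hret, hball, -, -, hq⟩ := hG.ball_ret d {ℓ} w t
  have : G.fringe d w t ℓ = B.queue.toList := by
    unfold fringe
    rw [hret 0]
    rfl
  rw [this]
  have := nodup_length_le o hball.nodup.1
  omega

/-- Only a bound polynomial in `n` matters: the union bound over the centers competes with an
exponentially small probability. -/
theorem Regular.centers_length (hG : G.Regular m) (d : Fin n) (r : ℕ) (w : Fin n) (t : ℝ) :
    (G.centers d r w t).length ≤ (n * (2 * n + 1) + 1) ^ r := by
  induction r generalizing w t with
  | zero => simp [centers]
  | succ r ih =>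
    have hin : ∀ ℓ, ((G.fringe d w t ℓ).flatMap (fun y => G.centers d r y.2 y.1)).length ≤
        (2 * n + 1) * (n * (2 * n + 1) + 1) ^ r := by
      intro ℓ
      rw [List.length_flatMap]
      refine (List.sum_le_card_nsmul _ ((n * (2 * n + 1) + 1) ^ r) ?_).trans ?_
      · intro x hx
        obtain ⟨y, -, rfl⟩ := List.mem_map.1 hx
        exact ih _ _
      · rw [List.length_map, smul_eq_mul]
        exact Nat.mul_le_mul_right _ (hG.fringe_length d w t ℓ)
    have hout : ((List.finRange n).flatMap (fun ℓ =>
        (G.fringe d w t ℓ).flatMap (fun y => G.centers d r y.2 y.1))).length ≤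
        n * ((2 * n + 1) * (n * (2 * n + 1) + 1) ^ r) := by
      rw [List.length_flatMap]
      refine (List.sum_le_card_nsmul _ ((2 * n + 1) * (n * (2 * n + 1) + 1) ^ r) ?_).trans ?_
      · intro x hx
        obtain ⟨ℓ, -, rfl⟩ := List.mem_map.1 hx
        exact hin ℓ
      · simp
    rw [centers, List.length_cons, pow_succ]
    have h1 : 1 ≤ (n * (2 * n + 1) + 1) ^ r := Nat.one_le_pow _ _ (by omega)
    have : (n * (2 * n + 1) + 1) ^ r * (n * (2 * n + 1) + 1) =
        n * ((2 * n + 1) * (n * (2 * n + 1) + 1) ^ r) + (n * (2 * n + 1) + 1) ^ r := by ring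
    omega

/-- Landmarks other than `ℓ` did not stop this ball, so it grows identically when `ℓ` is the only
landmark. This removes the dependence of the centers on the random set. -/
theorem IsBall.mem_fringe (hG : G.Regular m) {d w : Fin n} {t : ℝ} {L : Finset (Fin n)}
    {B : Ball n ℝ} {o : List (Fin n)} (h : G.IsBall d L w t B o) {ℓ : Fin n} (hℓ : ℓ ∈ L) {x : ℝ}
    (hl : B.last = some (ℓ, x)) {y : ℝ × Fin n} (hy : y ∈ B.queue.toList) :
    y ∈ G.fringe d w t ℓ := by
  have h' : G.IsBall d {ℓ} w t B o := by
    refine Growth.change_halt h ?_ hl ?_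
    · intro v hv
      have : v = d ∨ v = ℓ := by simpa [haltAt] using hv
      rcases this with rfl | rfl <;> simp [haltAt, hℓ]
    · simp [haltAt]
  obtain ⟨B', k, o', hret, hball, -⟩ := hG.ball_ret d {ℓ} w t
  obtain rfl := Growth.unique h' hball
  unfold fringe
  rw [hret 0]
  exact hy

theorem centers_subset {d w : Fin n} {t : ℝ} {ℓ : Fin n} {y : ℝ × Fin n}
    (hy : y ∈ G.fringe d w t ℓ) (r : ℕ) : G.centers d r y.2 y.1 ⊆ G.centers d (r + 1) w t := by
  intro z hz
  rw [centers]
  refine List.mem_cons_of_mem _ (List.mem_flatMap.2 ⟨ℓ, List.mem_finRange ℓ, ?_⟩)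
  exact List.mem_flatMap.2 ⟨y, hy, hz⟩

theorem self_mem_centers (G : Network n) (d : Fin n) (r : ℕ) (w : Fin n) (t : ℝ) :
    (t, w) ∈ G.centers d r w t := by
  cases r <;> simp [centers]

/-- The cost of a query with budget `r` all of whose balls have at most `s` vertices. -/
def rqaCost (n m N s : ℕ) : ℕ → ℕ
  | 0 => ballCost n m N s
  | r + 1 => ballCost n m N s + (1 + 2 * s) * (1 + rqaCost n m N s r)

theorem ballCost_mono (n m N : ℕ) {s s' : ℕ} (h : s ≤ s') : ballCost n m N s ≤ ballCost n m N s' := by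
  unfold ballCost growCost dijkstraCost
  gcongr

/-- The size hypothesis is placed on all potential centers, so that it passes to the recursive
calls. Since the entry on an optimal trip is among those tried, its recursive guarantee applies to
the remaining travel time. -/
theorem Regular.rqa_runs (hG : G.Regular m) {lmin lmax ε ζ : ℝ} {N : ℕ}
    (hs : G.BoundedSlopes lmin lmax) (h₂ : 0 ≤ lmax) (hε : 0 < ε) (hζ : 1 ≤ ζ)
    (ho : G.BoundedOpposite ζ) {L : Finset (Fin n)} {O : Oracle n} (hO : G.OracleSpec ε N L O)
    (d : Fin n) (s r : ℕ) (w : Fin n) (t : ℝ)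
    (hsmall : ∀ y ∈ G.centers d r w t, G.SmallBall d L s y.2 y.1) :
    Runs (rqa G O d r w t) (rqaCost n m N s r) (fun τ =>
      G.arr w d t ≤ τ ∧ τ ≤ G.arr w d t + ε * gam ε ζ lmax r * G.dist w d t) := by
  have hψ := psi_pos hε hζ h₂
  induction r generalizing w t with
  | zero =>
    obtain ⟨B, o, hball, hb⟩ := hG.ballQuery_ret hs h₂ hε hζ ho hO d w t
    have hlen := hsmall _ (G.self_mem_centers d 0 w t) B o hball
    have hD := hG.dist_nonneg w d t
    rw [rqa]
    refine (hb.bind (b' := 0) fun b hb => Runs.pure ⟨hb.1.sound, ?_⟩ 0).mono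
      (ballCost_mono n m N hlen) fun _ h => h
    rw [gam_zero hε hζ h₂]
    have e : G.arr w d t = t + G.dist w d t := by unfold dist; ring
    rw [e]
    rcases hb.1.close with h | ⟨R, h₀, h₁, h, -⟩
    · have := mul_nonneg hψ.le hD
      linarith
    · have := mul_le_mul_of_nonneg_left h₁ hψ.le
      linarith
  | succ r ih =>
    obtain ⟨B, o, hball, hb⟩ := hG.ballQuery_ret hs h₂ hε hζ ho hO d w t
    have hlen := hsmall _ (G.self_mem_centers d (r + 1) w t) B o hball
    have hD := hG.dist_nonneg w d t
    have hgam := one_lt_gam hε hζ h₂ (r + 1)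
    have e : G.arr w d t = t + G.dist w d t := by unfold dist; ring
    rw [rqa]
    refine (hb.bind (b' := (1 + 2 * s) * (1 + rqaCost n m N s r)) ?_).mono
      (Nat.add_le_add_right (ballCost_mono n m N hlen) _) fun _ h => h
    rintro b ⟨hb, hbl⟩
    refine (Runs.foldlM_le (fun done (best : ℝ) => best ≤ b.1 ∧ G.arr w d t ≤ best ∧
      ∀ y ∈ done, best ≤ G.arr y.2 d y.1 + ε * gam ε ζ lmax r * G.dist y.2 d y.1)
      (1 + rqaCost n m N s r) ⟨le_rfl, hb.sound, by simp⟩ ?_).mono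
      (Nat.mul_le_mul_right _ (by omega)) ?_
    · rintro done y rest best hdr ⟨i₁, i₂, i₃⟩
      have hy : y ∈ b.2 := by rw [hdr]; simp
      obtain ⟨ℓ, hℓ, x, hl, hyq⟩ := hb.fringe y hy
      have hyf := hball.mem_fringe hG hℓ hl hyq
      refine Runs.tick (((ih y.2 y.1 fun z hz => hsmall z (centers_subset hyf r hz)).bind
        (b' := 0) fun τ hτ => Runs.pure ⟨?_, ?_, ?_⟩ 0).mono le_rfl fun _ h => h)
      · exact (min_le_left _ _).trans i₁
      · exact le_min i₂ ((hb.sound' y hy).trans hτ.1)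
      · intro z hz
        rcases List.mem_append.1 hz with h | h
        · exact (min_le_left _ _).trans (i₃ z h)
        · rw [List.mem_singleton.1 h]
          exact (min_le_right _ _).trans hτ.2
    · rintro best ⟨i₁, i₂, i₃⟩
      refine ⟨i₂, ?_⟩
      rcases hb.close with h | ⟨R, h₀, h₁, h, y, hy, hyd, hyR⟩
      · have : ε * G.dist w d t ≤ ε * gam ε ζ lmax (r + 1) * G.dist w d t := by
          rw [mul_assoc]
          refine mul_le_mul_of_nonneg_left ?_ hε.le
          nlinarith
        rw [e]
        linarith
      -- Either the candidate of this ball is already good enough, or the remaining trip from `y` is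
      -- short enough for the recursive guarantee.
      · rcases gam_succ hε hζ h₂ r (D := G.dist w d t) (R := R) with hg | hg
        · rw [e]
          linarith
        · have h₃ := i₃ y hy
          rw [hyd] at h₃
          have h₄ : G.dist y.2 d y.1 ≤ G.dist w d t - R := by
            have e' : G.dist y.2 d y.1 = G.arr y.2 d y.1 - y.1 := rfl
            rw [e', hyd, e]
            linarith
          have h₅ := mul_le_mul_of_nonneg_left h₄
            (mul_nonneg hε.le (zero_le_one.trans (one_lt_gam hε hζ h₂ r).le))
          linarith

theorem Regular.query_runs (hG : G.Regular m) {lmin lmax ε ζ : ℝ} {N : ℕ}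
    (hs : G.BoundedSlopes lmin lmax) (h₂ : 0 ≤ lmax) (hε : 0 < ε) (hζ : 1 ≤ ζ)
    (ho : G.BoundedOpposite ζ) {L : Finset (Fin n)} {O : Oracle n} (hO : G.OracleSpec ε N L O)
    (o d : Fin n) (s r : ℕ) (t : ℝ)
    (hsmall : ∀ y ∈ G.centers d r o t, G.SmallBall d L s y.2 y.1) :
    Runs (query G O r o d t) (rqaCost n m N s r + 1) (fun A =>
      G.dist o d t ≤ A ∧ A ≤ (1 + gam ε ζ lmax r * ε) * G.dist o d t) := by
  unfold query
  refine (hG.rqa_runs hs h₂ hε hζ ho hO d s r o t hsmall).bind fun τ hτ =>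
    Runs.tick_pure ⟨?_, ?_⟩ le_rfl
  · have e : G.dist o d t = G.arr o d t - t := rfl
    linarith [hτ.1]
  · have e : G.dist o d t = G.arr o d t - t := rfl
    linarith [hτ.2]

/-! ### Sizes of balls -/

/-- With `s = n` the size hypothesis is free, which gives termination, correctness and a worst-case
cost for every landmark set. -/
theorem smallBall_card (G : Network n) (d : Fin n) (L : Finset (Fin n)) (w : Fin n) (t : ℝ) :
    G.SmallBall d L n w t := fun _ o h => nodup_length_le o h.nodup.1

/-- A ball with more than `s` vertices contains no landmark among the first `s` vertices around
its center. -/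
theorem Regular.exists_core (hG : G.Regular m) (d : Fin n) (s : ℕ) (w : Fin n) (t : ℝ) :
    (∀ L, G.SmallBall d L s w t) ∨ ∃ F : Finset (Fin n), F.card = s ∧
      ∀ L, ¬ G.SmallBall d L s w t → Disjoint F L := by
  -- The growth without landmarks fixes one order of settlement, of which every other growth from
  -- this center follows a prefix.
  obtain ⟨B', k, o', -, hball', -⟩ := hG.ball_ret d ∅ w t
  have hpre : ∀ L B o, G.IsBall d L w t B o → o <+: o' := by
    intro L B o hball
    refine Growth.prefix hball hball' ?_
    intro v hv
    have : v = d := by simpa [haltAt] using hv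
    simp [haltAt, this]
  rcases Nat.lt_or_ge s o'.length with h | h
  · right
    refine ⟨(o'.take s).toFinset, ?_, ?_⟩
    · rw [List.toFinset_card_of_nodup (hball'.nodup.1.sublist (List.take_sublist _ _)),
        List.length_take]
      omega
    · intro L hL
      unfold SmallBall at hL
      push Not at hL
      obtain ⟨B, o, hball, hlen⟩ := hL
      have htake : o'.take s = o.take s := by
        obtain ⟨r, rfl⟩ := hpre L B o hball
        rw [List.take_append_of_le_length hlen.le]
      rw [Finset.disjoint_left]
      intro v hv hvL
      rw [List.mem_toFinset, htake] at hv
      -- More than `s` vertices are settled, so the first `s` all precede the last one and none of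
      -- them halts.
      have hv' : v ∈ o.dropLast := by
        rw [List.dropLast_eq_take]
        exact List.take_subset_take_left _ (by omega) hv
      have := hball.not_halt v hv'
      simp [haltAt, hvL] at this
  · exact .inl fun L B o hball => (hpre L B o hball).length_le.trans h

end Network

/-! ## Random landmarks -/

section Expectation

variable {ρ : ℝ}

theorem expect_const (ρ b : ℝ) : expect (n := n) ρ (fun _ => b) = b := by
  unfold expect
  rw [← Finset.sum_mul]
  have := Fintype.sum_pow_mul_eq_add_pow (Fin n) ρ (1 - ρ)
  rw [Fintype.card_fin] at this
  rw [this]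
  simp

theorem expect_add (ρ : ℝ) (f g : Finset (Fin n) → ℝ) :
    expect ρ (fun L => f L + g L) = expect ρ f + expect ρ g := by
  unfold expect
  rw [← Finset.sum_add_distrib]
  exact Finset.sum_congr rfl fun L _ => mul_add _ _ _

theorem expect_mul (ρ b : ℝ) (f : Finset (Fin n) → ℝ) :
    expect ρ (fun L => f L * b) = expect ρ f * b := by
  unfold expect
  rw [Finset.sum_mul]
  exact Finset.sum_congr rfl fun L _ => (mul_assoc _ _ _).symm

theorem expect_mono (h₀ : 0 ≤ ρ) (h₁ : ρ ≤ 1) {f g : Finset (Fin n) → ℝ} (h : ∀ L, f L ≤ g L) :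
    expect ρ f ≤ expect ρ g :=
  Finset.sum_le_sum fun L _ => mul_le_mul_of_nonneg_left (h L)
    (mul_nonneg (pow_nonneg h₀ _) (pow_nonneg (sub_nonneg.2 h₁) _))

theorem expect_sum {ι : Type*} (ρ : ℝ) (s : Finset ι) (f : ι → Finset (Fin n) → ℝ) :
    expect ρ (fun L => ∑ i ∈ s, f i L) = ∑ i ∈ s, expect ρ (f i) := by
  unfold expect
  rw [Finset.sum_comm]
  exact Finset.sum_congr rfl fun L _ => Finset.mul_sum _ _ _

open Classical in
/-- The probability of the event `p`. -/
def prob (ρ : ℝ) (p : Finset (Fin n) → Prop) : ℝ := expect ρ (fun L => if p L then 1 else 0)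

theorem prob_mono (h₀ : 0 ≤ ρ) (h₁ : ρ ≤ 1) {p q : Finset (Fin n) → Prop} (h : ∀ L, p L → q L) :
    prob ρ p ≤ prob ρ q := by
  refine expect_mono h₀ h₁ fun L => ?_
  by_cases hp : p L
  · simp [hp, h L hp]
  · simp only [hp, if_false]
    split_ifs <;> norm_num

/-- The probability that no landmark lies in `F`. -/
theorem prob_disjoint (ρ : ℝ) (F : Finset (Fin n)) :
    prob ρ (fun L => Disjoint F L) = (1 - ρ) ^ F.card := by
  unfold prob expect
  simp only [mul_ite, mul_one, mul_zero]
  rw [← Finset.sum_filter]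
  -- The binomial theorem over the subsets of the complement leaves one factor `1 - ρ` for each
  -- element of `F`.
  have hf : (Finset.univ.filter fun L => Disjoint F L) = Fᶜ.powerset := by
    ext L
    simp [Finset.subset_compl_iff_disjoint_left]
  have hn : Fᶜ.card + F.card = n := Finset.card_compl_add_card F |>.trans (Fintype.card_fin n)
  rw [hf]
  have : ∀ L ∈ Fᶜ.powerset, ρ ^ L.card * (1 - ρ) ^ (n - L.card) =
      ρ ^ L.card * (1 - ρ) ^ (Fᶜ.card - L.card) * (1 - ρ) ^ F.card := by
    intro L hL
    have := Finset.card_le_card (Finset.mem_powerset.1 hL)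
    rw [mul_assoc, ← pow_add]
    congr 2
    omega
  rw [Finset.sum_congr rfl this, ← Finset.sum_mul, Finset.sum_pow_mul_eq_add_pow]
  simp

theorem expect_card (ρ : ℝ) : expect (n := n) ρ (fun L => (L.card : ℝ)) = n * ρ := by
  classical
  have h : (fun L : Finset (Fin n) => (L.card : ℝ)) = fun L => ∑ v ∈ Finset.univ,
      (1 + (if Disjoint {v} L then 1 else 0) * (-1) : ℝ) := by
    funext L
    have : ∀ v, (1 + (if Disjoint {v} L then 1 else 0) * (-1) : ℝ) = if v ∈ L then 1 else 0 := by
      intro v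
      by_cases hv : v ∈ L <;> simp [hv]
    rw [Finset.sum_congr rfl fun v _ => this v]
    simp
  rw [h, expect_sum]
  have : ∀ v : Fin n, expect (n := n) ρ
      (fun L => (1 + (if Disjoint {v} L then 1 else 0) * (-1) : ℝ)) = ρ := by
    intro v
    rw [expect_add, expect_const, expect_mul]
    have := prob_disjoint ρ {v}
    rw [Finset.card_singleton, pow_one] at this
    have e : expect (n := n) ρ (fun L => if Disjoint {v} L then 1 else 0) = 1 - ρ := by
      rw [← this]
      unfold prob
      congr!
    rw [e]
    ring
  rw [Finset.sum_congr rfl fun v _ => this v]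
  simp

/-- The union bound, over a list counted with repetitions. -/
theorem prob_exists_le (h₀ : 0 ≤ ρ) (h₁ : ρ ≤ 1) {ι : Type*} (l : List ι)
    (p : ι → Finset (Fin n) → Prop) {b : ℝ} (h : ∀ i ∈ l, prob ρ (p i) ≤ b) :
    prob ρ (fun L => ∃ i ∈ l, p i L) ≤ l.length * b := by
  induction l with
  | nil =>
    simp only [prob, List.not_mem_nil, false_and, exists_false, if_false]
    simp [expect_const]
  | cons i l ih =>
    have h₂ := ih fun j hj => h j (List.mem_cons_of_mem _ hj)
    have h₃ := h i List.mem_cons_self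
    rw [List.length_cons, Nat.cast_succ, add_mul, one_mul, add_comm]
    refine le_trans ?_ (add_le_add h₃ h₂)
    unfold prob
    rw [← expect_add]
    refine expect_mono h₀ h₁ fun L => ?_
    by_cases hi : p i L
    · simp only [hi, if_true]
      split_ifs <;> norm_num
    · by_cases hl : ∃ j ∈ l, p j L
      · rw [if_pos hl, if_neg hi]
        split_ifs <;> norm_num
      · have : ¬ ∃ j ∈ i :: l, p j L := by
          rintro ⟨j, hj, hp⟩
          rcases List.mem_cons.1 hj with rfl | hj
          · exact hi hp
          · exact hl ⟨j, hj, hp⟩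
        rw [if_neg this, if_neg hl, if_neg hi]
        norm_num

theorem expect_le_of_split (h₀ : 0 ≤ ρ) (h₁ : ρ ≤ 1) {f : Finset (Fin n) → ℝ}
    {p : Finset (Fin n) → Prop} {b w q : ℝ} (hb : 0 ≤ b) (hw : 0 ≤ w)
    (hp : ∀ L, ¬ p L → f L ≤ b) (hf : ∀ L, f L ≤ w) (hq : prob ρ p ≤ q) :
    expect ρ f ≤ b + q * w := by
  refine le_trans ?_ (add_le_add_right (mul_le_mul_of_nonneg_right hq hw) b)
  unfold prob
  rw [← expect_mul]
  conv_rhs => rw [← expect_const (n := n) ρ b]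
  rw [← expect_add]
  refine expect_mono h₀ h₁ fun L => ?_
  by_cases h : p L
  · simp only [h, if_true]
    linarith [hf L]
  · simp only [h, if_false]
    linarith [hp L h]

end Expectation

namespace Network

variable {G : Network n} {m : ℕ}

/-- The probability that some ball of a query has more than `s` vertices. -/
theorem Regular.prob_large_ball_le (hG : G.Regular m) {ρ : ℝ} (h₀ : 0 ≤ ρ) (h₁ : ρ ≤ 1)
    (d : Fin n) (s r : ℕ) (w : Fin n) (t : ℝ) :
    prob ρ (fun L => ∃ y ∈ G.centers d r w t, ¬ G.SmallBall d L s y.2 y.1) ≤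
      (n * (2 * n + 1) + 1 : ℝ) ^ r * Real.exp (-(ρ * s)) := by
  refine (prob_exists_le h₀ h₁ _ (fun (y : ℝ × Fin n) L => ¬ G.SmallBall d L s y.2 y.1)
    (b := Real.exp (-(ρ * s))) fun y _ => ?_).trans ?_
  · rcases hG.exists_core d s y.2 y.1 with h | ⟨F, hF, h⟩
    · simp only [prob, h, not_true_eq_false, if_false]
      rw [expect_const]
      exact (Real.exp_pos _).le
    · refine (prob_mono h₀ h₁ h).trans ?_
      rw [prob_disjoint, hF]
      have : (1 - ρ) ≤ Real.exp (-ρ) := by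
        linarith [Real.add_one_le_exp (-ρ)]
      refine (pow_le_pow_left₀ (by linarith) this s).trans (le_of_eq ?_)
      rw [← Real.exp_nat_mul]
      congr 1
      ring
  · refine mul_le_mul_of_nonneg_right ?_ (Real.exp_pos _).le
    exact_mod_cast hG.centers_length d r w t

/-! ### Costs as polynomials -/

section Costs

variable {s N K : ℕ}

theorem dijkstraCost_le (hlog : Nat.log 2 (2 * n + 2) ≤ m) (hm : 1 ≤ m) (a : ℕ) :
    dijkstraCost m (2 * n) a ≤ 10 * m * (1 + a) := by
  unfold dijkstraCost
  have h₁ : (1 + a) * (2 * Nat.log 2 (2 * n + 2) + 2) ≤ (1 + a) * (4 * m) :=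
    Nat.mul_le_mul_left _ (by omega)
  have h₂ : a * (m + Nat.log 2 (2 * n + 2) + 3) ≤ a * (5 * m) :=
    Nat.mul_le_mul_left _ (by omega)
  nlinarith

theorem probeCost_le (hlog : Nat.log 2 (2 * n + 2) ≤ m) (hm : 1 ≤ m) (hn : 1 ≤ n) :
    probeCost n m ≤ 61 * (m * n) := by
  have h := dijkstraCost_le hlog hm (2 * n)
  unfold probeCost
  have h₁ : m ≤ m * n := Nat.le_mul_of_pos_right m hn
  have h₂ : n ≤ m * n := Nat.le_mul_of_pos_left n hm
  linarith

theorem bisectCost_le (hlog : Nat.log 2 (2 * n + 2) ≤ m) (hm : 1 ≤ m) (hn : 1 ≤ n) (hN : N ≤ m) :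
    bisectCost n m N ≤ 68 * (m ^ 2 * n) := by
  have h := probeCost_le hlog hm hn
  unfold bisectCost
  have h₁ : 1 ≤ m * n := Nat.mul_pos hm hn
  have h₂ : n ≤ m * n := Nat.le_mul_of_pos_left n hm
  calc N * (probeCost n m + 2 * n + 1) + (N + 1) * (1 + n)
      ≤ m * (64 * (m * n)) + (2 * m) * (2 * (m * n)) := by gcongr <;> omega
    _ = 68 * (m ^ 2 * n) := by ring

theorem summarySize_le (hm : 1 ≤ m) (hK : K ≤ m) (hN : N ≤ m) : summarySize K N ≤ 10 * m ^ 2 := by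
  unfold summarySize
  calc 2 * ((K + 1) * (N + 1) + 1) ≤ 2 * ((2 * m) * (2 * m) + m * m) := by
        gcongr
        · omega
        · omega
        · exact Nat.mul_pos hm hm
    _ = 10 * m ^ 2 := by ring

theorem summaryCost_le (hlog : Nat.log 2 (2 * n + 2) ≤ m) (hm : 1 ≤ m) (hn : 1 ≤ n) (hK : K ≤ m)
    (hN : N ≤ m) : summaryCost n m K N ≤ 400 * (m ^ 3 * n) := by
  have h₁ := probeCost_le hlog hm hn
  have h₂ := bisectCost_le hlog hm hn hN
  have h₃ := summarySize_le hm hK hN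
  have e₁ : m * n ≤ m ^ 2 * n := Nat.mul_le_mul_right _ (Nat.le_self_pow two_ne_zero m)
  have e₂ : m ^ 2 * n ≤ m ^ 3 * n :=
    Nat.mul_le_mul_right _ (Nat.pow_le_pow_right hm (by norm_num))
  have e₃ : n ≤ m * n := Nat.le_mul_of_pos_left n hm
  have e₄ : m ^ 2 ≤ m ^ 2 * n := Nat.le_mul_of_pos_right _ hn
  have h₄ : K * (K + 4) ≤ 5 * m ^ 2 := by
    calc K * (K + 4) ≤ m * (5 * m) := by gcongr; omega
      _ = 5 * m ^ 2 := by ring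
  have h₅ : (K + 1) * (probeCost n m + bisectCost n m N + n) ≤ 260 * (m ^ 3 * n) := by
    calc (K + 1) * (probeCost n m + bisectCost n m N + n)
        ≤ (2 * m) * (130 * (m ^ 2 * n)) := by gcongr <;> omega
      _ = 260 * (m ^ 3 * n) := by ring
  have h₆ : n * (2 * summarySize K N + 1) ≤ 21 * (m ^ 2 * n) := by
    have : 1 ≤ m ^ 2 := Nat.pow_pos hm
    calc n * (2 * summarySize K N + 1) ≤ n * (21 * m ^ 2) := by gcongr; omega
      _ = 21 * (m ^ 2 * n) := by ring
  unfold summaryCost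
  omega

theorem baseCost_le (hlog : Nat.log 2 (2 * n + 2) ≤ m) (hm : 1 ≤ m) (hn : 1 ≤ n)
    (hK : G.disconcavity ≤ m) (hB : G.numBreakpoints ≤ m * n) :
    G.baseCost m ≤ 40 * (m ^ 2 * n) := by
  have h := dijkstraCost_le hlog hm (2 * n)
  have e₁ : m * n ≤ m ^ 2 * n := Nat.mul_le_mul_right _ (Nat.le_self_pow two_ne_zero m)
  have e₂ : 1 ≤ m * n := Nat.mul_pos hm hn
  have e₃ : n ≤ m * n := Nat.le_mul_of_pos_left n hm
  have e₄ : m ≤ m * n := Nat.le_mul_of_pos_right m hn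
  have h₁ : dijkstraCost m (2 * n) (2 * n) ≤ 30 * (m * n) := by linarith
  have h₂ : G.disconcavity * (1 + dijkstraCost m (2 * n) (2 * n)) ≤ 31 * (m ^ 2 * n) := by
    calc G.disconcavity * (1 + dijkstraCost m (2 * n) (2 * n)) ≤ m * (31 * (m * n)) := by
          gcongr; omega
      _ = 31 * (m ^ 2 * n) := by ring
  unfold baseCost
  omega

theorem ballCost_le (hlog : Nat.log 2 (2 * n + 2) ≤ m) (hm : 1 ≤ m) (hs : 1 ≤ s)
    (hN : N ≤ 10 * m ^ 2) : ballCost n m N s ≤ 50 * (m ^ 2 * s) := by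
  have h := dijkstraCost_le hlog hm (2 * s)
  have e₁ : m * s ≤ m ^ 2 * s := Nat.mul_le_mul_right _ (Nat.le_self_pow two_ne_zero m)
  have e₂ : m ^ 2 ≤ m ^ 2 * s := Nat.le_mul_of_pos_right _ hs
  have e₃ : s ≤ m * s := Nat.le_mul_of_pos_left s hm
  have e₄ : m ≤ m * s := Nat.le_mul_of_pos_right m hs
  have h₁ : dijkstraCost m (2 * n) (2 * s) ≤ 30 * (m * s) := by linarith
  unfold ballCost growCost
  omega

/-- A ball costs O(m²s) and has O(s) successors, so each level of the recursion multiplies the cost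
by O(m²s). -/
theorem rqaCost_le (hlog : Nat.log 2 (2 * n + 2) ≤ m) (hm : 1 ≤ m) (hs : 1 ≤ s)
    (hN : N ≤ 10 * m ^ 2) (r : ℕ) : rqaCost n m N s r + 1 ≤ (60 * (m ^ 2 * s)) ^ (r + 1) := by
  have h := ballCost_le hlog hm hs hN
  have hms : 1 ≤ m ^ 2 * s := Nat.mul_pos (Nat.pow_pos hm) hs
  induction r with
  | zero =>
    rw [rqaCost, zero_add, pow_one]
    omega
  | succ r ih =>
    rw [rqaCost, pow_succ]
    have hX : 1 ≤ (60 * (m ^ 2 * s)) ^ (r + 1) := Nat.pow_pos (by omega)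
    have h₂ : (1 + 2 * s) * (1 + rqaCost n m N s r) ≤
        (3 * (m ^ 2 * s)) * (60 * (m ^ 2 * s)) ^ (r + 1) := by
      have : s ≤ m ^ 2 * s := Nat.le_mul_of_pos_left s (Nat.pow_pos hm)
      gcongr <;> omega
    have h₃ : 51 * (m ^ 2 * s) ≤ 51 * (m ^ 2 * s) * (60 * (m ^ 2 * s)) ^ (r + 1) :=
      Nat.le_mul_of_pos_right _ hX
    have h₄ : (60 * (m ^ 2 * s)) ^ (r + 1) * (60 * (m ^ 2 * s)) =
        6 * (m ^ 2 * s) * (60 * (m ^ 2 * s)) ^ (r + 1) +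
        (3 * (m ^ 2 * s) * (60 * (m ^ 2 * s)) ^ (r + 1) +
        51 * (m ^ 2 * s) * (60 * (m ^ 2 * s)) ^ (r + 1)) := by ring
    have h₅ := Nat.zero_le (6 * (m ^ 2 * s) * (60 * (m ^ 2 * s)) ^ (r + 1))
    omega

end Costs

end Network

/-! ## Polylogarithmic bounds -/

/-- The factor 2 suffices because ln 2 > 1/2. -/
theorem exp_le_two_pow {y : ℝ} {d : ℕ} (h : 2 * y ≤ d) : Real.exp y ≤ 2 ^ d := by
  have h₁ : Real.exp y ≤ Real.exp (d * Real.log 2) := by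
    refine Real.exp_le_exp.2 ?_
    have := Real.log_two_gt_d9
    have h₂ : (0 : ℝ) ≤ d := d.cast_nonneg
    nlinarith
  rwa [Real.exp_nat_mul, Real.exp_log two_pos] at h₁

theorem one_le_one_add_log (hn : 0 < n) : 1 ≤ 1 + Real.log n := by
  have : (1 : ℝ) ≤ n := by exact_mod_cast hn
  linarith [Real.log_nonneg this]

theorem exp_one_add_log_sub_one (hn : 0 < n) : Real.exp (1 + Real.log n - 1) = n := by
  rw [add_sub_cancel_left, Real.exp_log (by exact_mod_cast hn)]

theorem log_two_mul_add_two_le (hn : 0 < n) :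
    (Nat.log 2 (2 * n + 2) : ℝ) ≤ 2 * (1 + Real.log n) + 3 := by
  have h1 := one_le_one_add_log hn
  have h : 2 * n + 2 ≤ 2 ^ ⌈2 * (1 + (1 + Real.log n))⌉₊ := by
    have h₁ := exp_le_two_pow (Nat.le_ceil (2 * (1 + (1 + Real.log n))))
    have h₂ : (4 * n : ℝ) ≤ Real.exp (1 + (1 + Real.log n)) := by
      rw [Real.exp_add, Real.exp_add, Real.exp_log (by exact_mod_cast hn)]
      have := Real.add_one_le_exp (1 : ℝ)
      have hn' : (0 : ℝ) < n := by exact_mod_cast hn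
      nlinarith [mul_le_mul this this (by norm_num) (Real.exp_pos 1).le]
    have h₃ : (4 * n : ℝ) ≤ 2 ^ ⌈2 * (1 + (1 + Real.log n))⌉₊ := h₂.trans h₁
    have : 4 * n ≤ 2 ^ ⌈2 * (1 + (1 + Real.log n))⌉₊ := by exact_mod_cast h₃
    omega
  have h' := Nat.log_mono_right (b := 2) h
  rw [Nat.log_pow (by norm_num)] at h'
  have h₄ : (Nat.log 2 (2 * n + 2) : ℝ) ≤ ⌈2 * (1 + (1 + Real.log n))⌉₊ := by exact_mod_cast h'
  have := Nat.ceil_lt_add_one (a := 2 * (1 + (1 + Real.log n))) (by linarith)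
  linarith

theorem clog_le_of_le {B : ℝ} {c s : ℕ} (hn : 0 < n) (hB : 0 ≤ B)
    (hs : (s : ℝ) ≤ B * n * (1 + Real.log n) ^ c) :
    (Nat.clog 2 s : ℝ) ≤ 2 * ((B + 1 + c) * (1 + Real.log n)) + 1 := by
  obtain ⟨l, hl⟩ : ∃ l, l = 1 + Real.log n := ⟨_, rfl⟩
  have h1 : 1 ≤ l := hl ▸ one_le_one_add_log hn
  have hexp : Real.exp (l - 1) = n := hl ▸ exp_one_add_log_sub_one hn
  rw [← hl] at hs ⊢
  have hc₀ : (0 : ℝ) ≤ c := c.cast_nonneg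
  have h₁ : (s : ℝ) ≤ Real.exp ((B + 1 + c) * l) := by
    have e₁ : B ≤ Real.exp (B * l) := by
      have := Real.add_one_le_exp (B * l)
      nlinarith
    have e₂ : (n : ℝ) ≤ Real.exp l := by
      rw [← hexp]
      exact Real.exp_le_exp.2 (by linarith)
    have e₃ : l ^ c ≤ Real.exp (c * l) := by
      rw [Real.exp_nat_mul]
      exact pow_le_pow_left₀ (by linarith) (by linarith [Real.add_one_le_exp l]) c
    refine hs.trans ?_
    have : (B + 1 + c) * l = B * l + l + c * l := by ring
    rw [this, Real.exp_add, Real.exp_add]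
    gcongr
  have h₂ : s ≤ 2 ^ ⌈2 * ((B + 1 + c) * l)⌉₊ := by
    have := h₁.trans (exp_le_two_pow (Nat.le_ceil _))
    exact_mod_cast this
  have h₃ : (Nat.clog 2 s : ℝ) ≤ ⌈2 * ((B + 1 + c) * l)⌉₊ := by
    exact_mod_cast Nat.clog_le_of_le_pow h₂
  have := Nat.ceil_lt_add_one (a := 2 * ((B + 1 + c) * l)) (by positivity)
  linarith

namespace Network

variable {G : Network n}

theorem size_le_numBreakpoints (G : Network n) {u : Fin n} {e : Fin n × Profile G.T}
    (he : e ∈ G.out u) : e.2.pts.size ≤ G.numBreakpoints := by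
  unfold numBreakpoints
  refine le_trans ?_ (Finset.single_le_sum
    (f := fun u => ((G.out u).map (fun e => e.2.pts.size)).sum) (fun _ _ => Nat.zero_le _)
    (Finset.mem_univ u))
  exact List.le_sum_of_mem (List.mem_map.2 ⟨e, he, rfl⟩)

/-- All the parameters that enter the costs are polylogarithmic. -/
theorem exists_parameters {B lmin lmax ε : ℝ} (c : ℕ) (hB : 0 ≤ B) (h₀ : 0 ≤ lmin)
    (h₂ : 0 ≤ lmax) (hε : 0 < ε) :
    ∃ C : ℝ, 0 ≤ C ∧ ∀ (n : ℕ) (G : Network n), 0 < n → G.StronglyConnected → G.FIFO →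
      (∀ u, (G.out u).length ≤ 2) → G.BoundedSlopes lmin lmax →
      (G.disconcavity : ℝ) ≤ B * (1 + Real.log n) ^ c →
      (G.numBreakpoints : ℝ) ≤ B * n * (1 + Real.log n) ^ c →
      (∀ u, ∀ e ∈ G.out u, ∀ t : ℝ,
        Real.log (G.T / e.2.delay t) ≤ B * (1 + Real.log n) ^ c) →
      ∃ m N : ℕ, 1 ≤ m ∧ (m : ℝ) ≤ C * (1 + Real.log n) ^ (c + 1) ∧ G.Regular m ∧
        G.disconcavity ≤ m ∧ G.numBreakpoints ≤ m * n ∧ Nat.log 2 (2 * n + 2) ≤ m ∧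
        G.FewBisections ε N ∧ N ≤ m := by
  obtain ⟨j, hj⟩ := pow_unbounded_of_one_lt (1 / ε) (one_lt_two (α := ℝ))
  obtain ⟨M, hM⟩ : ∃ M, M = (lmax + lmin + 1) / (4 * ε) := ⟨_, rfl⟩
  have hM₀ : 0 < M := hM ▸ div_pos (by linarith) (by linarith)
  have hJ : (0 : ℝ) < 2 ^ j := by positivity
  have hc₀ : (0 : ℝ) ≤ c := c.cast_nonneg
  obtain ⟨C, hC⟩ : ∃ C, C = B + 5 + (2 * (B + 1 + c) + 3) +
    (2 * (2 * (M + B) + 1) * 2 ^ j + 1) := ⟨_, rfl⟩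
  have hC₀ : 0 ≤ C := by rw [hC]; positivity
  have hC₁ : B ≤ C := by
    have : 0 ≤ 5 + (2 * (B + 1 + c) + 3) + (2 * (2 * (M + B) + 1) * 2 ^ j + 1) := by positivity
    linarith
  have hC₂ : 5 ≤ C := by
    have : 0 ≤ B + (2 * (B + 1 + c) + 3) + (2 * (2 * (M + B) + 1) * 2 ^ j + 1) := by positivity
    linarith
  have hC₃ : 2 * (B + 1 + c) + 3 ≤ C := by
    have : 0 ≤ B + 5 + (2 * (2 * (M + B) + 1) * 2 ^ j + 1) := by positivity
    linarith
  have hC₄ : 2 * (2 * (M + B) + 1) * 2 ^ j + 1 ≤ C := by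
    have : 0 ≤ B + 5 + (2 * (B + 1 + c) + 3) := by positivity
    linarith
  refine ⟨C + 1, by linarith, ?_⟩
  intro n G hn hstrong hfifo hdeg hs hK hbp hlog
  have hl2 := log_two_mul_add_two_le hn
  have hclog : ∀ u, ∀ e ∈ G.out u, (Nat.clog 2 e.2.pts.size : ℝ) ≤
      2 * ((B + 1 + c) * (1 + Real.log n)) + 1 := by
    intro u e he
    refine clog_le_of_le hn hB (le_trans ?_ hbp)
    exact_mod_cast G.size_le_numBreakpoints he
  have h1 := one_le_one_add_log hn
  obtain ⟨l, hl⟩ : ∃ l, l = 1 + Real.log n := ⟨_, rfl⟩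
  rw [← hl] at hK hbp hlog hl2 hclog h1 ⊢
  have hn' : (0 : ℝ) < n := by exact_mod_cast hn
  have hμ₁ : 1 ≤ l ^ (c + 1) := one_le_pow₀ h1
  have hμ₂ : l ≤ l ^ (c + 1) := le_self_pow₀ h1 (Nat.succ_ne_zero c)
  have hμ₃ : l ^ c ≤ l ^ (c + 1) := pow_le_pow_right₀ h1 (Nat.le_succ c)
  obtain ⟨μ, hμ⟩ : ∃ μ, μ = l ^ (c + 1) := ⟨_, rfl⟩
  rw [← hμ] at hμ₁ hμ₂ hμ₃ ⊢
  have hle : ∀ x : ℕ, (x : ℝ) ≤ C * μ → x ≤ ⌈C * μ⌉₊ := fun x hx => by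
    exact_mod_cast hx.trans (Nat.le_ceil _)
  have hCμ : ∀ {x : ℝ}, x ≤ C → x * μ ≤ C * μ := fun h =>
    mul_le_mul_of_nonneg_right h (by linarith)
  have hBl : B * l ^ c ≤ B * μ := mul_le_mul_of_nonneg_left hμ₃ hB
  -- Enough halvings to bring length `T` down to the short length: the ratio of the two is at most
  -- `M * exp (B * l ^ c)`.
  obtain ⟨d, hd⟩ : ∃ d, d = ⌈2 * (M + B * l ^ c)⌉₊ := ⟨_, rfl⟩
  have hBl₀ : 0 ≤ B * l ^ c := mul_nonneg hB (pow_nonneg (by linarith) c)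
  have hd₁ : (d : ℝ) ≤ 2 * (M + B * l ^ c) + 1 :=
    hd ▸ (Nat.ceil_lt_add_one (by linarith)).le
  have hd₂ : Real.exp (M + B * l ^ c) ≤ 2 ^ d := exp_le_two_pow (hd ▸ Nat.le_ceil _)
  have hreg : G.Regular ⌈C * μ⌉₊ := by
    refine ⟨hstrong, hfifo, hdeg, fun u e he => hle _ ?_⟩
    have h₃ := hclog u e he
    have h₄ := hCμ hC₃
    have h₅ : 2 * ((B + 1 + c) * l) ≤ 2 * (B + 1 + c) * μ := by
      rw [← mul_assoc]
      exact mul_le_mul_of_nonneg_left hμ₂ (by positivity)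
    push_cast
    linarith
  refine ⟨⌈C * μ⌉₊, 2 * (d * 2 ^ j) + 1, ?_, ?_, hreg, ?_, ?_, ?_, ?_, ?_⟩
  · refine hle 1 ?_
    push_cast
    have := hCμ hC₂
    linarith
  · have := Nat.ceil_lt_add_one (a := C * μ) (by positivity)
    linarith
  · exact hle _ (by linarith [hCμ hC₁])
  · have h₃ := Nat.le_ceil (C * μ)
    have h₄ : (G.numBreakpoints : ℝ) ≤ ⌈C * μ⌉₊ * n := by
      have : B * l ^ c ≤ ⌈C * μ⌉₊ := by linarith [hCμ hC₁]
      have := mul_le_mul_of_nonneg_right this hn'.le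
      linarith
    exact_mod_cast h₄
  · exact hle _ (by linarith [hCμ hC₂])
  -- The logarithmic bound on `T / delay` is a lower bound for all delays, and hence for travel
  -- times between distinct vertices.
  · refine hreg.fewBisections hs h₀ h₂ hε (δ := G.T * Real.exp (-(B * l ^ c))) ?_ ?_ ?_
    · intro u e he t
      have hT := G.T_pos
      have hD := e.2.delay_pos hT t
      have h₃ := hlog u e he t
      rw [Real.log_le_iff_le_exp (div_pos hT hD), div_le_iff₀ hD] at h₃
      rw [Real.exp_neg, ← div_eq_mul_inv, div_le_iff₀ (Real.exp_pos _)]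
      linarith
    · rw [div_lt_iff₀ hε] at hj
      linarith
    · have hT := G.T_pos
      have h₃ : M ≤ 2 ^ d * Real.exp (-(B * l ^ c)) := by
        rw [Real.exp_neg, ← div_eq_mul_inv, le_div_iff₀ (Real.exp_pos _)]
        refine le_trans ?_ hd₂
        rw [Real.exp_add]
        refine mul_le_mul_of_nonneg_right ?_ (Real.exp_pos _).le
        linarith [Real.add_one_le_exp M]
      have h₄ : lmax + lmin + 1 = M * (4 * ε) := by
        rw [hM]
        field_simp
      rw [h₄]
      have := mul_le_mul_of_nonneg_right h₃ (by positivity : 0 ≤ 4 * ε * G.T)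
      linarith
  · refine hle _ ?_
    push_cast
    have h₃ : (d : ℝ) ≤ (2 * (M + B) + 1) * μ := by nlinarith
    have h₄ := mul_le_mul_of_nonneg_right h₃ hJ.le
    have := hCμ hC₄
    linarith

end Network

open Asymptotics Filter in
-- The gap between the exponents is split into `k + 1` equal parts: each logarithm is absorbed by
-- one, and the last makes the quotient tend to 0.
theorem isLittleO_rpow_mul_log_pow (C : ℝ) (k : ℕ) {b p : ℝ} (h : b < p) :
    (fun n : ℕ => C * (n : ℝ) ^ b * (1 + Real.log n) ^ k) =o[atTop] (fun n : ℕ => (n : ℝ) ^ p) := by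
  obtain ⟨s, hs⟩ : ∃ s, s = (p - b) / (k + 1) := ⟨_, rfl⟩
  have hs₀ : 0 < s := hs ▸ div_pos (by linarith) (by positivity)
  have hlog : (fun x : ℝ => 1 + Real.log x) =o[atTop] fun x => x ^ s := by
    refine IsLittleO.add ?_ (isLittleO_log_rpow_atTop hs₀)
    rw [isLittleO_const_left]
    right
    exact tendsto_norm_atTop_atTop.comp (tendsto_rpow_atTop hs₀)
  have h₁ : (fun x : ℝ => C * x ^ b * (1 + Real.log x) ^ k) =O[atTop] fun x => x ^ (p - s) := by
    have h₂ := ((isBigO_refl (fun x : ℝ => x ^ b) atTop).const_mul_left C).mul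
      (hlog.isBigO.pow k)
    refine h₂.congr' EventuallyEq.rfl ?_
    filter_upwards [eventually_gt_atTop 0] with x hx
    rw [← Real.rpow_natCast, ← Real.rpow_mul hx.le, ← Real.rpow_add hx]
    congr 1
    have : (p - b) = s * (k + 1) := by
      rw [hs]
      field_simp
    linarith
  have h₂ : (fun x : ℝ => x ^ (p - s)) =o[atTop] fun x : ℝ => x ^ p := by
    refine isLittleO_of_tendsto' ?_ ((tendsto_rpow_neg_atTop hs₀).congr' ?_)
    · filter_upwards [eventually_gt_atTop 0] with x hx h
      exact absurd h (Real.rpow_pos_of_pos hx p).ne'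
    · filter_upwards [eventually_gt_atTop 0] with x hx
      rw [← Real.rpow_sub hx]
      congr 1
      ring
  exact (h₁.trans_isLittleO h₂).comp_tendsto tendsto_natCast_atTop_atTop

/-! ### Expected space, preprocessing time and query time. -/

namespace Network

variable {G : Network n} {m : ℕ}

theorem space_bound {K N : ℕ} (hm : 1 ≤ m) (hn : 1 ≤ n) (hK : K ≤ m)
    (hB : G.numBreakpoints ≤ m * n) (hN : N ≤ m) (x : ℕ) :
    6 * n + 2 * G.numBreakpoints + x * (n * (1 + 2 * summarySize K N)) ≤
      40 * (m ^ 2 * n) + x * (400 * (m ^ 3 * n)) := by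
  have h := summarySize_le hm hK hN
  have e₁ : m * n ≤ m ^ 2 * n := Nat.mul_le_mul_right _ (Nat.le_self_pow two_ne_zero m)
  have e₂ : m ^ 2 * n ≤ m ^ 3 * n :=
    Nat.mul_le_mul_right _ (Nat.pow_le_pow_right hm (by norm_num))
  have e₃ : n ≤ m * n := Nat.le_mul_of_pos_left n hm
  have h₁ : n * (1 + 2 * summarySize K N) ≤ 21 * (m ^ 2 * n) := by
    have : 1 ≤ m ^ 2 := Nat.pow_pos hm
    calc n * (1 + 2 * summarySize K N) ≤ n * (21 * m ^ 2) := by gcongr; omega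
      _ = 21 * (m ^ 2 * n) := by ring
  refine Nat.add_le_add (by omega) (Nat.mul_le_mul_left _ (by omega))

/-- The expected number of landmarks is n^(1-a). The fixed term, linear in `n`, is dominated because
2 - a ≥ 1. -/
theorem expect_landmark_cost_le (hn : 0 < n) {a C : ℝ} (ha : a ≤ 1) {c : ℕ}
    (hm : (m : ℝ) ≤ C * (1 + Real.log n) ^ c) (hm₁ : 1 ≤ m) (ha₀ : 0 ≤ a) {f : Finset (Fin n) → ℕ}
    (hf : ∀ L, f L ≤ 40 * (m ^ 2 * n) + L.card * (400 * (m ^ 3 * n))) :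
    expect ((n : ℝ) ^ (-a)) (fun L => (f L : ℝ)) ≤
      440 * C ^ 3 * (n : ℝ) ^ (2 - a) * (1 + Real.log n) ^ (c * 3) := by
  have hl := one_le_one_add_log hn
  have hn₁ : (1 : ℝ) ≤ n := by exact_mod_cast hn
  have hn₀ : (0 : ℝ) < n := by exact_mod_cast hn
  have hm₁' : (1 : ℝ) ≤ m := by exact_mod_cast hm₁
  have hρ₁ : (n : ℝ) ^ (-a) ≤ 1 := Real.rpow_le_one_of_one_le_of_nonpos hn₁ (by linarith)
  have hf' : ∀ L, (f L : ℝ) ≤ 40 * ((m : ℝ) ^ 2 * n) + (L.card : ℝ) * (400 * ((m : ℝ) ^ 3 * n)) :=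
    fun L => by exact_mod_cast hf L
  have h := expect_mono (by positivity) hρ₁ hf'
  rw [expect_add, expect_const, expect_mul, expect_card] at h
  have hpow : (n : ℝ) ^ (2 - a) = n * (n : ℝ) ^ (-a) * n := by
    rw [sub_eq_add_neg, Real.rpow_add hn₀, Real.rpow_two]
    ring
  have hle : (n : ℝ) ≤ (n : ℝ) ^ (2 - a) := by
    conv_lhs => rw [← Real.rpow_one (n : ℝ)]
    exact Real.rpow_le_rpow_of_exponent_le hn₁ (by linarith)
  have hm₂ : (m : ℝ) ^ 2 ≤ (m : ℝ) ^ 3 := pow_le_pow_right₀ hm₁' (by norm_num)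
  have hm₃ : (m : ℝ) ^ 3 ≤ C ^ 3 * (1 + Real.log n) ^ (c * 3) := by
    rw [pow_mul, ← mul_pow]
    exact pow_le_pow_left₀ (by positivity) hm 3
  have h₁ : (m : ℝ) ^ 2 * n ≤ (m : ℝ) ^ 3 * (n : ℝ) ^ (2 - a) := by gcongr
  have h₂ := mul_le_mul_of_nonneg_right hm₃ (by positivity : 0 ≤ 440 * (n : ℝ) ^ (2 - a))
  calc expect ((n : ℝ) ^ (-a)) (fun L => (f L : ℝ))
      ≤ 40 * ((m : ℝ) ^ 2 * n) + n * (n : ℝ) ^ (-a) * (400 * ((m : ℝ) ^ 3 * n)) := h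
    _ = 40 * ((m : ℝ) ^ 2 * n) + 400 * ((m : ℝ) ^ 3 * (n : ℝ) ^ (2 - a)) := by
        rw [hpow]
        ring
    _ ≤ 440 * C ^ 3 * (n : ℝ) ^ (2 - a) * (1 + Real.log n) ^ (c * 3) := by linarith

theorem expect_query_cost_le (hG : G.Regular m) (hn : 0 < n) {a C : ℝ} (ha : 0 ≤ a)
    {c N r : ℕ} (hm : 1 ≤ m) (hmC : (m : ℝ) ≤ C * (1 + Real.log n) ^ c)
    (hlog : Nat.log 2 (2 * n + 2) ≤ m) (hN : N ≤ 10 * m ^ 2) (o d : Fin n) (t : ℝ)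
    {Q : Finset (Fin n) → ℕ} (hQ : ∀ L, Q L ≤ rqaCost n m N n r + 1)
    (hQ' : ∀ L s, (∀ y ∈ G.centers d r o t, G.SmallBall d L s y.2 y.1) →
      Q L ≤ rqaCost n m N s r + 1) :
    expect ((n : ℝ) ^ (-a)) (fun L => (Q L : ℝ)) ≤
      60 ^ (r + 1) * C ^ (2 * (r + 1)) * ((3 * r + 2) ^ (r + 1) + 4 ^ r) *
        (n : ℝ) ^ ((1 + (r : ℝ)) * a) * (1 + Real.log n) ^ (c * (2 * (r + 1)) + (r + 1)) := by
  have hl := one_le_one_add_log hn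
  have hn₁ : (1 : ℝ) ≤ n := by exact_mod_cast hn
  have hn₀ : (0 : ℝ) < n := by exact_mod_cast hn
  have hρ₀ : 0 ≤ (n : ℝ) ^ (-a) := by positivity
  have hρ₁ : (n : ℝ) ^ (-a) ≤ 1 := Real.rpow_le_one_of_one_le_of_nonpos hn₁ (by linarith)
  obtain ⟨X, hX⟩ : ∃ X, X = (n : ℝ) ^ a * (1 + Real.log n) := ⟨_, rfl⟩
  have hX₁ : 1 ≤ X := by
    rw [hX]
    exact one_le_mul_of_one_le_of_one_le (Real.one_le_rpow hn₁ ha) hl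
  have hXr : X ^ (r + 1) = (n : ℝ) ^ ((1 + (r : ℝ)) * a) * (1 + Real.log n) ^ (r + 1) := by
    rw [hX, mul_pow, ← Real.rpow_natCast, ← Real.rpow_mul hn₀.le]
    congr 2
    push_cast
    ring
  -- With this `s`, a given ball is larger with probability at most n^-(3r+1). This pays for the
  -- O(n^(2r)) centers and for the worst-case cost of order n^(r+1).
  obtain ⟨s, hs⟩ : ∃ s, s = ⌈(3 * r + 1) * X⌉₊ := ⟨_, rfl⟩
  have hs₁ : (3 * r + 1) * X ≤ s := hs ▸ Nat.le_ceil _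
  have hs₂ : (s : ℝ) ≤ (3 * r + 2) * X := by
    have := Nat.ceil_lt_add_one (a := (3 * r + 1) * X) (by positivity)
    rw [← hs] at this
    linarith
  have hs₃ : 1 ≤ s := by
    have : 0 < s := by
      rw [hs, Nat.ceil_pos]
      positivity
    exact this
  have hexp : Real.exp (-((n : ℝ) ^ (-a) * s)) ≤ ((n : ℝ) ^ (3 * r + 1))⁻¹ := by
    rw [Real.exp_neg]
    refine inv_anti₀ (by positivity) ?_
    have h₁ : ((3 * r + 1 : ℕ) : ℝ) * Real.log n ≤ (n : ℝ) ^ (-a) * s := by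
      have h₂ := mul_le_mul_of_nonneg_left hs₁ hρ₀
      have h₃ : (n : ℝ) ^ (-a) * ((3 * r + 1) * X) = (3 * r + 1) * (1 + Real.log n) := by
        have : (n : ℝ) ^ (-a) * (n : ℝ) ^ a = 1 := by
          rw [← Real.rpow_add hn₀, neg_add_cancel, Real.rpow_zero]
        rw [hX]
        linear_combination (3 * r + 1) * (1 + Real.log n) * this
      rw [h₃] at h₂
      refine le_trans ?_ h₂
      push_cast
      refine mul_le_mul_of_nonneg_left ?_ (by positivity)
      linarith
    calc (n : ℝ) ^ (3 * r + 1) = Real.exp ((3 * r + 1 : ℕ) * Real.log n) := by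
          rw [Real.exp_nat_mul, Real.exp_log hn₀]
      _ ≤ _ := Real.exp_le_exp.2 h₁
  have hprob := (hG.prob_large_ball_le hρ₀ hρ₁ d s r o t).trans
    (mul_le_mul (pow_le_pow_left₀ (by positivity)
      (show (n * (2 * n + 1) + 1 : ℝ) ≤ 4 * n ^ 2 by nlinarith) r) hexp (Real.exp_pos _).le
      (by positivity))
  have hgood : ∀ L, ¬ (∃ y ∈ G.centers d r o t, ¬ G.SmallBall d L s y.2 y.1) →
      (Q L : ℝ) ≤ (60 * ((m : ℝ) ^ 2 * s)) ^ (r + 1) := by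
    intro L hL
    push Not at hL
    exact_mod_cast (hQ' L s hL).trans (rqaCost_le hlog hm hs₃ hN r)
  have hbad : ∀ L, (Q L : ℝ) ≤ (60 * ((m : ℝ) ^ 2 * n)) ^ (r + 1) := fun L => by
    exact_mod_cast (hQ L).trans (rqaCost_le hlog hm hn hN r)
  have h := expect_le_of_split hρ₀ hρ₁ (by positivity) (by positivity) hgood hbad hprob
  have hM : ((m : ℝ) ^ 2) ^ (r + 1) ≤
      C ^ (2 * (r + 1)) * (1 + Real.log n) ^ (c * (2 * (r + 1))) := by
    rw [← pow_mul, pow_mul (1 + Real.log n), ← mul_pow]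
    exact pow_le_pow_left₀ (by positivity) hmC _
  have h₁ : (60 * ((m : ℝ) ^ 2 * s)) ^ (r + 1) ≤
      60 ^ (r + 1) * ((m : ℝ) ^ 2) ^ (r + 1) * ((3 * r + 2) ^ (r + 1) * X ^ (r + 1)) := by
    rw [← mul_pow, ← mul_pow, ← mul_pow, mul_assoc]
    gcongr
  -- The powers of `n` cancel exactly: 2r - (3r+1) + (r+1) = 0.
  have h₂ : (4 * (n : ℝ) ^ 2) ^ r * ((n : ℝ) ^ (3 * r + 1))⁻¹ *
      (60 * ((m : ℝ) ^ 2 * n)) ^ (r + 1) = 60 ^ (r + 1) * ((m : ℝ) ^ 2) ^ (r + 1) * 4 ^ r := by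
    have : (n : ℝ) ^ (3 * r + 1) ≠ 0 := by positivity
    field_simp
    ring
  have h₃ : (4 : ℝ) ^ r ≤ 4 ^ r * X ^ (r + 1) :=
    le_mul_of_one_le_right (by positivity) (one_le_pow₀ hX₁)
  calc expect ((n : ℝ) ^ (-a)) (fun L => (Q L : ℝ))
      ≤ 60 ^ (r + 1) * ((m : ℝ) ^ 2) ^ (r + 1) * ((3 * r + 2) ^ (r + 1) * X ^ (r + 1)) +
        60 ^ (r + 1) * ((m : ℝ) ^ 2) ^ (r + 1) * 4 ^ r := by
        rw [h₂] at h
        linarith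
    _ ≤ 60 ^ (r + 1) * ((m : ℝ) ^ 2) ^ (r + 1) * ((3 * r + 2) ^ (r + 1) * X ^ (r + 1)) +
        60 ^ (r + 1) * ((m : ℝ) ^ 2) ^ (r + 1) * (4 ^ r * X ^ (r + 1)) := by gcongr
    _ = ((m : ℝ) ^ 2) ^ (r + 1) *
        (60 ^ (r + 1) * ((3 * r + 2) ^ (r + 1) + 4 ^ r) * X ^ (r + 1)) := by ring
    _ ≤ C ^ (2 * (r + 1)) * (1 + Real.log n) ^ (c * (2 * (r + 1))) *
        (60 ^ (r + 1) * ((3 * r + 2) ^ (r + 1) + 4 ^ r) * X ^ (r + 1)) := by gcongr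
    _ = _ := by
        rw [hXr, pow_add]
        ring

end Network

end TDOracle

end

/-! ### The main theorem. -/

theorem mainTheorem4 (r : ℕ) (a ε ζ lmin lmax : ℝ) (B : ℝ) (c : ℕ)
    (ha : 0 < a) (ha' : a < 1 / ((r : ℝ) + 1)) (hε : 0 < ε) (hζ : 1 ≤ ζ)
    (hmin : 0 ≤ lmin) (hmin' : lmin < 1) (hmax : 0 ≤ lmax) :
    1 < TDOracle.gam ε ζ lmax r ∧
    ∃ (C : ℝ) (k : ℕ),
      -- the two bounds below are subquadratic and sublinear
      ((fun n : ℕ => C * (n : ℝ) ^ (2 - a) * (1 + Real.log n) ^ k)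
          =o[Filter.atTop] (fun n : ℕ => (n : ℝ) ^ 2)) ∧
      ((fun n : ℕ => C * (n : ℝ) ^ ((1 + (r : ℝ)) * a) * (1 + Real.log n) ^ k)
          =o[Filter.atTop] (fun n : ℕ => (n : ℝ))) ∧
      ∀ (n : ℕ) (G : TDOracle.Network n), 0 < n →
        G.StronglyConnected → G.FIFO → (∀ u, (G.out u).length ≤ 2) →
        G.BoundedSlopes lmin lmax → G.BoundedOpposite ζ →
        (G.disconcavity : ℝ) ≤ B * (1 + Real.log n) ^ c →
        (G.numBreakpoints : ℝ) ≤ B * n * (1 + Real.log n) ^ c →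
        (∀ u, ∀ e ∈ G.out u, ∀ t : ℝ,
          Real.log (G.T / e.2.delay t) ≤ B * (1 + Real.log n) ^ c) →
        -- `O L` is the oracle built for the landmark set `L`, and `P L` the time spent
        ∃ (O : Finset (Fin n) → TDOracle.Oracle n) (P : Finset (Fin n) → ℕ),
          (∀ L, (TDOracle.preprocess G ε L).run 0 = some (O L, P L)) ∧
          TDOracle.expect ((n : ℝ) ^ (-a)) (fun L => (TDOracle.space G (O L) : ℝ))
            ≤ C * (n : ℝ) ^ (2 - a) * (1 + Real.log n) ^ k ∧
          TDOracle.expect ((n : ℝ) ^ (-a)) (fun L => (P L : ℝ))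
            ≤ C * (n : ℝ) ^ (2 - a) * (1 + Real.log n) ^ k ∧
          ∀ (o d : Fin n), ∀ t ∈ Set.Ico 0 G.T,
            -- the query returns `A L` in time `Q L`
            ∃ (A : Finset (Fin n) → ℝ) (Q : Finset (Fin n) → ℕ),
              (∀ L, (TDOracle.query G (O L) r o d t).run 0 = some (A L, Q L)) ∧
              (∀ L, G.dist o d t ≤ A L ∧
                A L ≤ (1 + TDOracle.gam ε ζ lmax r * ε) * G.dist o d t) ∧
              TDOracle.expect ((n : ℝ) ^ (-a)) (fun L => (Q L : ℝ))
                ≤ C * (n : ℝ) ^ ((1 + (r : ℝ)) * a) * (1 + Real.log n) ^ k := by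
  refine ⟨TDOracle.one_lt_gam hε hζ hmax r, ?_⟩
  have hr : (0 : ℝ) ≤ r := r.cast_nonneg
  have ha₁ : (1 + (r : ℝ)) * a < 1 := by
    rw [lt_div_iff₀ (by linarith)] at ha'
    linarith
  have ha₂ : a ≤ 1 := by nlinarith
  -- The sign of `B` is not prescribed; its absolute value serves as a nonnegative bound.
  obtain ⟨C, hC, H⟩ := TDOracle.Network.exists_parameters c (abs_nonneg B) hmin hmax hε
  obtain ⟨C₁, hC₁⟩ : ∃ C₁ : ℝ, C₁ = 440 * C ^ 3 := ⟨_, rfl⟩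
  obtain ⟨C₂, hC₂⟩ : ∃ C₂ : ℝ, C₂ = 60 ^ (r + 1) * C ^ (2 * (r + 1)) *
    ((3 * r + 2) ^ (r + 1) + 4 ^ r) := ⟨_, rfl⟩
  have hC₁₀ : 0 ≤ C₁ := by rw [hC₁]; positivity
  have hC₂₀ : 0 ≤ C₂ := by rw [hC₂]; positivity
  obtain ⟨k, hk⟩ : ∃ k, k = (c + 1) * 3 + ((c + 1) * (2 * (r + 1)) + (r + 1)) := ⟨_, rfl⟩
  refine ⟨C₁ + C₂, k, ?_, ?_, ?_⟩
  · simpa using TDOracle.isLittleO_rpow_mul_log_pow (C₁ + C₂) k (show 2 - a < 2 by linarith)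
  · simpa using TDOracle.isLittleO_rpow_mul_log_pow (C₁ + C₂) k ha₁
  intro n G hn hstrong hfifo hdeg hs ho hK hbp hlog
  have hl₁ := TDOracle.one_le_one_add_log hn
  have hn₁ : (1 : ℝ) ≤ n := by exact_mod_cast hn
  have hB : B * (1 + Real.log n) ^ c ≤ |B| * (1 + Real.log n) ^ c :=
    mul_le_mul_of_nonneg_right (le_abs_self B) (by positivity)
  obtain ⟨m, N, hm, hmC, hreg, hKm, hbpm, hlogm, hfew, hNm⟩ := H n G hn hstrong hfifo hdeg hs
    (hK.trans hB) (hbp.trans (by nlinarith)) fun u e he t => (hlog u e he t).trans hB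
  have hρ₀ : 0 ≤ (n : ℝ) ^ (-a) := by positivity
  have hρ₁ : (n : ℝ) ^ (-a) ≤ 1 := Real.rpow_le_one_of_one_le_of_nonpos hn₁ (by linarith)
  have hbound : ∀ {x : ℝ}, ∀ {D p : ℝ} {i : ℕ}, D ≤ C₁ + C₂ → i ≤ k →
      x ≤ D * (n : ℝ) ^ p * (1 + Real.log n) ^ i →
      x ≤ (C₁ + C₂) * (n : ℝ) ^ p * (1 + Real.log n) ^ k := by
    intro x D p i hD hi hx
    refine hx.trans ?_
    have : (1 + Real.log n) ^ i ≤ (1 + Real.log n) ^ k := pow_le_pow_right₀ hl₁ hi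
    have : 0 ≤ (1 + Real.log n) ^ i := by positivity
    gcongr
  choose O P hP hPle hO using
    fun L => hreg.preprocess_runs hs hmin hmin' hmax hε hfew L
  refine ⟨O, P, fun L => by simpa using hP L 0, ?_, ?_, ?_⟩
  · refine hbound (D := C₁) (by linarith) (i := (c + 1) * 3) (by omega)
      (hC₁ ▸ TDOracle.Network.expect_landmark_cost_le hn ha₂ hmC hm ha.le (fun L => ?_))
    exact (TDOracle.Network.space_le hreg (hO L)).trans
      (TDOracle.Network.space_bound hm hn hKm hbpm hNm L.card)
  · refine hbound (D := C₁) (by linarith) (i := (c + 1) * 3) (by omega)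
      (hC₁ ▸ TDOracle.Network.expect_landmark_cost_le hn ha₂ hmC hm ha.le (fun L => ?_))
    refine (hPle L).trans (Nat.add_le_add
      (TDOracle.Network.baseCost_le hlogm hm hn hKm hbpm) (Nat.mul_le_mul_left _
      (TDOracle.Network.summaryCost_le hlogm hm hn hKm hNm)))
  · intro o d t _
    -- The trivial ball size `n` fixes answer and running time for every landmark set, with the
    -- deterministic guarantee.
    have hquery := fun L => hreg.query_runs hs hmax hε hζ ho (hO L) o d n r t
      fun y _ => G.smallBall_card d L y.2 y.1
    choose A Q hQ hQle hA using hquery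
    refine ⟨A, Q, fun L => by simpa using hQ L 0, hA, ?_⟩
    refine hbound (D := C₂) (by linarith)
      (i := (c + 1) * (2 * (r + 1)) + (r + 1)) (by omega) (hC₂ ▸ TDOracle.Network.expect_query_cost_le hreg hn ha.le
      hm hmC hlogm (TDOracle.Network.summarySize_le hm hKm hNm) o d t hQle fun L s hsmall => ?_)
    -- By determinism, the sharper cost for small balls applies to the run already named.
    exact ((hreg.query_runs hs hmax hε hζ ho (hO L) o d s r t hsmall).post (hQ L)).1
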